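/- A planar 4-web on an open set $U\subset\mathbb R^2$ is given by four smooth 1-forms $\omega_1,\dots,\omega_4$ on $U$ which are pairwise linearly independent at every point (the leaves of the $i$-th foliation are the integral curves of $\ker\omega_i$). The forms may be rescaled by nonvanishing smooth functions; fix any normalization $\omega_1+\omega_2+\omega_3=0$, $a\,\omega_1+\omega_2+\omega_4=0$ with a smooth function $a$ (then $a\neq0,1$ everywhere). The rank of the web at a point $p$ is the dimension of the space of germs at $p$ of smooth quadruples $(\lambda_1,\dots,\lambda_4)$ with $\sum_i\lambda_i\omega_i=0$ and $d(\lambda_i\omega_i)=0$ for all $i$. Let $\partial_1,\partial_2$ be the frame dual to $\omega_1,\omega_2$. Let $\gamma=g_1\omega_1+g_2\omega_2$ be the 1-form with $d\omega_i=\omega_i\wedge\gamma$ for $i=1,2$, and let $K$ be defined by $d\gamma=K\,\omega_1\wedge\omega_2$. For a function $u$ of weight $k$ put $\delta_i u=\partial_i u-k\,g_i u$; this has weight $k+1$. Subscripts (after a comma, if there are other subscripts) denote these covariant derivatives. The weights are: $a$: 0, $K$: 2, $c_0$: 2, $c_1,c_2$: 3, $G_{ij}$: 6. Thus $a_i=\delta_ia$,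 $a_{12}=\delta_1\delta_2a=\delta_2\delta_1a$, $a_{ii}=\delta_i\delta_i a$, while $a_{112}$ and $a_{122}$ are the symmetrized third derivatives, $a_{112}=\frac13(\delta_2\delta_1\delta_1+\delta_1\delta_2\delta_1+\delta_1\delta_1\delta_2)a$, $a_{122}=\frac13(\delta_1\delta_2\delta_2+\delta_2\delta_1\delta_2+\delta_2\delta_2\delta_1)a$; further $c_{i,j}=\delta_jc_i$, $c_{i,11}=\delta_1\delta_1c_i$, $c_{i,12}=\delta_2\delta_1c_i$, $G_{ij,k}=\delta_kG_{ij}$. Put $$c_0=K+\frac{a_{11}-aa_{22}-2(1-a)a_{12}}{4a(1-a)}+\frac{(2a-1)a_1^2-a^2a_2^2+2(1-a)^2a_1a_2}{4(1-a)^2a^2},$$ $$c_1=\frac{K_2-K_1}{4(1-a)}+\frac{(a-4)a_1+(11-20a+12a^2)a_2}{12(1-a)^2a}K+\frac{a_{112}-a_{122}}{4a(1-a)}+\frac{a_1-aa_2}{4a^2(1-a)}a_{22}+\frac{(2a-1)(a_1-aa_2)}{4(1-a)^2a^2}a_{12}-\frac{a_2^2\left((1-2a)a_1+aa_2\right)}{4(1-a)^2a^2},$$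 $$c_2=\frac{aK_2-K_1}{4a(1-a)}+\frac{(1-2a)a_1-(a-2)aa_2}{4(1-a)^2a^2}K,$$ $$G_{11}=ac_0(c_{2,2}-c_{2,1})+ac_2(c_{0,1}-c_{0,2})-a(1-a)c_1c_2+(2a_2-a_1-aa_2)c_0c_2-Kc_0^2,$$ $$G_{12}=ac_0(c_{1,2}-c_{1,1})+ac_1(c_{0,1}-c_{0,2})-a(1-a)c_1^2+(2a_2-a_1-2aa_2)c_0c_1+(a_2^2+a_{12}-a_{22})c_0^2,$$ $$G_{21}=c_0(c_{2,1}-ac_{2,2})+c_2(ac_{0,2}-c_{0,1})-2a_2c_0c_2+a(1-a)c_2^2,$$ $$G_{22}=c_0(c_{1,1}-ac_{1,2})+c_1(ac_{0,2}-c_{0,1})+a(1-a)c_1c_2-a_2c_0c_1-a_2(1-a)c_0c_2+(a_{22}-K)c_0^2,$$ $$J_1=a_2c_1c_2(c_1-c_2)+ac_2^2(c_{1,2}-c_{1,1})+c_1c_2\left(c_{1,1}+a(c_{2,1}-c_{1,2}-c_{2,2})\right)+c_1^2(ac_{2,2}-c_{2,1}),$$ $$J_2=c_1^2(c_1-c_2)^2K+(c_{1,11}-c_{1,12})c_1c_2(c_2-c_1)+c_1^2(c_1-c_2)(c_{2,11}-c_{2,12})-c_2(2c_1-c_2)c_{1,1}(c_{1,2}-c_{1,1})+c_1^2c_{2,1}(c_{1,2}-c_{2,2}+c_{2,1})+c_1^2c_{1,1}(c_{2,2}-2c_{2,1}),$$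 $$J_3=(a_{22}-a_{12})(1-a)+a_2(a_2-a_1)-(1-a)^2K,\qquad J_4=a_{12}a-a_1a_2-Ka^2,$$ $$J_{10}=G_{11}G_{22}-G_{21}G_{12},$$ $$J_{11}=c_0(G_{21,1}G_{22}-G_{22,1}G_{21})+(a_2c_0-ac_1)G_{21}^2+(ac_2-a_2c_0+ac_1)G_{21}G_{22}-ac_2G_{22}^2,$$ $$J_{12}=c_0(G_{21,2}G_{22}-G_{22,2}G_{21})+(a_2c_0-ac_1)G_{21}^2+(ac_2+c_1)G_{21}G_{22}-c_2G_{22}^2.$$ **Theorem.** Let $p\in U$ be a regular point in the following sense: $c_0$ is either identically zero near $p$ or nonzero at $p$, and, if $c_0\equiv0$ near $p$, each of $c_1$ and $c_1-c_2$ is also either identically zero near $p$ or nonzero at $p$ (such points form a dense open subset of $U$). Below, an equation means an identity near $p$, and an inequality $\neq$ between functions is meant at $p$. Consider the four conditions: 1. $c_0=0$, $c_1\neq c_2$, $c_1\neq0$, and $J_1=J_2=0$; 2. $c_0=0$, $c_1=c_2\neq0$, and $J_3=0$; 3. $c_0=0$, $c_1=0$, $c_2\neq0$, and $J_4=0$;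 4. $c_0\neq0$, $J_{10}=J_{11}=J_{12}=0$, and the functions $G_{11},G_{12},G_{21},G_{22}$ do not all vanish identically near $p$. If the web has rank one at $p$, then one of the conditions 1–4 holds. Conversely, if one of the conditions 1–4 holds, and if in the case $c_0(p)\neq0$ moreover $(G_{21}(p),G_{22}(p))\neq(0,0)$, then the web has rank one at $p$. -/

import Mathlib

open Filter Topology
open scoped ContDiff

noncomputable section

namespace PlanarWeb

/-- The plane, with coordinates `(x, y)`. -/
abbrev Plane : Type := ℝ × ℝ

/-- Differential 1-forms on the plane. -/
abbrev OneForm : Type := Plane → (Plane →L[ℝ] ℝ)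

/-- The coefficient of `α ∧ β` with respect to `dx ∧ dy`. -/
def wedge (α β : OneForm) (x : Plane) : ℝ :=
  α x (1, 0) * β x (0, 1) - α x (0, 1) * β x (1, 0)

/-- The coefficient of the exterior derivative `dα` with respect to `dx ∧ dy`. -/
def extD (α : OneForm) (x : Plane) : ℝ :=
  fderiv ℝ α x (1, 0) (0, 1) - fderiv ℝ α x (0, 1) (1, 0)

/-- A planar 4-web on an open subset of the plane: four foliations by curves in general position.
The `i`-th foliation is given by the kernel of a smooth 1-form `form i`
(every smooth line field in the plane is integrable). -/
structure FourWeb where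
  domain : Set Plane
  isOpen_domain : IsOpen domain
  form : Fin 4 → OneForm
  smooth : ∀ i, ContDiffOn ℝ ∞ (form i) domain
  generalPosition : ∀ i j, i ≠ j → ∀ x ∈ domain, wedge (form i) (form j) x ≠ 0

/-- `l` is a solution, near `p`, of the abelian equation of the web: the `l i` are smooth,
`∑ i, l i • form i = 0`, and every 1-form `l i • form i` is closed. -/
def FourWeb.IsAbelianNear (W : FourWeb) (p : Plane) (l : Plane → Fin 4 → ℝ) : Prop :=
  (∀ᶠ x in 𝓝 p, ContDiffAt ℝ ∞ l x) ∧
  (∀ᶠ x in 𝓝 p, ∑ i, l x i • W.form i x = 0) ∧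
  (∀ i, ∀ᶠ x in 𝓝 p, extD (fun y => l y i • W.form i y) x = 0)

lemma extD_add {α β : OneForm} {x : Plane} (hα : DifferentiableAt ℝ α x)
    (hβ : DifferentiableAt ℝ β x) : extD (α + β) x = extD α x + extD β x := by
  simp only [extD, fderiv_add hα hβ, add_apply]
  ring

lemma extD_const_smul {α : OneForm} {x : Plane} (c : ℝ) (hα : DifferentiableAt ℝ α x) :
    extD (c • α) x = c * extD α x := by
  simp only [extD, fderiv_const_smul hα, smul_apply, smul_eq_mul]
  ring

lemma FourWeb.IsAbelianNear.differentiableAt {W : FourWeb} {p : Plane} (hp : p ∈ W.domain)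
    {l : Plane → Fin 4 → ℝ} (h : W.IsAbelianNear p l) (i : Fin 4) :
    ∀ᶠ x in 𝓝 p, DifferentiableAt ℝ (fun y => l y i • W.form i y) x := by
  filter_upwards [h.1, W.isOpen_domain.mem_nhds hp] with x hx hxU
  have h1 : DifferentiableAt ℝ l x := hx.differentiableAt (by simp)
  have h2 : DifferentiableAt ℝ (W.form i) x :=
    ((W.smooth i).contDiffAt (W.isOpen_domain.mem_nhds hxU)).differentiableAt (by simp)
  exact ((differentiableAt_pi.1 h1) i).smul h2

/-- The vector space of germs at `p` of solutions of the abelian equation. -/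
def FourWeb.abelianGerms (W : FourWeb) (p : Plane) (hp : p ∈ W.domain) :
    Submodule ℝ (Germ (𝓝 p) (Fin 4 → ℝ)) where
  carrier := {L | ∃ l : Plane → Fin 4 → ℝ, W.IsAbelianNear p l ∧ L = (l : Germ (𝓝 p) (Fin 4 → ℝ))}
  zero_mem' := by
    refine ⟨0, ⟨Eventually.of_forall fun x => contDiffAt_const, by simp, fun i => ?_⟩, rfl⟩
    refine Eventually.of_forall fun x => ?_
    simp [extD]
  add_mem' := by
    rintro _ _ ⟨l, hl, rfl⟩ ⟨m, hm, rfl⟩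
    refine ⟨l + m, ⟨?_, ?_, fun i => ?_⟩, rfl⟩
    · filter_upwards [hl.1, hm.1] with x h1 h2 using h1.add h2
    · filter_upwards [hl.2.1, hm.2.1] with x h1 h2
      simp only [Pi.add_apply, add_smul, Finset.sum_add_distrib, h1, h2, add_zero]
    · filter_upwards [hl.2.2 i, hm.2.2 i, hl.differentiableAt hp i, hm.differentiableAt hp i]
        with x h1 h2 d1 d2
      have h := extD_add d1 d2
      rw [h1, h2, add_zero] at h
      rw [← h]
      congr 1
      funext y
      simp [add_smul]
  smul_mem' := by
    rintro c _ ⟨l, hl, rfl⟩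
    refine ⟨c • l, ⟨?_, ?_, fun i => ?_⟩, rfl⟩
    · filter_upwards [hl.1] with x h1 using contDiffAt_const.smul h1
    · filter_upwards [hl.2.1] with x h1
      simp only [Pi.smul_apply, smul_assoc, ← Finset.smul_sum, h1, smul_zero]
    · filter_upwards [hl.2.2 i, hl.differentiableAt hp i] with x h1 d1
      have h := extD_const_smul c d1
      rw [h1, mul_zero] at h
      rw [← h]
      congr 1
      funext y
      simp [smul_smul]

/-- The (local) rank of the web at `p`: the dimension of the solution space of the abelian
equation near `p`. -/
def FourWeb.rank (W : FourWeb) (p : Plane) (hp : p ∈ W.domain) : Cardinal :=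
  Module.rank ℝ (W.abelianGerms p hp)

/-- A normalization of the web: forms `ωᵢ = scale i • form i` that define the same foliations and
satisfy `ω₁ + ω₂ + ω₃ = 0` and `a ω₁ + ω₂ + ω₄ = 0` (`ω₁, …, ω₄` have the indices `0, …, 3`). -/
structure FourWeb.Normalization (W : FourWeb) where
  scale : Fin 4 → Plane → ℝ
  scale_smooth : ∀ i, ContDiffOn ℝ ∞ (scale i) W.domain
  scale_ne_zero : ∀ i, ∀ x ∈ W.domain, scale i x ≠ 0
  a : Plane → ℝ
  a_smooth : ContDiffOn ℝ ∞ a W.domain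
  sum_eq : ∀ x ∈ W.domain,
    scale 0 x • W.form 0 x + scale 1 x • W.form 1 x + scale 2 x • W.form 2 x = 0
  cross_eq : ∀ x ∈ W.domain,
    a x • (scale 0 x • W.form 0 x) + scale 1 x • W.form 1 x + scale 3 x • W.form 3 x = 0

lemma contDiffOn_wedge {α β : OneForm} {s : Set Plane} (hα : ContDiffOn ℝ ∞ α s)
    (hβ : ContDiffOn ℝ ∞ β s) : ContDiffOn ℝ ∞ (wedge α β) s :=
  ((hα.clm_apply contDiffOn_const).mul (hβ.clm_apply contDiffOn_const)).sub
    ((hα.clm_apply contDiffOn_const).mul (hβ.clm_apply contDiffOn_const))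

lemma covector_ext {u v : Plane →L[ℝ] ℝ} (h1 : u (1, 0) = v (1, 0)) (h2 : u (0, 1) = v (0, 1)) :
    u = v := by
  ext
  · simpa using h1
  · simpa using h2

/-- Every 4-web can be normalized. -/
theorem FourWeb.nonempty_normalization (W : FourWeb) : Nonempty W.Normalization := by
  have w : ∀ i j, ContDiffOn ℝ ∞ (wedge (W.form i) (W.form j)) W.domain := fun i j =>
    contDiffOn_wedge (W.smooth i) (W.smooth j)
  have n01 := W.generalPosition 0 1 (by decide)
  have n12 := W.generalPosition 1 2 (by decide)
  have n20 := W.generalPosition 2 0 (by decide)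
  have n13 := W.generalPosition 1 3 (by decide)
  have n03 := W.generalPosition 0 3 (by decide)
  refine ⟨⟨fun i => ![wedge (W.form 1) (W.form 2), wedge (W.form 2) (W.form 0),
      wedge (W.form 0) (W.form 1), fun x => - (wedge (W.form 2) (W.form 0) x *
        wedge (W.form 0) (W.form 1) x / wedge (W.form 0) (W.form 3) x)] i, ?_, ?_,
      fun x => - (wedge (W.form 2) (W.form 0) x * wedge (W.form 1) (W.form 3) x /
        (wedge (W.form 1) (W.form 2) x * wedge (W.form 0) (W.form 3) x)), ?_, ?_, ?_⟩⟩
  · intro i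
    fin_cases i
    · exact w 1 2
    · exact w 2 0
    · exact w 0 1
    · exact (((w 2 0).mul (w 0 1)).div (w 0 3) n03).neg
  · intro i x hx
    fin_cases i
    · exact n12 x hx
    · exact n20 x hx
    · exact n01 x hx
    · exact neg_ne_zero.2 (div_ne_zero (mul_ne_zero (n20 x hx) (n01 x hx)) (n03 x hx))
  · exact (((w 2 0).mul (w 1 3)).div ((w 1 2).mul (w 0 3))
      fun x hx => mul_ne_zero (n12 x hx) (n03 x hx)).neg
  · intro x hx
    apply covector_ext <;> simp [wedge] <;> ring
  · intro x hx
    have h12 := n12 x hx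
    have h03 := n03 x hx
    apply covector_ext <;> simp <;> field_simp <;> simp only [wedge] <;> ring

namespace FourWeb.Normalization

variable {W : FourWeb} (N : W.Normalization)

/-- The normalized forms `ω₁, ω₂, ω₃, ω₄` (indices `0, 1, 2, 3`). -/
def normForm (i : Fin 4) : OneForm := fun x => N.scale i x • W.form i x

/-- The coefficient of `ω₁ ∧ ω₂` with respect to `dx ∧ dy`. -/
def area : Plane → ℝ := wedge (N.normForm 0) (N.normForm 1)

/-- The vector field `∂₁` of the frame dual to `ω₁, ω₂`. -/
def frame₁ (x : Plane) : Plane := (N.area x)⁻¹ • (N.normForm 1 x (0, 1), - N.normForm 1 x (1, 0))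

/-- The vector field `∂₂` of the frame dual to `ω₁, ω₂`. -/
def frame₂ (x : Plane) : Plane := (N.area x)⁻¹ • (- N.normForm 0 x (0, 1), N.normForm 0 x (1, 0))

/-- The coefficient `g₁` in `γ = g₁ ω₁ + g₂ ω₂`, where `dωᵢ = ωᵢ ∧ γ`. As `ω₁ ∧ γ = g₂ ω₁ ∧ ω₂`
and `ω₂ ∧ γ = - g₁ ω₁ ∧ ω₂`, these equations determine `g₁` and `g₂`. -/
def g₁ (x : Plane) : ℝ := - (extD (N.normForm 1) x / N.area x)

/-- The coefficient `g₂` in `γ = g₁ ω₁ + g₂ ω₂`; see `g₁`. -/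
def g₂ (x : Plane) : ℝ := extD (N.normForm 0) x / N.area x

/-- The connection form `γ` of the Chern connection. -/
def γ : OneForm := fun x => N.g₁ x • N.normForm 0 x + N.g₂ x • N.normForm 1 x

/-- The curvature function: `dγ = K ω₁ ∧ ω₂`. -/
def K (x : Plane) : ℝ := extD N.γ x / N.area x

/-- The covariant derivative `δ₁` of a function of weight `k`. -/
def δ₁ (k : ℕ) (u : Plane → ℝ) (x : Plane) : ℝ := fderiv ℝ u x (N.frame₁ x) - k * N.g₁ x * u x

/-- The covariant derivative `δ₂` of a function of weight `k`. -/
def δ₂ (k : ℕ) (u : Plane → ℝ) (x : Plane) : ℝ := fderiv ℝ u x (N.frame₂ x) - k * N.g₂ x * u x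

/-! Covariant derivatives of `a` (weight 0) and `K` (weight 2). Those of the third order are the
symmetrized ones; on functions of weight 0 the operators `δ₁` and `δ₂` commute. -/

def a₁ : Plane → ℝ := N.δ₁ 0 N.a
def a₂ : Plane → ℝ := N.δ₂ 0 N.a
def a₁₁ : Plane → ℝ := N.δ₁ 1 N.a₁
def a₁₂ : Plane → ℝ := N.δ₂ 1 N.a₁
def a₂₂ : Plane → ℝ := N.δ₂ 1 N.a₂
def a₁₁₂ (x : Plane) : ℝ :=
  (N.δ₂ 2 (N.δ₁ 1 (N.δ₁ 0 N.a)) x + N.δ₁ 2 (N.δ₂ 1 (N.δ₁ 0 N.a)) x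
    + N.δ₁ 2 (N.δ₁ 1 (N.δ₂ 0 N.a)) x) / 3
def a₁₂₂ (x : Plane) : ℝ :=
  (N.δ₁ 2 (N.δ₂ 1 (N.δ₂ 0 N.a)) x + N.δ₂ 2 (N.δ₁ 1 (N.δ₂ 0 N.a)) x
    + N.δ₂ 2 (N.δ₂ 1 (N.δ₁ 0 N.a)) x) / 3
def K₁ : Plane → ℝ := N.δ₁ 2 N.K
def K₂ : Plane → ℝ := N.δ₂ 2 N.K

/-! The coefficients of the obstruction `c₀ v₂ + c₁ v + c₂ u`, of weights 2, 3, 3. -/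

def c₀ (x : Plane) : ℝ :=
  let a := N.a x; let K := N.K x
  let a1 := N.a₁ x; let a2 := N.a₂ x
  let a11 := N.a₁₁ x; let a12 := N.a₁₂ x; let a22 := N.a₂₂ x
  K + (a11 - a * a22 - 2 * (1 - a) * a12) / (4 * a * (1 - a))
    + ((-1 + 2 * a) * a1 ^ 2 - a ^ 2 * a2 ^ 2 + 2 * (1 - a) ^ 2 * a1 * a2)
      / (4 * (1 - a) ^ 2 * a ^ 2)

def c₁ (x : Plane) : ℝ :=
  let a := N.a x; let K := N.K x
  let K1 := N.K₁ x; let K2 := N.K₂ x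
  let a1 := N.a₁ x; let a2 := N.a₂ x
  let a12 := N.a₁₂ x; let a22 := N.a₂₂ x
  let a112 := N.a₁₁₂ x; let a122 := N.a₁₂₂ x
  (K2 - K1) / (4 * (1 - a))
    + ((a - 4) * a1 + (11 - 20 * a + 12 * a ^ 2) * a2) / (12 * (1 - a) ^ 2 * a) * K
    + (a112 - a122) / (4 * a * (1 - a))
    + (a1 - a * a2) / (4 * a ^ 2 * (1 - a)) * a22
    + (2 * a - 1) * (a1 - a * a2) / (4 * (1 - a) ^ 2 * a ^ 2) * a12
    - a2 ^ 2 * ((1 - 2 * a) * a1 + a * a2) / (4 * (1 - a) ^ 2 * a ^ 2)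

def c₂ (x : Plane) : ℝ :=
  let a := N.a x; let K := N.K x
  let K1 := N.K₁ x; let K2 := N.K₂ x
  let a1 := N.a₁ x; let a2 := N.a₂ x
  (a * K2 - K1) / (4 * a * (1 - a))
    + ((1 - 2 * a) * a1 - (a - 2) * a * a2) / (4 * (1 - a) ^ 2 * a ^ 2) * K

/-! Covariant derivatives `cᵢ,ⱼ` of the coefficients. -/

def c₀₁ : Plane → ℝ := N.δ₁ 2 N.c₀
def c₀₂ : Plane → ℝ := N.δ₂ 2 N.c₀
def c₁₁ : Plane → ℝ := N.δ₁ 3 N.c₁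
def c₁₂ : Plane → ℝ := N.δ₂ 3 N.c₁
def c₂₁ : Plane → ℝ := N.δ₁ 3 N.c₂
def c₂₂ : Plane → ℝ := N.δ₂ 3 N.c₂

/-! The second covariant derivatives `c₁,₁₁`, `c₁,₁₂`, `c₂,₁₁`, `c₂,₁₂`. -/

def c₁₁₁ : Plane → ℝ := N.δ₁ 4 N.c₁₁
def c₁₁₂ : Plane → ℝ := N.δ₂ 4 N.c₁₁
def c₂₁₁ : Plane → ℝ := N.δ₁ 4 N.c₂₁
def c₂₁₂ : Plane → ℝ := N.δ₂ 4 N.c₂₁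

/-! The functions `Gᵢⱼ`, of weight 6. -/

def G₁₁ (x : Plane) : ℝ :=
  let a := N.a x; let K := N.K x; let a1 := N.a₁ x; let a2 := N.a₂ x
  let c0 := N.c₀ x; let c1 := N.c₁ x; let c2 := N.c₂ x
  a * c0 * (N.c₂₂ x - N.c₂₁ x) + a * c2 * (N.c₀₁ x - N.c₀₂ x) - a * (1 - a) * c1 * c2
    + (2 * a2 - a1 - a * a2) * c0 * c2 - K * c0 ^ 2

def G₁₂ (x : Plane) : ℝ :=
  let a := N.a x; let a1 := N.a₁ x; let a2 := N.a₂ x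
  let c0 := N.c₀ x; let c1 := N.c₁ x
  a * c0 * (N.c₁₂ x - N.c₁₁ x) + a * c1 * (N.c₀₁ x - N.c₀₂ x) - a * (1 - a) * c1 ^ 2
    + (2 * a2 - a1 - 2 * a * a2) * c0 * c1 + (a2 ^ 2 + N.a₁₂ x - N.a₂₂ x) * c0 ^ 2

def G₂₁ (x : Plane) : ℝ :=
  let a := N.a x; let a2 := N.a₂ x
  let c0 := N.c₀ x; let c2 := N.c₂ x
  c0 * (N.c₂₁ x - a * N.c₂₂ x) + c2 * (a * N.c₀₂ x - N.c₀₁ x) - 2 * a2 * c0 * c2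
    + a * (1 - a) * c2 ^ 2

def G₂₂ (x : Plane) : ℝ :=
  let a := N.a x; let K := N.K x; let a2 := N.a₂ x
  let c0 := N.c₀ x; let c1 := N.c₁ x; let c2 := N.c₂ x
  c0 * (N.c₁₁ x - a * N.c₁₂ x) + c1 * (a * N.c₀₂ x - N.c₀₁ x) + a * (1 - a) * c1 * c2
    - a2 * c0 * c1 - a2 * (1 - a) * c0 * c2 + (N.a₂₂ x - K) * c0 ^ 2

/-! The invariants `J₁, J₂, J₃, J₄, J₁₀, J₁₁, J₁₂`. -/

def J₁ (x : Plane) : ℝ :=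
  let a := N.a x; let a2 := N.a₂ x; let c1 := N.c₁ x; let c2 := N.c₂ x
  a2 * c1 * c2 * (c1 - c2) + a * c2 ^ 2 * (N.c₁₂ x - N.c₁₁ x)
    + c1 * c2 * (N.c₁₁ x + a * (N.c₂₁ x - N.c₁₂ x - N.c₂₂ x))
    + c1 ^ 2 * (a * N.c₂₂ x - N.c₂₁ x)

def J₂ (x : Plane) : ℝ :=
  let K := N.K x; let c1 := N.c₁ x; let c2 := N.c₂ x
  let c11 := N.c₁₁ x; let c12 := N.c₁₂ x; let c21 := N.c₂₁ x; let c22 := N.c₂₂ x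
  c1 ^ 2 * (c1 - c2) ^ 2 * K + (N.c₁₁₁ x - N.c₁₁₂ x) * c1 * c2 * (c2 - c1)
    + c1 ^ 2 * (c1 - c2) * (N.c₂₁₁ x - N.c₂₁₂ x) - c2 * (2 * c1 - c2) * c11 * (c12 - c11)
    + c1 ^ 2 * c21 * (c12 - c22 + c21) + c1 ^ 2 * c11 * (c22 - 2 * c21)

def J₃ (x : Plane) : ℝ :=
  let a := N.a x; let K := N.K x; let a1 := N.a₁ x; let a2 := N.a₂ x
  (N.a₂₂ x - N.a₁₂ x) * (1 - a) + a2 * (a2 - a1) - (1 - a) ^ 2 * K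

def J₄ (x : Plane) : ℝ :=
  let a := N.a x; let K := N.K x
  N.a₁₂ x * a - N.a₁ x * N.a₂ x - K * a ^ 2

def J₁₀ (x : Plane) : ℝ := N.G₁₁ x * N.G₂₂ x - N.G₂₁ x * N.G₁₂ x

def J₁₁ (x : Plane) : ℝ :=
  let a := N.a x; let a2 := N.a₂ x
  let c0 := N.c₀ x; let c1 := N.c₁ x; let c2 := N.c₂ x
  let G21 := N.G₂₁ x; let G22 := N.G₂₂ x
  c0 * (N.δ₁ 6 N.G₂₁ x * G22 - N.δ₁ 6 N.G₂₂ x * G21) + (a2 * c0 - a * c1) * G21 ^ 2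
    + (a * c2 - a2 * c0 + a * c1) * G21 * G22 - a * c2 * G22 ^ 2

def J₁₂ (x : Plane) : ℝ :=
  let a := N.a x; let a2 := N.a₂ x
  let c0 := N.c₀ x; let c1 := N.c₁ x; let c2 := N.c₂ x
  let G21 := N.G₂₁ x; let G22 := N.G₂₂ x
  c0 * (N.δ₂ 6 N.G₂₁ x * G22 - N.δ₂ 6 N.G₂₂ x * G21) + (a2 * c0 - a * c1) * G21 ^ 2
    + (a * c2 + c1) * G21 * G22 - c2 * G22 ^ 2

end FourWeb.Normalization

/-- `f` vanishes identically near `p`. -/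
def VanishesNear (f : Plane → ℝ) (p : Plane) : Prop := ∀ᶠ x in 𝓝 p, f x = 0

/-- `p` is a regular point of `f`: either `f` vanishes identically near `p`, or `f p ≠ 0`.
For a continuous `f`, the regular points form a dense open set. -/
def RegularAt (f : Plane → ℝ) (p : Plane) : Prop := VanishesNear f p ∨ f p ≠ 0

namespace FourWeb.Normalization

variable {W : FourWeb} (N : W.Normalization)

def Case1 (p : Plane) : Prop :=
  VanishesNear N.c₀ p ∧ VanishesNear N.J₁ p ∧ VanishesNear N.J₂ p ∧
    N.c₁ p ≠ N.c₂ p ∧ N.c₁ p ≠ 0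

def Case2 (p : Plane) : Prop :=
  VanishesNear N.c₀ p ∧ VanishesNear (fun x => N.c₁ x - N.c₂ x) p ∧ N.c₁ p ≠ 0 ∧
    VanishesNear N.J₃ p

def Case3 (p : Plane) : Prop :=
  VanishesNear N.c₀ p ∧ VanishesNear N.c₁ p ∧ N.c₂ p ≠ 0 ∧ VanishesNear N.J₄ p

def Case4 (p : Plane) : Prop :=
  N.c₀ p ≠ 0 ∧ VanishesNear N.J₁₀ p ∧ VanishesNear N.J₁₁ p ∧ VanishesNear N.J₁₂ p ∧
    ¬ (VanishesNear N.G₁₁ p ∧ VanishesNear N.G₁₂ p ∧ VanishesNear N.G₂₁ p ∧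
      VanishesNear N.G₂₂ p)

end FourWeb.Normalization

end PlanarWeb

end

noncomputable section

namespace PlanarWeb

/-! ### Exterior derivatives -/

/-! An abelian relation is determined by its coefficients `u` of `ω₃` and `v` of `ω₄`, and
closedness of its four terms becomes `δ₁ u = δ₂ u = -δ₁ v`, `δ₁ v = δ₂ (a v)`. Put `w = δ₂ v`. The
commutator of `δ₁` and `δ₂` is multiplication by `-k K` on weight `k`. Applied to `u` and to `v`, it
expresses `δ₁ w` and `δ₂ w` through `(u, v, w)` (`IsSolutionNear.hasCov_w`). So solutions are
parallel sections of a connection of rank three, and the value of `(u, v, w)` at `p` determines a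
solution. Applied to `w`, the commutator gives the only curvature of this connection, the relation
`c₀ w + c₁ v + c₂ u = 0` (`IsSolutionNear.obstruction`).

If `c₀`, `c₁`, `c₂` all vanish, the connection is flat and the Frobenius theorem
(`exists_solution_of_flat`, `exists_cov_solution`) provides independent solutions, so the rank is
not one. Otherwise the relation cuts the system down, and differentiating it may cut it down again.

If `c₀ = 0`, the relation makes `u` and `v` proportional with known ratio, and one unknown `f` with
`δᵢ f = zᵢ f` remains. Such an equation has a nonzero solution exactly when `δ₁ z₂ - δ₂ z₁ + K = 0`
(`closed_of_scalar_solution`, `exists_scalar_solution`). This is `J₂ = 0`, `J₃ = 0` or `J₄ = 0`,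
according to the ratio; `J₁ = 0` expresses that the ratio is compatible with the original equations.

If `c₀ ≠ 0`, the relation eliminates `w`, and the reduced connection on `(u, v)` has curvature
`(Gᵢⱼ)` up to a factor. When it vanishes there are two independent solutions. Otherwise a nonzero
solution lies in the kernel of the matrix, so its determinant `J₁₀` vanishes, and `J₁₁ = J₁₂ = 0`
says that the kernel line of the second row is preserved by the reduced connection. Conversely, on
that line a scalar equation remains, and its integrability follows from the same relations. -/

lemma extD_smul {f : Plane → ℝ} {α : OneForm} {x : Plane} (hf : DifferentiableAt ℝ f x)
    (hα : DifferentiableAt ℝ α x) :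
    extD (fun y => f y • α y) x = wedge (fderiv ℝ f) α x + f x * extD α x := by
  simp only [extD, wedge, fderiv_fun_smul hf hα, add_apply, smul_apply,
    ContinuousLinearMap.smulRight_apply, smul_eq_mul]
  ring

lemma contDiffOn_extD {α : OneForm} {s : Set Plane} (hs : IsOpen s) (hα : ContDiffOn ℝ ∞ α s) :
    ContDiffOn ℝ ∞ (extD α) s := by
  have h := hα.fderiv_of_isOpen (m := ∞) hs (by simp)
  exact ((h.clm_apply contDiffOn_const).clm_apply contDiffOn_const).sub
    ((h.clm_apply contDiffOn_const).clm_apply contDiffOn_const)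

lemma covector_apply (u : Plane →L[ℝ] ℝ) (v : Plane) :
    u v = v.1 * u (1, 0) + v.2 * u (0, 1) := by
  have h : v = v.1 • ((1, 0) : Plane) + v.2 • ((0, 1) : Plane) := by ext <;> simp
  conv_lhs => rw [h]
  rw [map_add, map_smul, map_smul, smul_eq_mul, smul_eq_mul]

/-- In the plane an alternating bilinear form is a multiple of the determinant. For the derivative
of a 1-form the factor is `extD`. -/
lemma bilin_sub_swap (B : Plane →L[ℝ] Plane →L[ℝ] ℝ) (h k : Plane) :
    B h k - B k h = (B (1, 0) (0, 1) - B (0, 1) (1, 0)) * (h.1 * k.2 - h.2 * k.1) := by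
  have key : ∀ v w : Plane, B v w = v.1 * (w.1 * B (1, 0) (1, 0) + w.2 * B (1, 0) (0, 1))
      + v.2 * (w.1 * B (0, 1) (1, 0) + w.2 * B (0, 1) (0, 1)) := by
    intro v w
    have hv : v = v.1 • ((1, 0) : Plane) + v.2 • ((0, 1) : Plane) := by ext <;> simp
    conv_lhs => rw [hv]
    rw [map_add, map_smul, map_smul, add_apply, smul_apply, smul_apply,
      covector_apply (B (1, 0)) w, covector_apply (B (0, 1)) w, smul_eq_mul, smul_eq_mul]
  rw [key h k, key k h]
  ring

lemma extD_congr {α β : OneForm} {x : Plane} (h : α =ᶠ[𝓝 x] β) : extD α x = extD β x := by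
  simp only [extD, h.fderiv_eq]

namespace FourWeb.Normalization

variable {W : FourWeb} (N : W.Normalization)

/-! ### The coframe and its dual frame -/

lemma contDiffOn_normForm (i : Fin 4) : ContDiffOn ℝ ∞ (N.normForm i) W.domain :=
  (N.scale_smooth i).smul (W.smooth i)

lemma contDiffOn_area : ContDiffOn ℝ ∞ N.area W.domain :=
  contDiffOn_wedge (N.contDiffOn_normForm 0) (N.contDiffOn_normForm 1)

variable {x : Plane}

lemma normForm_wedge_ne_zero {i j : Fin 4} (hij : i ≠ j) (hx : x ∈ W.domain) :
    wedge (N.normForm i) (N.normForm j) x ≠ 0 := by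
  have h : wedge (N.normForm i) (N.normForm j) x
      = N.scale i x * N.scale j x * wedge (W.form i) (W.form j) x := by
    simp only [wedge, normForm, smul_apply, smul_eq_mul]
    ring
  rw [h]
  exact mul_ne_zero (mul_ne_zero (N.scale_ne_zero i x hx) (N.scale_ne_zero j x hx))
    (W.generalPosition i j hij x hx)

lemma area_ne_zero (hx : x ∈ W.domain) : N.area x ≠ 0 :=
  N.normForm_wedge_ne_zero (by decide) hx

lemma normForm_two (hx : x ∈ W.domain) :
    N.normForm 2 x = (-1 : ℝ) • N.normForm 0 x + (-1 : ℝ) • N.normForm 1 x := by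
  have h := N.sum_eq x hx
  have h' : N.normForm 0 x + N.normForm 1 x + N.normForm 2 x = 0 := h
  rw [eq_neg_of_add_eq_zero_right h']
  module

lemma normForm_three (hx : x ∈ W.domain) :
    N.normForm 3 x = (-N.a x) • N.normForm 0 x + (-1 : ℝ) • N.normForm 1 x := by
  have h' : N.a x • N.normForm 0 x + N.normForm 1 x + N.normForm 3 x = 0 := N.cross_eq x hx
  rw [eq_neg_of_add_eq_zero_right h']
  module

lemma a_ne_zero (hx : x ∈ W.domain) : N.a x ≠ 0 := by
  intro h
  apply N.normForm_wedge_ne_zero (i := 1) (j := 3) (by decide) hx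
  simp only [wedge, N.normForm_three hx, h, add_apply, smul_apply, smul_eq_mul]
  ring

lemma one_sub_a_ne_zero (hx : x ∈ W.domain) : 1 - N.a x ≠ 0 := by
  intro h
  apply N.normForm_wedge_ne_zero (i := 2) (j := 3) (by decide) hx
  simp only [wedge, N.normForm_three hx, N.normForm_two hx, add_apply, smul_apply, smul_eq_mul]
  linear_combination
    (N.normForm 0 x (1, 0) * N.normForm 1 x (0, 1) - N.normForm 0 x (0, 1) * N.normForm 1 x (1, 0))
      * h

lemma contDiffOn_frame₁ : ContDiffOn ℝ ∞ N.frame₁ W.domain :=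
  ((N.contDiffOn_area).inv fun _ h => N.area_ne_zero h).smul
    (((N.contDiffOn_normForm 1).clm_apply contDiffOn_const).prodMk
      ((N.contDiffOn_normForm 1).clm_apply contDiffOn_const).neg)

lemma contDiffOn_frame₂ : ContDiffOn ℝ ∞ N.frame₂ W.domain :=
  ((N.contDiffOn_area).inv fun _ h => N.area_ne_zero h).smul
    (((N.contDiffOn_normForm 0).clm_apply contDiffOn_const).neg.prodMk
      ((N.contDiffOn_normForm 0).clm_apply contDiffOn_const))

lemma normForm_zero_frame₁ (hx : x ∈ W.domain) : N.normForm 0 x (N.frame₁ x) = 1 := by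
  have h := N.area_ne_zero hx
  rw [covector_apply]
  simp only [frame₁, Prod.smul_mk, smul_eq_mul]
  field_simp
  simp only [area, wedge]
  ring

lemma normForm_one_frame₁ : N.normForm 1 x (N.frame₁ x) = 0 := by
  rw [covector_apply]
  simp only [frame₁, Prod.smul_mk, smul_eq_mul]
  ring

lemma normForm_zero_frame₂ : N.normForm 0 x (N.frame₂ x) = 0 := by
  rw [covector_apply]
  simp only [frame₂, Prod.smul_mk, smul_eq_mul]
  ring

lemma normForm_one_frame₂ (hx : x ∈ W.domain) : N.normForm 1 x (N.frame₂ x) = 1 := by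
  have h := N.area_ne_zero hx
  rw [covector_apply]
  simp only [frame₂, Prod.smul_mk, smul_eq_mul]
  field_simp
  simp only [area, wedge]
  ring

lemma covector_eq_coframe (hx : x ∈ W.domain) (u : Plane →L[ℝ] ℝ) :
    u = u (N.frame₁ x) • N.normForm 0 x + u (N.frame₂ x) • N.normForm 1 x := by
  have h := N.area_ne_zero hx
  apply covector_ext <;> rw [covector_apply u (N.frame₁ x), covector_apply u (N.frame₂ x)] <;>
    simp only [frame₁, frame₂, Prod.smul_mk, smul_eq_mul, add_apply, smul_apply] <;>
    field_simp <;> simp only [area, wedge] <;> ring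

lemma apply_frame_sub (B : Plane →L[ℝ] Plane →L[ℝ] ℝ) (hx : x ∈ W.domain) :
    B (N.frame₁ x) (N.frame₂ x) - B (N.frame₂ x) (N.frame₁ x)
      = (B (1, 0) (0, 1) - B (0, 1) (1, 0)) / N.area x := by
  have h := N.area_ne_zero hx
  rw [bilin_sub_swap B (N.frame₁ x)]
  simp only [frame₁, frame₂, Prod.smul_mk, smul_eq_mul]
  field_simp
  simp only [area, wedge]
  ring

lemma contDiffOn_g₁ : ContDiffOn ℝ ∞ N.g₁ W.domain :=
  ((contDiffOn_extD W.isOpen_domain (N.contDiffOn_normForm 1)).div N.contDiffOn_area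
    fun _ h => N.area_ne_zero h).neg

lemma contDiffOn_g₂ : ContDiffOn ℝ ∞ N.g₂ W.domain :=
  (contDiffOn_extD W.isOpen_domain (N.contDiffOn_normForm 0)).div N.contDiffOn_area
    fun _ h => N.area_ne_zero h

lemma contDiffOn_γ : ContDiffOn ℝ ∞ N.γ W.domain :=
  (N.contDiffOn_g₁.smul (N.contDiffOn_normForm 0)).add
    (N.contDiffOn_g₂.smul (N.contDiffOn_normForm 1))

lemma contDiffOn_K : ContDiffOn ℝ ∞ N.K W.domain :=
  (contDiffOn_extD W.isOpen_domain N.contDiffOn_γ).div N.contDiffOn_area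
    fun _ h => N.area_ne_zero h

lemma contDiffOn_δ₁ {U : Set Plane} (hU : IsOpen U) (hUW : U ⊆ W.domain) (k : ℕ)
    {u : Plane → ℝ} (hu : ContDiffOn ℝ ∞ u U) : ContDiffOn ℝ ∞ (N.δ₁ k u) U :=
  ((hu.fderiv_of_isOpen (m := ∞) hU (by simp)).clm_apply (N.contDiffOn_frame₁.mono hUW)).sub
    ((contDiffOn_const.mul (N.contDiffOn_g₁.mono hUW)).mul hu)

lemma contDiffOn_δ₂ {U : Set Plane} (hU : IsOpen U) (hUW : U ⊆ W.domain) (k : ℕ)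
    {u : Plane → ℝ} (hu : ContDiffOn ℝ ∞ u U) : ContDiffOn ℝ ∞ (N.δ₂ k u) U :=
  ((hu.fderiv_of_isOpen (m := ∞) hU (by simp)).clm_apply (N.contDiffOn_frame₂.mono hUW)).sub
    ((contDiffOn_const.mul (N.contDiffOn_g₂.mono hUW)).mul hu)

lemma differentiableAt_normForm (hx : x ∈ W.domain) (i : Fin 4) :
    DifferentiableAt ℝ (N.normForm i) x :=
  ((N.contDiffOn_normForm i).contDiffAt (W.isOpen_domain.mem_nhds hx)).differentiableAt (by simp)

/-- The Leibniz terms `f dω₁` and `h dω₂` are exactly the connection terms of weight 1, which is why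
coefficients of 1-forms carry that weight. -/
lemma extD_coframe {f h : Plane → ℝ} (hx : x ∈ W.domain) (hf : DifferentiableAt ℝ f x)
    (hh : DifferentiableAt ℝ h x) :
    extD (fun y => f y • N.normForm 0 y + h y • N.normForm 1 y) x
      = N.area x * (N.δ₁ 1 h x - N.δ₂ 1 f x) := by
  have hA := N.area_ne_zero hx
  have d0 := N.differentiableAt_normForm hx 0
  have d1 := N.differentiableAt_normForm hx 1
  have e := extD_add (hf.smul d0) (hh.smul d1)
  change extD (fun y => f y • N.normForm 0 y + h y • N.normForm 1 y) x
    = extD (fun y => f y • N.normForm 0 y) x + extD (fun y => h y • N.normForm 1 y) x at e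
  rw [e, extD_smul hf d0, extD_smul hh d1]
  simp only [δ₁, δ₂, g₁, g₂, wedge]
  rw [covector_apply (fderiv ℝ h x) (N.frame₁ x), covector_apply (fderiv ℝ f x) (N.frame₂ x)]
  simp only [frame₁, frame₂, Prod.smul_mk, smul_eq_mul, Nat.cast_one]
  field_simp
  ring

lemma K_eq (hx : x ∈ W.domain) : N.K x = N.δ₁ 1 N.g₂ x - N.δ₂ 1 N.g₁ x := by
  have hU := W.isOpen_domain.mem_nhds hx
  have h := N.extD_coframe hx ((N.contDiffOn_g₁.contDiffAt hU).differentiableAt (by simp))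
    ((N.contDiffOn_g₂.contDiffAt hU).differentiableAt (by simp))
  have hA := N.area_ne_zero hx
  change extD N.γ x = _ at h
  rw [K, h]
  field_simp

/-- The bracket of the frame fields. -/
lemma frame_bracket (hx : x ∈ W.domain) :
    fderiv ℝ N.frame₂ x (N.frame₁ x) - fderiv ℝ N.frame₁ x (N.frame₂ x)
      = - N.g₂ x • N.frame₁ x + N.g₁ x • N.frame₂ x := by
  have hU := W.isOpen_domain.mem_nhds hx
  have e1 : DifferentiableAt ℝ N.frame₁ x :=
    (N.contDiffOn_frame₁.contDiffAt hU).differentiableAt (by simp)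
  have e2 : DifferentiableAt ℝ N.frame₂ x :=
    (N.contDiffOn_frame₂.contDiffAt hU).differentiableAt (by simp)
  -- The pairing of a coframe form with a frame field is constant, so a derivative of the frame can
  -- be moved onto the coframe.
  have key : ∀ (i : Fin 4) (e : Plane → Plane), DifferentiableAt ℝ e x → ∀ (c : ℝ),
      (∀ y ∈ W.domain, N.normForm i y (e y) = c) → ∀ v,
      N.normForm i x (fderiv ℝ e x v) = - fderiv ℝ (N.normForm i) x v (e x) := by
    intro i e he c hc v
    have h1 : fderiv ℝ (fun y => N.normForm i y (e y)) x = 0 := by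
      have : (fun y => N.normForm i y (e y)) =ᶠ[𝓝 x] fun _ => c := by
        filter_upwards [hU] with y hy using hc y hy
      rw [this.fderiv_eq]
      simp
    rw [fderiv_clm_apply (N.differentiableAt_normForm hx i) he] at h1
    have h2 := DFunLike.congr_fun h1 v
    simp at h2
    linarith
  set v : Plane := fderiv ℝ N.frame₂ x (N.frame₁ x) - fderiv ℝ N.frame₁ x (N.frame₂ x) with hv
  have h0 : N.normForm 0 x v = - N.g₂ x := by
    rw [hv, map_sub, key 0 _ e2 0 (fun y _ => N.normForm_zero_frame₂),
      key 0 _ e1 1 (fun y hy => N.normForm_zero_frame₁ hy), g₂, extD]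
    have := N.apply_frame_sub (fderiv ℝ (N.normForm 0) x) hx
    linarith
  have h1 : N.normForm 1 x v = N.g₁ x := by
    rw [hv, map_sub, key 1 _ e2 1 (fun y hy => N.normForm_one_frame₂ hy),
      key 1 _ e1 0 (fun y _ => N.normForm_one_frame₁), g₁, extD]
    have := N.apply_frame_sub (fderiv ℝ (N.normForm 1) x) hx
    linarith
  have hsep : ∀ u : Plane →L[ℝ] ℝ, u v = u (- N.g₂ x • N.frame₁ x + N.g₁ x • N.frame₂ x) := by
    intro u
    conv_lhs => rw [N.covector_eq_coframe hx u]
    simp only [add_apply, smul_apply, h0, h1, map_add, map_smul, smul_eq_mul]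
    ring
  ext
  · exact hsep (ContinuousLinearMap.fst ℝ ℝ ℝ)
  · exact hsep (ContinuousLinearMap.snd ℝ ℝ ℝ)

/-- Covariant derivatives of a function of weight `k` commute up to curvature. -/
lemma δ₁_δ₂_sub (k : ℕ) {u : Plane → ℝ} (hx : x ∈ W.domain) (hu : ContDiffAt ℝ ∞ u x) :
    N.δ₁ (k + 1) (N.δ₂ k u) x - N.δ₂ (k + 1) (N.δ₁ k u) x = - k * N.K x * u x := by
  have hU := W.isOpen_domain.mem_nhds hx
  have e1 : DifferentiableAt ℝ N.frame₁ x :=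
    (N.contDiffOn_frame₁.contDiffAt hU).differentiableAt (by simp)
  have e2 : DifferentiableAt ℝ N.frame₂ x :=
    (N.contDiffOn_frame₂.contDiffAt hU).differentiableAt (by simp)
  have dg1 : DifferentiableAt ℝ N.g₁ x :=
    (N.contDiffOn_g₁.contDiffAt hU).differentiableAt (by simp)
  have dg2 : DifferentiableAt ℝ N.g₂ x :=
    (N.contDiffOn_g₂.contDiffAt hU).differentiableAt (by simp)
  have du : DifferentiableAt ℝ u x := hu.differentiableAt (by simp)
  have ddu : DifferentiableAt ℝ (fderiv ℝ u) x :=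
    (hu.fderiv_right (m := ∞) (by simp)).differentiableAt (by simp)
  have hsymm := hu.isSymmSndFDerivAt (by simp; exact WithTop.coe_le_coe.2 le_top)
  have hb := congrArg (fderiv ℝ u x) (N.frame_bracket hx)
  simp only [map_sub, map_add, map_smul, smul_eq_mul] at hb
  have hs := hsymm (N.frame₁ x) (N.frame₂ x)
  have hK := N.K_eq hx
  have f1 : fderiv ℝ (N.δ₁ k u) x (N.frame₂ x)
      = fderiv ℝ (fderiv ℝ u) x (N.frame₂ x) (N.frame₁ x)
        + fderiv ℝ u x (fderiv ℝ N.frame₁ x (N.frame₂ x))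
        - k * (fderiv ℝ N.g₁ x (N.frame₂ x) * u x + N.g₁ x * fderiv ℝ u x (N.frame₂ x)) := by
    have : N.δ₁ k u = fun y => fderiv ℝ u y (N.frame₁ y) - k * N.g₁ y * u y := rfl
    rw [this, fderiv_fun_sub (ddu.clm_apply e1) ((dg1.const_mul _).fun_mul du),
      fderiv_clm_apply ddu e1, fderiv_fun_mul (dg1.const_mul _) du, fderiv_const_mul dg1]
    simp
    ring
  have f2 : fderiv ℝ (N.δ₂ k u) x (N.frame₁ x)
      = fderiv ℝ (fderiv ℝ u) x (N.frame₁ x) (N.frame₂ x)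
        + fderiv ℝ u x (fderiv ℝ N.frame₂ x (N.frame₁ x))
        - k * (fderiv ℝ N.g₂ x (N.frame₁ x) * u x + N.g₂ x * fderiv ℝ u x (N.frame₁ x)) := by
    have : N.δ₂ k u = fun y => fderiv ℝ u y (N.frame₂ y) - k * N.g₂ y * u y := rfl
    rw [this, fderiv_fun_sub (ddu.clm_apply e2) ((dg2.const_mul _).fun_mul du),
      fderiv_clm_apply ddu e2, fderiv_fun_mul (dg2.const_mul _) du, fderiv_const_mul dg2]
    simp
    ring
  have o1 : N.δ₁ (k + 1) (N.δ₂ k u) x = fderiv ℝ (N.δ₂ k u) x (N.frame₁ x)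
      - ((k + 1 : ℕ) : ℝ) * N.g₁ x * N.δ₂ k u x := rfl
  have o2 : N.δ₂ (k + 1) (N.δ₁ k u) x = fderiv ℝ (N.δ₁ k u) x (N.frame₂ x)
      - ((k + 1 : ℕ) : ℝ) * N.g₂ x * N.δ₁ k u x := rfl
  rw [o1, o2, f1, f2]
  simp only [δ₁, δ₂] at hK ⊢
  push_cast at hK ⊢
  linear_combination hs + hb + (k * u x) * hK

/-! ### Rules for covariant derivatives -/

/-- `f`, regarded as a function of weight `k`, is differentiable at `x` and has the covariant
derivatives `d₁` and `d₂` there. -/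
def HasCov (k : ℕ) (f : Plane → ℝ) (x : Plane) (d₁ d₂ : ℝ) : Prop :=
  DifferentiableAt ℝ f x ∧ N.δ₁ k f x = d₁ ∧ N.δ₂ k f x = d₂

variable {N} {k l : ℕ} {f h : Plane → ℝ} {d₁ d₂ e₁ e₂ : ℝ}

lemma hasCov_of_contDiffAt (N : W.Normalization) (k : ℕ) (hf : ContDiffAt ℝ ∞ f x) :
    N.HasCov k f x (N.δ₁ k f x) (N.δ₂ k f x) :=
  ⟨hf.differentiableAt (by simp), rfl, rfl⟩

lemma hasCov_const (c : ℝ) : N.HasCov 0 (fun _ => c) x 0 0 :=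
  ⟨differentiableAt_const c, by simp [δ₁], by simp [δ₂]⟩

namespace HasCov

lemma congr_deriv (hf : N.HasCov k f x d₁ d₂) (h1 : d₁ = e₁) (h2 : d₂ = e₂) :
    N.HasCov k f x e₁ e₂ := h1 ▸ h2 ▸ hf

lemma congr (hf : N.HasCov k f x d₁ d₂) (hfh : h =ᶠ[𝓝 x] f) : N.HasCov k h x d₁ d₂ := by
  refine ⟨hf.1.congr_of_eventuallyEq hfh, ?_, ?_⟩
  · rw [← hf.2.1, δ₁, δ₁, hfh.fderiv_eq, hfh.eq_of_nhds]
  · rw [← hf.2.2, δ₂, δ₂, hfh.fderiv_eq, hfh.eq_of_nhds]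

/-- This is how identities between functions are differentiated below: both sides are given
derivatives by the calculus rules, and these must agree. -/
lemma unique (hf : N.HasCov k f x d₁ d₂) (hh : N.HasCov k h x e₁ e₂) (hfh : f =ᶠ[𝓝 x] h) :
    d₁ = e₁ ∧ d₂ = e₂ := by
  have h' := hh.congr hfh
  exact ⟨hf.2.1.symm.trans h'.2.1, hf.2.2.symm.trans h'.2.2⟩

lemma eq_zero (hf : N.HasCov k f x d₁ d₂) (h : f =ᶠ[𝓝 x] 0) : d₁ = 0 ∧ d₂ = 0 :=
  hf.unique ⟨differentiableAt_const 0, by simp [δ₁], by simp [δ₂]⟩ h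

lemma add (hf : N.HasCov k f x d₁ d₂) (hh : N.HasCov k h x e₁ e₂) :
    N.HasCov k (fun y => f y + h y) x (d₁ + e₁) (d₂ + e₂) := by
  refine ⟨hf.1.add hh.1, ?_, ?_⟩
  · rw [← hf.2.1, ← hh.2.1, δ₁, δ₁, δ₁, fderiv_fun_add hf.1 hh.1, add_apply]
    ring
  · rw [← hf.2.2, ← hh.2.2, δ₂, δ₂, δ₂, fderiv_fun_add hf.1 hh.1, add_apply]
    ring

lemma neg (hf : N.HasCov k f x d₁ d₂) : N.HasCov k (fun y => - f y) x (-d₁) (-d₂) := by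
  refine ⟨hf.1.neg, ?_, ?_⟩
  · rw [← hf.2.1, δ₁, δ₁, fderiv_fun_neg, neg_apply]
    ring
  · rw [← hf.2.2, δ₂, δ₂, fderiv_fun_neg, neg_apply]
    ring

lemma sub (hf : N.HasCov k f x d₁ d₂) (hh : N.HasCov k h x e₁ e₂) :
    N.HasCov k (fun y => f y - h y) x (d₁ - e₁) (d₂ - e₂) := by
  simpa only [sub_eq_add_neg] using hf.add hh.neg

lemma mul (hf : N.HasCov k f x d₁ d₂) (hh : N.HasCov l h x e₁ e₂) :
    N.HasCov (k + l) (fun y => f y * h y) x (d₁ * h x + f x * e₁) (d₂ * h x + f x * e₂) := by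
  refine ⟨hf.1.mul hh.1, ?_, ?_⟩
  · rw [← hf.2.1, ← hh.2.1, δ₁, δ₁, δ₁, fderiv_fun_mul hf.1 hh.1]
    simp
    ring
  · rw [← hf.2.2, ← hh.2.2, δ₂, δ₂, δ₂, fderiv_fun_mul hf.1 hh.1]
    simp
    ring

lemma const_mul (c : ℝ) (hf : N.HasCov k f x d₁ d₂) :
    N.HasCov k (fun y => c * f y) x (c * d₁) (c * d₂) := by
  refine ⟨hf.1.const_mul c, ?_, ?_⟩
  · rw [← hf.2.1, δ₁, δ₁, fderiv_const_mul hf.1, smul_apply, smul_eq_mul]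
    ring
  · rw [← hf.2.2, δ₂, δ₂, fderiv_const_mul hf.1, smul_apply, smul_eq_mul]
    ring

/-- The derivatives come from the product rule for `(f / h) * h = f`. They keep the quotient `f x /
h x` intact, so that a named quotient such as `q₀` reappears under its own name. The weight of `f`
is written as a sum to avoid subtracting natural numbers. -/
lemma div (hf : N.HasCov (k + l) f x d₁ d₂) (hh : N.HasCov l h x e₁ e₂) (h0 : h x ≠ 0) :
    N.HasCov k (fun y => f y / h y) x ((d₁ - f x / h x * e₁) / h x)
      ((d₂ - f x / h x * e₂) / h x) := by
  have hd : DifferentiableAt ℝ (fun y => f y / h y) x := by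
    simpa only [div_eq_mul_inv] using hf.1.fun_mul (hh.1.fun_inv h0)
  have hq : N.HasCov k (fun y => f y / h y) x _ _ := ⟨hd, rfl, rfl⟩
  have e : (fun y => f y / h y * h y) =ᶠ[𝓝 x] f := by
    filter_upwards [hh.1.continuousAt.eventually_ne h0] with y hy
    exact div_mul_cancel₀ _ hy
  obtain ⟨h1, h2⟩ := (hq.mul hh).unique hf e
  refine hq.congr_deriv ?_ ?_
  · rw [eq_div_iff h0, ← h1]
    ring
  · rw [eq_div_iff h0, ← h2]
    ring

lemma hasFDerivAt (hx : x ∈ W.domain) (hf : N.HasCov k f x d₁ d₂) :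
    HasFDerivAt f ((d₁ + k * N.g₁ x * f x) • N.normForm 0 x
      + (d₂ + k * N.g₂ x * f x) • N.normForm 1 x) x := by
  convert hf.1.hasFDerivAt using 1
  rw [N.covector_eq_coframe hx (fderiv ℝ f x), ← hf.2.1, ← hf.2.2, δ₁, δ₂]
  congr 2 <;> ring

end HasCov

lemma hasCov_of_hasFDerivAt (hx : x ∈ W.domain)
    (hf : HasFDerivAt f ((d₁ + k * N.g₁ x * f x) • N.normForm 0 x
      + (d₂ + k * N.g₂ x * f x) • N.normForm 1 x) x) : N.HasCov k f x d₁ d₂ := by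
  refine ⟨hf.differentiableAt, ?_, ?_⟩
  · rw [δ₁, hf.fderiv]
    simp only [add_apply, smul_apply, smul_eq_mul, N.normForm_zero_frame₁ hx,
      N.normForm_one_frame₁]
    ring
  · rw [δ₂, hf.fderiv]
    simp only [add_apply, smul_apply, smul_eq_mul, N.normForm_zero_frame₂,
      N.normForm_one_frame₂ hx]
    ring

end FourWeb.Normalization

/-! ### Linear ordinary differential equations on the unit interval -/

section LinearSystem

open Set

variable {E : Type*} [NormedAddCommGroup E] [NormedSpace ℝ E]

lemma exp_half_le_two : Real.exp (1 / 2) ≤ 2 := by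
  have h1 : Real.exp (1 / 2) * Real.exp (1 / 2) = Real.exp 1 := by
    rw [← Real.exp_add]
    norm_num
  have h2 := Real.exp_one_lt_d9
  nlinarith [Real.exp_pos (1 / 2)]

lemma hasDerivWithinAt_Ici_of_Icc {f : ℝ → E} {f' : E} {t : ℝ} (ht : t ∈ Ico (0 : ℝ) 1)
    (h : HasDerivWithinAt f f' (Icc 0 1) t) : HasDerivWithinAt f f' (Ici t) t :=
  h.mono_of_mem_nhdsWithin (Filter.mem_of_superset (Icc_mem_nhdsGE ht.2)
    (Icc_subset_Icc_left ht.1))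

/-- The bound `1 / 2` makes one application of Picard–Lindelöf cover the whole interval: on the ball
of radius `‖s₀‖` about `s₀` the speed is at most `1 / 2 * (2 * ‖s₀‖)`, so the ball is not left in
unit time. Grönwall then bounds the solution, with `exp (1 / 2) ≤ 2`. -/
lemma exists_linear_ode_solution [CompleteSpace E] {B : ℝ → E →L[ℝ] E}
    (hB : ContinuousOn B (Icc 0 1)) (hB' : ∀ t ∈ Icc (0 : ℝ) 1, ‖B t‖ ≤ 1 / 2) (s₀ : E) :
    ∃ Y : ℝ → E, Y 0 = s₀ ∧ (∀ t ∈ Icc (0 : ℝ) 1, HasDerivWithinAt Y (B t (Y t)) (Icc 0 1) t) ∧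
      ∀ t ∈ Icc (0 : ℝ) 1, ‖Y t‖ ≤ 2 * ‖s₀‖ := by
  have hPL : IsPicardLindelof (fun t y => B t y) (tmin := 0) (tmax := 1)
      ⟨0, by simp⟩ s₀ ⟨‖s₀‖, norm_nonneg _⟩ 0 ⟨‖s₀‖, norm_nonneg _⟩ (1 / 2) := by
    refine ⟨fun t ht => ?_, fun y _ => hB.clm_apply continuousOn_const, fun t ht y hy => ?_, ?_⟩
    · refine ((B t).lipschitz.weaken ?_).lipschitzOnWith
      rw [← NNReal.coe_le_coe]
      simpa using hB' t ht
    · have h1 : ‖y‖ ≤ 2 * ‖s₀‖ := by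
        rw [mem_closedBall_iff_norm] at hy
        have h2 : ‖y - s₀‖ ≤ ‖s₀‖ := hy
        have h3 := norm_le_norm_add_norm_sub s₀ y
        have h4 := norm_sub_rev s₀ y
        linarith
      change ‖B t y‖ ≤ ‖s₀‖
      have h2 := (B t).le_opNorm y
      have h3 := hB' t ht
      have h4 : ‖B t‖ * ‖y‖ ≤ 1 / 2 * (2 * ‖s₀‖) :=
        mul_le_mul h3 h1 (norm_nonneg _) (by norm_num)
      linarith
    · simp
  obtain ⟨Y, hY0, hY⟩ := hPL.exists_eq_forall_mem_Icc_hasDerivWithinAt₀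
  refine ⟨Y, hY0, hY, fun t ht => ?_⟩
  have hb := norm_le_gronwallBound_of_norm_deriv_right_le (f := Y) (δ := ‖s₀‖) (K := 1 / 2) (ε := 0)
    (a := 0) (b := 1) (fun t ht => (hY t ht).continuousWithinAt)
    (fun t ht => hasDerivWithinAt_Ici_of_Icc ht (hY t ⟨ht.1, ht.2.le⟩))
    (by rw [← hY0]) (fun t ht => by
      rw [add_zero]
      exact ((B t).le_opNorm _).trans
        (mul_le_mul_of_nonneg_right (hB' t ⟨ht.1, ht.2.le⟩) (norm_nonneg _))) t ht
  rw [gronwallBound_ε0] at hb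
  have h1 : Real.exp (1 / 2 * (t - 0)) ≤ 2 :=
    (Real.exp_le_exp.2 (by linarith [ht.2])).trans exp_half_le_two
  calc ‖Y t‖ ≤ _ := hb
    _ ≤ ‖s₀‖ * 2 := mul_le_mul_of_nonneg_left h1 (norm_nonneg _)
    _ = 2 * ‖s₀‖ := mul_comm _ _

/-- Grönwall with rate `1 / 2` and defect `ε` gives `2 * ε * (exp (1 / 2) - 1)` at time 1. -/
lemma norm_sub_le_of_approx_linear_ode {B : ℝ → E →L[ℝ] E}
    (hB' : ∀ t ∈ Icc (0 : ℝ) 1, ‖B t‖ ≤ 1 / 2) {Y Z Z' : ℝ → E} {ε : ℝ} (hε : 0 ≤ ε)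
    (h0 : Z 0 = Y 0)
    (hY : ∀ t ∈ Icc (0 : ℝ) 1, HasDerivWithinAt Y (B t (Y t)) (Icc 0 1) t)
    (hZ : ∀ t ∈ Icc (0 : ℝ) 1, HasDerivWithinAt Z (Z' t) (Icc 0 1) t)
    (hZB : ∀ t ∈ Icc (0 : ℝ) 1, ‖Z' t - B t (Z t)‖ ≤ ε) : ‖Z 1 - Y 1‖ ≤ 2 * ε := by
  have hb := norm_le_gronwallBound_of_norm_deriv_right_le (f := fun t => Z t - Y t)
    (f' := fun t => Z' t - B t (Y t)) (δ := 0) (K := 1 / 2) (ε := ε)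
    (a := 0) (b := 1) (fun t ht => ((hZ t ht).continuousWithinAt.sub (hY t ht).continuousWithinAt))
    (fun t ht => hasDerivWithinAt_Ici_of_Icc ht
      ((hZ t ⟨ht.1, ht.2.le⟩).sub (hY t ⟨ht.1, ht.2.le⟩)))
    (by simp [h0]) (fun t ht => by
      have ht' : t ∈ Icc (0 : ℝ) 1 := ⟨ht.1, ht.2.le⟩
      have e : Z' t - B t (Y t) = B t (Z t - Y t) + (Z' t - B t (Z t)) := by
        rw [map_sub]
        abel
      rw [e]
      refine (norm_add_le _ _).trans (add_le_add ?_ (hZB t ht'))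
      exact ((B t).le_opNorm _).trans
        (mul_le_mul_of_nonneg_right (hB' t ht') (norm_nonneg _))) 1 (by simp)
  rw [gronwallBound_of_K_ne_0 (by norm_num)] at hb
  have h1 := exp_half_le_two
  have h2 : ε * Real.exp (1 / 2) ≤ ε * 2 := mul_le_mul_of_nonneg_left h1 hε
  norm_num at hb h2 ⊢
  linarith

end LinearSystem

/-! ### Flat linear systems of partial differential equations -/

section FlatSystem

set_option maxSynthPendingDepth 3

open Set

variable {V E : Type*} [NormedAddCommGroup V] [NormedSpace ℝ V]
  [NormedAddCommGroup E] [NormedSpace ℝ E]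

lemma norm_apply₃_le (D : V →L[ℝ] V →L[ℝ] E →L[ℝ] E) (h k : V) (y : E) :
    ‖D h k y‖ ≤ ‖D‖ * ‖h‖ * ‖k‖ * ‖y‖ :=
  ((D h k).le_opNorm y).trans (mul_le_mul_of_nonneg_right (D.le_opNorm₂ h k) (norm_nonneg _))

lemma eventually_norm_lt {X F : Type*} [TopologicalSpace X] [SeminormedAddCommGroup F] {f : X → F}
    {p : X} (hf : ContinuousAt f p) : ∀ᶠ x in 𝓝 p, ‖f x‖ < ‖f p‖ + 1 :=
  hf.norm.eventually_lt_const (lt_add_one _)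

/-- A ball on which `A` has bounds for its first two derivatives. -/
lemma exists_ball_bounds {A : V → V →L[ℝ] E →L[ℝ] E} {U : Set V} (hU : IsOpen U) {p : V}
    (hp : p ∈ U) (hA : ContDiffOn ℝ ∞ A U) :
    ∃ M r : ℝ, 1 ≤ M ∧ 0 < r ∧ r ≤ 1 ∧ M * r ≤ 1 / 2 ∧ Metric.ball p r ⊆ U ∧
      (∀ x ∈ Metric.ball p r, ‖A x‖ ≤ M ∧ ‖fderiv ℝ A x‖ ≤ M) ∧
      ∀ x ∈ Metric.ball p r, ∀ y ∈ Metric.ball p r,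
        ‖A y - A x - fderiv ℝ A x (y - x)‖ ≤ M * ‖y - x‖ ^ 2 := by
  have hA1 : ContDiffOn ℝ ∞ (fderiv ℝ A) U := hA.fderiv_of_isOpen (m := ∞) hU (by simp)
  have hA2 : ContDiffOn ℝ ∞ (fderiv ℝ (fderiv ℝ A)) U :=
    hA1.fderiv_of_isOpen (m := ∞) hU (by simp)
  have hUp := hU.mem_nhds hp
  have b0 := eventually_norm_lt (hA.continuousOn.continuousAt hUp)
  have b1 := eventually_norm_lt (hA1.continuousOn.continuousAt hUp)
  have b2 := eventually_norm_lt (hA2.continuousOn.continuousAt hUp)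
  obtain ⟨R, hR, hb⟩ := Metric.eventually_nhds_iff_ball.1 (b0.and (b1.and (b2.and hUp)))
  set M : ℝ := ‖A p‖ + ‖fderiv ℝ A p‖ + ‖fderiv ℝ (fderiv ℝ A) p‖ + 1 with hM
  have n0 := norm_nonneg (A p)
  have n1 := norm_nonneg (fderiv ℝ A p)
  have n2 := norm_nonneg (fderiv ℝ (fderiv ℝ A) p)
  have hM1 : 1 ≤ M := by linarith
  have hM0 : 0 < M := by linarith
  set r : ℝ := min (min R 1) (1 / (2 * M)) with hr
  have hrR : r ≤ R := (min_le_left _ _).trans (min_le_left _ _)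
  have hsub : Metric.ball p r ⊆ Metric.ball p R := Metric.ball_subset_ball hrR
  refine ⟨M, r, hM1, by positivity, (min_le_left _ _).trans (min_le_right _ _), ?_,
    fun x hx => (hb x (hsub hx)).2.2.2, fun x hx => ?_, fun x hx y hy => ?_⟩
  · calc M * r ≤ M * (1 / (2 * M)) := mul_le_mul_of_nonneg_left (min_le_right _ _) hM0.le
      _ = 1 / 2 := by field_simp
  · have h := hb x (hsub hx)
    exact ⟨by linarith [h.1], by linarith [h.2.1]⟩
  · have hseg : segment ℝ x y ⊆ Metric.ball p r := (convex_ball p r).segment_subset hx hy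
    have hd : ∀ z ∈ Metric.ball p r, HasFDerivAt A (fderiv ℝ A z) z := fun z hz =>
      ((hA.contDiffAt (hU.mem_nhds (hb z (hsub hz)).2.2.2)).differentiableAt (by simp)).hasFDerivAt
    have hdd : ∀ z ∈ Metric.ball p r, DifferentiableAt ℝ (fderiv ℝ A) z := fun z hz =>
      (hA1.contDiffAt (hU.mem_nhds (hb z (hsub hz)).2.2.2)).differentiableAt (by simp)
    -- Taylor's estimate by two mean value inequalities: on the segment the derivative of `A`
    -- differs from its value at `x` by at most `M * ‖y - x‖`.
    have h := Convex.norm_image_sub_le_of_norm_hasFDerivWithin_le' (f := A) (f' := fderiv ℝ A)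
      (φ := fderiv ℝ A x) (C := M * ‖y - x‖) (s := segment ℝ x y)
      (fun z hz => (hd z (hseg hz)).hasFDerivWithinAt) (fun z hz => ?_)
      (convex_segment x y) (left_mem_segment ℝ x y) (right_mem_segment ℝ x y)
    · rw [pow_two, ← mul_assoc]
      exact h
    · have h1 := (convex_ball p r).norm_image_sub_le_of_norm_fderiv_le (𝕜 := ℝ)
        (f := fderiv ℝ A) (C := M) (x := x) (y := z) hdd
        (fun w hw => by linarith [(hb w (hsub hw)).2.2.1]) hx (hseg hz)
      refine h1.trans (mul_le_mul_of_nonneg_left ?_ hM0.le)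
      have h2 := norm_sub_le_of_mem_segment hz
      exact h2

/-- A solution of a linear system either vanishes near a point or has no zeros near the point. -/
theorem eventually_eq_zero_or_ne_zero {s : V → E} {s' : V → V →L[ℝ] E} {p : V} {C : ℝ}
    (hs : ∀ᶠ x in 𝓝 p, HasFDerivAt s (s' x) x) (hC : ∀ᶠ x in 𝓝 p, ‖s' x‖ ≤ C * ‖s x‖) :
    (∀ᶠ x in 𝓝 p, s x = 0) ∨ ∀ᶠ x in 𝓝 p, s x ≠ 0 := by
  obtain ⟨r, hr, hb⟩ := Metric.eventually_nhds_iff_ball.1 (hs.and hC)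
  by_cases h : ∃ q ∈ Metric.ball p r, s q = 0
  · obtain ⟨q, hq, hq0⟩ := h
    left
    filter_upwards [Metric.ball_mem_nhds p hr] with y hy
    have hmem : ∀ t ∈ Icc (0 : ℝ) 1, q + t • (y - q) ∈ Metric.ball p r := fun t ht =>
      (convex_ball p r).add_smul_sub_mem hq hy ht
    have hd : ∀ t ∈ Icc (0 : ℝ) 1, HasDerivAt (fun t : ℝ => s (q + t • (y - q)))
        (s' (q + t • (y - q)) (y - q)) t := by
      intro t ht
      have h1 : HasDerivAt (fun t : ℝ => q + t • (y - q)) (y - q) t := by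
        simpa using ((hasDerivAt_id t).smul_const (y - q)).const_add q
      exact (hb _ (hmem t ht)).1.comp_hasDerivAt t h1
    -- Along the segment from a zero `q` the function satisfies a linear differential inequality
    -- with zero initial value.
    have h2 := eq_zero_of_abs_deriv_le_mul_abs_self_of_eq_zero_right
      (f := fun t : ℝ => s (q + t • (y - q))) (f' := fun t => s' (q + t • (y - q)) (y - q))
      (K := C * ‖y - q‖) (a := 0) (b := 1)
      (fun t ht => (hd t ht).continuousAt.continuousWithinAt)
      (fun t ht => (hd t ⟨ht.1, ht.2.le⟩).hasDerivWithinAt) (by simp [hq0])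
      (fun t ht => by
        refine ((s' _).le_opNorm _).trans ?_
        have h3 := mul_le_mul_of_nonneg_right (hb _ (hmem t ⟨ht.1, ht.2.le⟩)).2
          (norm_nonneg (y - q))
        linarith) 1 (by simp)
    simpa using h2
  · right
    push Not at h
    filter_upwards [Metric.ball_mem_nhds p hr] with y hy using h y hy

/-- This is the one place where flatness enters the construction of solutions. Here `B` and `D`
stand for `A` and its derivative at a point of the ray with direction `z`, and `B + t • D h + Δ` for
`A` at the corresponding point of the ray with direction `z + h`. The curve `y + t • B h y` almost
solves the equation along the second ray: after substituting `hfl`, all terms linear in `h` cancel.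
The four remaining terms contribute `2 + 2 + 2 + 6`, so `20` is generous. -/
lemma norm_flat_approx_le {B : V →L[ℝ] E →L[ℝ] E} {D : V →L[ℝ] V →L[ℝ] E →L[ℝ] E}
    {Δ : V →L[ℝ] E →L[ℝ] E} {t M c : ℝ} {z h : V} {y : E} (ht0 : 0 ≤ t) (ht1 : t ≤ 1)
    (hM : 1 ≤ M) (hc : 0 ≤ c) (hfl : D z h y + B h (B z y) = D h z y + B z (B h y))
    (hA1 : ‖B‖ ≤ M) (hD1 : ‖D‖ ≤ M) (hΔn : ‖Δ‖ ≤ M * ‖h‖ ^ 2) (hy' : ‖y‖ ≤ 2 * c)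
    (hzh : ‖z + h‖ ≤ 1) (hMh : M * ‖h‖ ≤ 1) :
    ‖B z y + (t • (D z h y + B h (B z y)) + (1 : ℝ) • B h y)
      - (B + t • D h + Δ) (z + h) (y + t • B h y)‖ ≤ 20 * M ^ 2 * c * ‖h‖ ^ 2 := by
  have hM0 : 0 < M := by linarith
  have expand : B z y + (t • (D z h y + B h (B z y)) + (1 : ℝ) • B h y)
      - (B + t • D h + Δ) (z + h) (y + t • B h y)
      = -(t • B h (B h y) + t • D h h y
        + (t * t) • D h (z + h) (B h y) + Δ (z + h) (y + t • B h y)) := by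
    rw [hfl]
    simp only [add_apply, smul_apply, map_add, map_smul, smul_add, smul_smul, one_smul]
    module
  rw [expand, norm_neg]
  have hn := norm_nonneg h
  have nA : ∀ k w, ‖B k w‖ ≤ M * ‖k‖ * ‖w‖ := fun k w =>
    ((B).le_opNorm₂ k w).trans (by gcongr)
  have nhy : ‖B h y‖ ≤ M * ‖h‖ * (2 * c) := (nA h y).trans (by gcongr)
  have nt : ∀ w : E, ‖t • w‖ ≤ ‖w‖ := fun w => by
    rw [norm_smul, Real.norm_eq_abs, abs_of_nonneg ht0]
    exact mul_le_of_le_one_left (norm_nonneg _) ht1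
  have t1 : ‖t • B h (B h y)‖ ≤ 2 * M ^ 2 * c * ‖h‖ ^ 2 := by
    refine (nt _).trans ((nA _ _).trans ?_)
    calc M * ‖h‖ * ‖B h y‖ ≤ M * ‖h‖ * (M * ‖h‖ * (2 * c)) := by gcongr
      _ = _ := by ring
  have t2 : ‖t • D h h y‖ ≤ 2 * M ^ 2 * c * ‖h‖ ^ 2 := by
    refine (nt _).trans ((norm_apply₃_le _ _ _ _).trans ?_)
    calc ‖D‖ * ‖h‖ * ‖h‖ * ‖y‖ ≤ (M * M) * ‖h‖ * ‖h‖ * (2 * c) := by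
          gcongr
          nlinarith
      _ = _ := by ring
  have t3 : ‖(t * t) • D h (z + h) (B h y)‖ ≤ 2 * M ^ 2 * c * ‖h‖ ^ 2 := by
    rw [mul_smul]
    refine (nt _).trans ((nt _).trans ((norm_apply₃_le _ _ _ _).trans ?_))
    calc ‖D‖ * ‖h‖ * ‖z + h‖ * ‖B h y‖
        ≤ M * ‖h‖ * 1 * (M * ‖h‖ * (2 * c)) := by
          gcongr
      _ = _ := by ring
  have ny : ‖y + t • B h y‖ ≤ 6 * c := by
    refine (norm_add_le _ _).trans ?_
    have h1 := (nt (B h y)).trans nhy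
    nlinarith
  have t4 : ‖Δ (z + h) (y + t • B h y)‖ ≤ 6 * M ^ 2 * c * ‖h‖ ^ 2 := by
    refine (Δ.le_opNorm₂ _ _).trans ?_
    calc ‖Δ‖ * ‖z + h‖ * ‖y + t • B h y‖
        ≤ (M * M * ‖h‖ ^ 2) * 1 * (6 * c) := by
          gcongr
          exact hΔn.trans (by gcongr; nlinarith)
      _ = _ := by ring
  have tri := norm_add₄_le (a := t • B h (B h y)) (b := t • D h h y)
    (c := (t * t) • D h (z + h) (B h y)) (d := Δ (z + h) (y + t • B h y))
  have hpos : 0 ≤ M ^ 2 * c * ‖h‖ ^ 2 := by positivity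
  linarith

variable [CompleteSpace E]

/-- The Frobenius theorem for linear systems: if the connection `d - A` is flat, then the system
`ds = A s` has local solutions with arbitrary initial values. -/
theorem exists_solution_of_flat {A : V → V →L[ℝ] E →L[ℝ] E} {U : Set V} (hU : IsOpen U) {p : V}
    (hp : p ∈ U) (hA : ContDiffOn ℝ ∞ A U)
    (hflat : ∀ x ∈ U, ∀ h k y, fderiv ℝ A x h k y + A x k (A x h y)
      = fderiv ℝ A x k h y + A x h (A x k y)) (s₀ : E) :
    ∃ s : V → E, s p = s₀ ∧
      ∀ᶠ x in 𝓝 p, ContDiffAt ℝ ∞ s x ∧ HasFDerivAt s ((A x).flip (s x)) x := by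
  obtain ⟨M, r, hM, hr, hr1, hMr, hrU, hb, hT⟩ := exists_ball_bounds hU hp hA
  have hM0 : 0 < M := by linarith
  have hmem : ∀ z : V, ‖z‖ < r → ∀ t ∈ Icc (0 : ℝ) 1, p + t • z ∈ Metric.ball p r := by
    intro z hz t ht
    rw [mem_ball_iff_norm, add_sub_cancel_left, norm_smul, Real.norm_eq_abs, abs_of_nonneg ht.1]
    exact (mul_le_of_le_one_left (norm_nonneg _) ht.2).trans_lt hz
  have hdA : ∀ x ∈ Metric.ball p r, HasFDerivAt A (fderiv ℝ A x) x := fun z hz =>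
    ((hA.contDiffAt (hU.mem_nhds (hrU hz))).differentiableAt (by simp)).hasFDerivAt
  have hray : ∀ z : V, ‖z‖ < r → ∀ t ∈ Icc (0 : ℝ) 1, HasDerivWithinAt (fun t => A (p + t • z))
      (fderiv ℝ A (p + t • z) z) (Icc 0 1) t := by
    intro z hz t ht
    have h1 : HasDerivAt (fun t : ℝ => p + t • z) z t := by
      simpa using ((hasDerivAt_id t).smul_const z).const_add p
    exact ((hdA _ (hmem z hz t ht)).comp_hasDerivAt t h1).hasDerivWithinAt
  have hB' : ∀ z : V, ‖z‖ < r → ∀ t ∈ Icc (0 : ℝ) 1, ‖A (p + t • z) z‖ ≤ 1 / 2 := by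
    intro z hz t ht
    calc ‖A (p + t • z) z‖ ≤ ‖A (p + t • z)‖ * ‖z‖ := (A (p + t • z)).le_opNorm z
      _ ≤ M * r := mul_le_mul (hb _ (hmem z hz t ht)).1 hz.le (norm_nonneg _) hM0.le
      _ ≤ 1 / 2 := hMr
  -- Solve the equation along each ray from `p`. The condition on `z` is inside the existential so
  -- that `choose` yields a family defined for every `z`.
  have hex : ∀ z : V, ∃ Y : ℝ → E, ‖z‖ < r → Y 0 = s₀ ∧
      (∀ t ∈ Icc (0 : ℝ) 1, HasDerivWithinAt Y (A (p + t • z) z (Y t)) (Icc 0 1) t) ∧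
      ∀ t ∈ Icc (0 : ℝ) 1, ‖Y t‖ ≤ 2 * ‖s₀‖ := by
    intro z
    by_cases hz : ‖z‖ < r
    · obtain ⟨Y, hY⟩ := exists_linear_ode_solution (B := fun t => A (p + t • z) z)
        (fun t ht => ((hray z hz t ht).continuousWithinAt.clm_apply continuousWithinAt_const))
        (hB' z hz) s₀
      exact ⟨Y, fun _ => hY⟩
    · exact ⟨0, fun h => absurd h hz⟩
  choose Y hY using hex
  set s : V → E := fun x => Y (x - p) 1 with hs
  have hsp : s p = s₀ := by
    have h0 : ‖(0 : V)‖ < r := by simpa using hr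
    obtain ⟨h1, h2, -⟩ := hY 0 h0
    -- Along the constant ray the constant curve `s₀` is an exact solution, and the comparison with
    -- `ε = 0` gives uniqueness.
    have h3 := norm_sub_le_of_approx_linear_ode (hB' 0 h0) (Z := fun _ => s₀) (Z' := fun _ => 0)
      (ε := 0) le_rfl h1.symm h2 (fun t _ => hasDerivWithinAt_const t _ s₀) (by simp)
    simp only [hs, sub_self]
    rw [mul_zero] at h3
    exact (sub_eq_zero.1 (norm_le_zero_iff.1 h3)).symm
  have hder : ∀ x ∈ Metric.ball p r, HasFDerivAt s ((A x).flip (s x)) x := by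
    intro x hx
    set z := x - p with hz
    have hzr : ‖z‖ < r := mem_ball_iff_norm.1 hx
    have hpz : p + (1 : ℝ) • z = x := by simp [hz]
    have key : ∀ h : V, ‖z + h‖ < r →
        ‖s (x + h) - s x - (A x).flip (s x) h‖ ≤ 2 * (20 * M ^ 2 * ‖s₀‖) * ‖h‖ ^ 2 := by
      intro h hh
      obtain ⟨y0, y1, y2⟩ := hY z hzr
      obtain ⟨w0, w1, -⟩ := hY (z + h) hh
      have e1 : s (x + h) = Y (z + h) 1 := by
        simp only [hs, hz]
        congr 1
        abel
      have e2 : s x = Y z 1 := rfl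
      -- With `M * r ≤ 1 / 2` this gives the bound `M * ‖h‖ ≤ 1` needed in the estimate.
      have hhr : ‖h‖ ≤ 2 * r := by
        have := norm_sub_le (z + h) z
        rw [add_sub_cancel_left] at this
        linarith
      -- The trial curve is the solution along `z` plus `t` times its expected variation. At `t = 1`
      -- it is the first order expansion `s x + A x h (s x)`, and its defect on the ray `z + h` is
      -- of second order in `h`.
      have h3 := norm_sub_le_of_approx_linear_ode (hB' (z + h) hh) (Y := Y (z + h))
        (Z := fun t => Y z t + t • A (p + t • z) h (Y z t))
        (Z' := fun t => A (p + t • z) z (Y z t) + (t • (fderiv ℝ A (p + t • z) z h (Y z t)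
          + A (p + t • z) h (A (p + t • z) z (Y z t))) + (1 : ℝ) • A (p + t • z) h (Y z t)))
        (ε := 20 * M ^ 2 * ‖s₀‖ * ‖h‖ ^ 2) (by positivity) (by simp [y0, w0]) w1 ?_ ?_
      · have e3 : s (x + h) - s x - (A x).flip (s x) h
            = -(Y z 1 + (1 : ℝ) • A (p + (1 : ℝ) • z) h (Y z 1) - Y (z + h) 1) := by
          rw [e1, e2, hpz, ContinuousLinearMap.flip_apply, one_smul]
          abel
        rw [e3, norm_neg]
        linarith
      · intro t ht
        exact (y1 t ht).add ((hasDerivWithinAt_id t _).smul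
          (((hray z hzr t ht).clm_apply (hasDerivWithinAt_const t _ h)).clm_apply (y1 t ht))
            |>.congr_deriv (by simp))
      · intro t ht
        have ht0 := ht.1
        have ht1 := ht.2
        have hm1 := hmem z hzr t ht
        have hm2 := hmem (z + h) hh t ht
        set q := p + t • z with hq
        set y := Y z t with hy
        set Δ := A (p + t • (z + h)) - A q - fderiv ℝ A q (t • h) with hΔ
        have hΔn : ‖Δ‖ ≤ M * ‖h‖ ^ 2 := by
          have e : p + t • (z + h) - q = t • h := by rw [hq, smul_add]; abel
          have h1 := hT q hm1 _ hm2
          rw [e] at h1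
          refine h1.trans (mul_le_mul_of_nonneg_left ?_ hM0.le)
          rw [norm_smul, Real.norm_eq_abs, abs_of_nonneg ht0]
          exact pow_le_pow_left₀ (by positivity) (mul_le_of_le_one_left (norm_nonneg _) ht1) 2
        have eA : A (p + t • (z + h)) = A q + t • fderiv ℝ A q h + Δ := by
          rw [hΔ, map_smul]
          abel
        rw [eA]
        refine norm_flat_approx_le ht0 ht1 hM ((norm_nonneg (s₀)))
          (hflat q (hrU hm1) z h y) (hb q hm1).1 (hb q hm1).2 hΔn (y2 t ht) (by linarith) ?_
        nlinarith
    rw [hasFDerivAt_iff_isLittleO_nhds_zero]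
    have hO : (fun h => s (x + h) - s x - (A x).flip (s x) h) =O[𝓝 0] fun h : V => ‖h‖ ^ 2 := by
      refine Asymptotics.IsBigO.of_bound (2 * (20 * M ^ 2 * ‖s₀‖)) ?_
      have hc : Tendsto (fun h : V => ‖z + h‖) (𝓝 0) (𝓝 ‖z + 0‖) :=
        (continuous_const.add continuous_id).norm.tendsto 0
      rw [add_zero] at hc
      filter_upwards [hc.eventually_lt_const hzr] with h hh
      rw [norm_pow, norm_norm]
      exact key h hh
    exact hO.trans_isLittleO (Asymptotics.isLittleO_norm_pow_id one_lt_two)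
  -- Bootstrapping: the derivative of `s` is `A` applied to `s`, so each degree of smoothness of `s`
  -- yields the next.
  have hsm : ∀ n : ℕ, ContDiffOn ℝ n s (Metric.ball p r) := by
    intro n
    induction n with
    | zero => exact contDiffOn_zero.2 fun x hx => (hder x hx).continuousAt.continuousWithinAt
    | succ n ih =>
      rw [Nat.cast_succ, contDiffOn_succ_iff_fderiv_of_isOpen Metric.isOpen_ball]
      refine ⟨fun x hx => (hder x hx).differentiableAt.differentiableWithinAt, by simp, ?_⟩
      have hAn : ContDiffOn ℝ n A (Metric.ball p r) :=
        (hA.mono hrU).of_le (by exact_mod_cast le_top)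
      have h1 : ContDiffOn ℝ n (fun x => (A x).flip (s x)) (Metric.ball p r) :=
        ((ContinuousLinearMap.flipₗᵢ ℝ V E E).contDiff.comp_contDiffOn hAn).clm_apply ih
      exact h1.congr fun x hx => (hder x hx).fderiv
  refine ⟨s, hsp, ?_⟩
  filter_upwards [Metric.ball_mem_nhds p hr] with x hx
  exact ⟨(contDiffOn_infty.2 hsm).contDiffAt (Metric.isOpen_ball.mem_nhds hx), hder x hx⟩

end FlatSystem

/-! ### Linear systems for covariant derivatives -/

section MatrixConnection

set_option maxSynthPendingDepth 3

variable {n : ℕ}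

/-- The matrix of 1-forms `α`, as a 1-form with values in the endomorphisms of `ℝⁿ`. -/
def matrixConnection (α : Fin n → Fin n → OneForm) (x : Plane) :
    Plane →L[ℝ] (Fin n → ℝ) →L[ℝ] (Fin n → ℝ) :=
  ∑ j, ∑ l, (α j l x).smulRight
    ((ContinuousLinearMap.proj (R := ℝ) (φ := fun _ : Fin n => ℝ) l).smulRight
      (Pi.single j (1 : ℝ) : Fin n → ℝ))

lemma matrixConnection_apply (α : Fin n → Fin n → OneForm) (x h : Plane) (y : Fin n → ℝ)
    (j : Fin n) : matrixConnection α x h y j = ∑ l, α j l x h * y l := by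
  simp only [matrixConnection, sum_apply, ContinuousLinearMap.smulRight_apply,
    smul_apply, ContinuousLinearMap.proj_apply, Finset.sum_apply, Pi.smul_apply, smul_eq_mul,
    Pi.single_apply]
  rw [Finset.sum_eq_single j]
  · simp
  · intro b _ hb
    simp [hb.symm]
  · simp

lemma contDiffOn_matrixConnection {α : Fin n → Fin n → OneForm} {s : Set Plane}
    (hα : ∀ j l, ContDiffOn ℝ ∞ (α j l) s) : ContDiffOn ℝ ∞ (matrixConnection α) s :=
  ContDiffOn.sum fun j _ => ContDiffOn.sum fun l _ => (hα j l).smulRight contDiffOn_const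

lemma fderiv_matrixConnection_apply {α : Fin n → Fin n → OneForm} {x : Plane}
    (hα : ∀ j l, DifferentiableAt ℝ (α j l) x)
    (hA : DifferentiableAt ℝ (matrixConnection α) x) (h k : Plane) (y : Fin n → ℝ) (j : Fin n) :
    fderiv ℝ (matrixConnection α) x h k y j = ∑ l, fderiv ℝ (α j l) x h k * y l := by
  have h1 := hasFDerivAt_pi'.1 ((hA.hasFDerivAt.clm_apply (hasFDerivAt_const k x)).clm_apply
    (hasFDerivAt_const y x)) j
  have h2 : HasFDerivAt (fun z => ∑ l, α j l z k * y l) _ x :=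
    HasFDerivAt.fun_sum fun l _ =>
      ((hα j l).hasFDerivAt.clm_apply (hasFDerivAt_const k x)).mul_const (y l)
  have h3 : (fun z => matrixConnection α z k y j) = fun z => ∑ l, α j l z k * y l := by
    funext z
    exact matrixConnection_apply α z k y j
  rw [h3] at h1
  have h4 := DFunLike.congr_fun (h1.unique h2) h
  simpa [sum_apply, mul_comm] using h4

lemma wedge_apply (α β : OneForm) (x h k : Plane) :
    α x h * β x k - α x k * β x h = wedge α β x * (h.1 * k.2 - h.2 * k.1) := by
  rw [covector_apply (α x) h, covector_apply (α x) k, covector_apply (β x) h,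
    covector_apply (β x) k, wedge]
  ring

/-- Flatness is `dα = α ∧ α` entry by entry: both terms evaluated on `(h, k)` are their coefficients
times the same determinant. -/
lemma matrixConnection_flat {α : Fin n → Fin n → OneForm} {U : Set Plane} (hU : IsOpen U)
    (hα : ∀ j l, ContDiffOn ℝ ∞ (α j l) U)
    (hflat : ∀ x ∈ U, ∀ j l, extD (α j l) x = ∑ m, wedge (α j m) (α m l) x) :
    ∀ x ∈ U, ∀ h k y, fderiv ℝ (matrixConnection α) x h k y
        + matrixConnection α x k (matrixConnection α x h y)
      = fderiv ℝ (matrixConnection α) x k h y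
        + matrixConnection α x h (matrixConnection α x k y) := by
  intro x hx h k y
  have hd : ∀ j l, DifferentiableAt ℝ (α j l) x := fun j l =>
    ((hα j l).contDiffAt (hU.mem_nhds hx)).differentiableAt (by simp)
  have hA : DifferentiableAt ℝ (matrixConnection α) x :=
    ((contDiffOn_matrixConnection hα).contDiffAt (hU.mem_nhds hx)).differentiableAt (by simp)
  ext j
  simp only [Pi.add_apply, fderiv_matrixConnection_apply hd hA, matrixConnection_apply]
  have e1 : ∀ h k : Plane, ∑ m, α j m x h * ∑ l, α m l x k * y l
      = ∑ l, (∑ m, α j m x h * α m l x k) * y l := by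
    intro h k
    simp only [Finset.mul_sum, Finset.sum_mul]
    rw [Finset.sum_comm]
    exact Finset.sum_congr rfl fun _ _ => Finset.sum_congr rfl fun _ _ => by ring
  rw [e1, e1, ← Finset.sum_add_distrib, ← Finset.sum_add_distrib]
  refine Finset.sum_congr rfl fun l _ => ?_
  have h1 := bilin_sub_swap (fderiv ℝ (α j l) x) h k
  have h2 : (∑ m, α j m x h * α m l x k) - ∑ m, α j m x k * α m l x h
      = (∑ m, wedge (α j m) (α m l) x) * (h.1 * k.2 - h.2 * k.1) := by
    rw [← Finset.sum_sub_distrib, Finset.sum_mul]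
    exact Finset.sum_congr rfl fun m _ => wedge_apply _ _ _ _ _
  have h3 := hflat x hx j l
  rw [extD] at h3
  rw [h3] at h1
  linear_combination (y l) * h1 - (y l) * h2

end MatrixConnection

namespace FourWeb.Normalization

variable {W : FourWeb} (N : W.Normalization) {n : ℕ}

/-- The connection matrix of the system `δᵢ sⱼ = ∑ₗ (Mᵢ)ⱼₗ sₗ` for functions `sⱼ` of weight
`k j`. -/
def covForm (k : Fin n → ℕ) (M₁ M₂ : Fin n → Fin n → Plane → ℝ) (j l : Fin n) : OneForm :=
  fun x => (M₁ j l x + (if j = l then (k j : ℝ) else 0) * N.g₁ x) • N.normForm 0 x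
    + (M₂ j l x + (if j = l then (k j : ℝ) else 0) * N.g₂ x) • N.normForm 1 x

variable {N} {k : Fin n → ℕ} {M₁ M₂ : Fin n → Fin n → Plane → ℝ}

lemma contDiffOn_covForm {U : Set Plane} (hUW : U ⊆ W.domain)
    (h₁ : ∀ j l, ContDiffOn ℝ ∞ (M₁ j l) U) (h₂ : ∀ j l, ContDiffOn ℝ ∞ (M₂ j l) U)
    (j l : Fin n) : ContDiffOn ℝ ∞ (N.covForm k M₁ M₂ j l) U :=
  (((h₁ j l).add (contDiffOn_const.mul (N.contDiffOn_g₁.mono hUW))).smul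
    ((N.contDiffOn_normForm 0).mono hUW)).add
    (((h₂ j l).add (contDiffOn_const.mul (N.contDiffOn_g₂.mono hUW))).smul
      ((N.contDiffOn_normForm 1).mono hUW))

lemma covForm_sum (x : Plane) (s : Fin n → ℝ) (j : Fin n) :
    ∑ l, s l • N.covForm k M₁ M₂ j l x
      = ((∑ l, M₁ j l x * s l) + k j * N.g₁ x * s j) • N.normForm 0 x
        + ((∑ l, M₂ j l x * s l) + k j * N.g₂ x * s j) • N.normForm 1 x := by
  simp only [covForm, smul_add, smul_smul, add_smul, Finset.sum_add_distrib,
    Finset.sum_smul]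
  have e : ∀ (g : ℝ) (φ : Plane →L[ℝ] ℝ),
      ∑ l, (s l * ((if j = l then (k j : ℝ) else 0) * g)) • φ = (k j * g * s j) • φ := by
    intro g φ
    rw [Finset.sum_eq_single j]
    · simp only [if_true]
      congr 1
      ring
    · intro b _ hb
      simp [hb.symm]
    · simp
  rw [e, e]
  simp only [mul_comm (s _)]

lemma hasCov_iff_hasFDerivAt_matrixConnection {x : Plane} (hx : x ∈ W.domain)
    {s : Fin n → Plane → ℝ} :
    (∀ j, N.HasCov (k j) (s j) x (∑ l, M₁ j l x * s l x) (∑ l, M₂ j l x * s l x)) ↔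
      HasFDerivAt (fun y j => s j y)
        ((matrixConnection (N.covForm k M₁ M₂) x).flip fun j => s j x) x := by
  have e : ∀ j, (ContinuousLinearMap.proj (R := ℝ) (φ := fun _ : Fin n => ℝ) j).comp
      ((matrixConnection (N.covForm k M₁ M₂) x).flip fun j => s j x)
      = ((∑ l, M₁ j l x * s l x) + k j * N.g₁ x * s j x) • N.normForm 0 x
        + ((∑ l, M₂ j l x * s l x) + k j * N.g₂ x * s j x) • N.normForm 1 x := by
    intro j
    rw [← covForm_sum]
    refine ContinuousLinearMap.ext fun v => ?_
    change matrixConnection (N.covForm k M₁ M₂) x v (fun j => s j x) j = _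
    rw [matrixConnection_apply, sum_apply]
    exact Finset.sum_congr rfl fun l _ => mul_comm _ _
  rw [hasFDerivAt_pi']
  simp only [e]
  exact forall_congr' fun j => ⟨fun h => h.hasFDerivAt hx, fun h => hasCov_of_hasFDerivAt hx h⟩

/-- A weighted linear system that satisfies the formal integrability condition has local
solutions with arbitrary initial values. -/
theorem exists_cov_solution {U : Set Plane} (hU : IsOpen U) (hUW : U ⊆ W.domain) {p : Plane}
    (hp : p ∈ U) (hk : ∀ j l, k l ≤ k j + 1)
    (h₁ : ∀ j l, ContDiffOn ℝ ∞ (M₁ j l) U) (h₂ : ∀ j l, ContDiffOn ℝ ∞ (M₂ j l) U)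
    (hflat : ∀ x ∈ U, ∀ j l, N.δ₁ (k j + 1 - k l) (M₂ j l) x - N.δ₂ (k j + 1 - k l) (M₁ j l) x
      + (if j = l then (k j : ℝ) else 0) * N.K x
      = ∑ m, (M₁ j m x * M₂ m l x - M₂ j m x * M₁ m l x)) (s₀ : Fin n → ℝ) :
    ∃ s : Fin n → Plane → ℝ, (∀ j, s j p = s₀ j) ∧ ∀ᶠ x in 𝓝 p, ∀ j, ContDiffAt ℝ ∞ (s j) x ∧
      N.HasCov (k j) (s j) x (∑ l, M₁ j l x * s l x) (∑ l, M₂ j l x * s l x) := by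
  have hα := contDiffOn_covForm (N := N) (k := k) hUW h₁ h₂
  have hfl : ∀ x ∈ U, ∀ j l, extD (N.covForm k M₁ M₂ j l) x
      = ∑ m, wedge (N.covForm k M₁ M₂ j m) (N.covForm k M₁ M₂ m l) x := by
    intro x hx j l
    have hxW := hUW hx
    have hn := hU.mem_nhds hx
    have hW := W.isOpen_domain.mem_nhds hxW
    have hg1 := hasCov_of_contDiffAt N 1 (N.contDiffOn_g₁.contDiffAt hW)
    have hg2 := hasCov_of_contDiffAt N 1 (N.contDiffOn_g₂.contDiffAt hW)
    have hm1 := hasCov_of_contDiffAt N 1 ((h₁ j l).contDiffAt hn)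
    have hm2 := hasCov_of_contDiffAt N 1 ((h₂ j l).contDiffAt hn)
    have e := N.extD_coframe hxW (hm1.add ((hg1.const_mul (if j = l then (k j : ℝ) else 0)))).1
      (hm2.add ((hg2.const_mul (if j = l then (k j : ℝ) else 0)))).1
    rw [(hm1.add ((hg1.const_mul (if j = l then (k j : ℝ) else 0)))).2.2,
      (hm2.add ((hg2.const_mul (if j = l then (k j : ℝ) else 0)))).2.1] at e
    change extD (N.covForm k M₁ M₂ j l) x = _ at e
    have w : ∀ m, wedge (N.covForm k M₁ M₂ j m) (N.covForm k M₁ M₂ m l) x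
        = N.area x * ((M₁ j m x * M₂ m l x - M₂ j m x * M₁ m l x)
          + (if j = m then (k j : ℝ) else 0) * (N.g₁ x * M₂ m l x - N.g₂ x * M₁ m l x)
          + (if m = l then (k m : ℝ) else 0) * (N.g₂ x * M₁ j m x - N.g₁ x * M₂ j m x)) := by
      intro m
      simp only [wedge, covForm, area, add_apply, smul_apply, smul_eq_mul]
      ring
    have hsum : ∑ m, wedge (N.covForm k M₁ M₂ j m) (N.covForm k M₁ M₂ m l) x
        = N.area x * ((∑ m, (M₁ j m x * M₂ m l x - M₂ j m x * M₁ m l x))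
          + k j * (N.g₁ x * M₂ j l x - N.g₂ x * M₁ j l x)
          + k l * (N.g₂ x * M₁ j l x - N.g₁ x * M₂ j l x)) := by
      simp only [w]
      rw [← Finset.mul_sum, Finset.sum_add_distrib, Finset.sum_add_distrib]
      congr 2
      · congr 1
        rw [Finset.sum_eq_single j]
        · simp
        · intro b _ hb
          simp [hb.symm]
        · simp
      · rw [Finset.sum_eq_single l]
        · simp
        · intro b _ hb
          simp [hb]
        · simp
    rw [e, hsum, ← hflat x hx j l, N.K_eq hxW]
    -- By `hk` the subtraction of weights is not truncated. Passing from weight 1, used by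
    -- `extD_coframe`, to the true weight of the entry produces the terms with `k j - k l`, which
    -- match those that the diagonal terms contribute to the wedge products.
    have c1 : N.δ₁ (k j + 1 - k l) (M₂ j l) x
        = N.δ₁ 1 (M₂ j l) x - ((k j : ℝ) - k l) * N.g₁ x * M₂ j l x := by
      simp only [δ₁, Nat.cast_sub (hk j l)]
      push_cast
      ring
    have c2 : N.δ₂ (k j + 1 - k l) (M₁ j l) x
        = N.δ₂ 1 (M₁ j l) x - ((k j : ℝ) - k l) * N.g₂ x * M₁ j l x := by
      simp only [δ₂, Nat.cast_sub (hk j l)]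
      push_cast
      ring
    rw [c1, c2]
    ring
  obtain ⟨s, hs0, hs⟩ := exists_solution_of_flat hU hp (contDiffOn_matrixConnection hα)
    (matrixConnection_flat hU hα hfl) s₀
  refine ⟨fun j x => s x j, fun j => congrFun hs0 j, ?_⟩
  filter_upwards [hs, hU.mem_nhds hp] with x hx hxU j
  exact ⟨contDiffAt_pi.1 hx.1 j,
    (hasCov_iff_hasFDerivAt_matrixConnection (hUW hxU) (s := fun j x => s x j)).2 hx.2 j⟩

/-- A solution of a weighted linear system either vanishes near a point or has no zeros near
the point. -/
theorem cov_solution_zero_or_ne_zero {U : Set Plane} (hU : IsOpen U) (hUW : U ⊆ W.domain)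
    {p : Plane} (hp : p ∈ U)
    (h₁ : ∀ j l, ContDiffOn ℝ ∞ (M₁ j l) U) (h₂ : ∀ j l, ContDiffOn ℝ ∞ (M₂ j l) U)
    {s : Fin n → Plane → ℝ}
    (hs : ∀ᶠ x in 𝓝 p, ∀ j,
      N.HasCov (k j) (s j) x (∑ l, M₁ j l x * s l x) (∑ l, M₂ j l x * s l x)) :
    (∀ᶠ x in 𝓝 p, ∀ j, s j x = 0) ∨ ∀ᶠ x in 𝓝 p, ∃ j, s j x ≠ 0 := by
  have hα := contDiffOn_covForm (N := N) (k := k) hUW h₁ h₂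
  have hc := eventually_norm_lt
    ((contDiffOn_matrixConnection hα).continuousOn.continuousAt (hU.mem_nhds hp))
  have key := eventually_eq_zero_or_ne_zero (s := fun y j => s j y)
    (s' := fun x => (matrixConnection (N.covForm k M₁ M₂) x).flip fun j => s j x) (p := p)
    (C := ‖matrixConnection (N.covForm k M₁ M₂) p‖ + 1) (by
      filter_upwards [hs, hU.mem_nhds hp] with x hx hxU
      exact (hasCov_iff_hasFDerivAt_matrixConnection (hUW hxU)).1 hx) (by
      filter_upwards [hc] with x hx
      refine ((matrixConnection (N.covForm k M₁ M₂) x).flip.le_opNorm _).trans ?_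
      rw [ContinuousLinearMap.opNorm_flip]
      exact mul_le_mul_of_nonneg_right hx.le (norm_nonneg _))
  refine key.imp (fun h => h.mono fun x hx j => congrFun hx j) (fun h => h.mono fun x hx => ?_)
  by_contra! hcon
  exact hx (funext hcon)

end FourWeb.Normalization

namespace FourWeb.Normalization

variable {W : FourWeb} (N : W.Normalization)

/-! ### The abelian equation in terms of two functions -/

/-- The reduced form of the abelian equation: `u` and `v` (of weight 1) satisfy
`δ₁ u = δ₂ u = - δ₁ v` and `δ₁ v = δ₂ (a v)` near `p`. -/
def IsSolutionNear (p : Plane) (u v : Plane → ℝ) : Prop :=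
  ∀ᶠ x in 𝓝 p, ContDiffAt ℝ ∞ u x ∧ ContDiffAt ℝ ∞ v x ∧
    N.HasCov 1 u x (-(N.a x * N.δ₂ 1 v x + N.a₂ x * v x)) (-(N.a x * N.δ₂ 1 v x + N.a₂ x * v x)) ∧
    N.δ₁ 1 v x = N.a x * N.δ₂ 1 v x + N.a₂ x * v x

/-- The coefficient of the `i`-th normalized form in an abelian relation. -/
def coef (l : Plane → Fin 4 → ℝ) (i : Fin 4) (x : Plane) : ℝ := l x i / N.scale i x

/-- The abelian relation with last two coefficients `u` and `v`. -/
def relation (u v : Plane → ℝ) (x : Plane) : Fin 4 → ℝ :=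
  ![(u x + N.a x * v x) * N.scale 0 x, (u x + v x) * N.scale 1 x, u x * N.scale 2 x,
    v x * N.scale 3 x]

variable {N} {p x : Plane}

lemma hasCov_a (hx : x ∈ W.domain) : N.HasCov 0 N.a x (N.a₁ x) (N.a₂ x) :=
  hasCov_of_contDiffAt N 0 (N.a_smooth.contDiffAt (W.isOpen_domain.mem_nhds hx))

lemma smul_form_eq (hx : x ∈ W.domain) (l : Plane → Fin 4 → ℝ) (i : Fin 4) :
    l x i • W.form i x = N.coef l i x • N.normForm i x := by
  rw [normForm, smul_smul, coef, div_mul_cancel₀ _ (N.scale_ne_zero i x hx)]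

lemma smul_coframe_inj (hx : x ∈ W.domain) {b c : ℝ}
    (h : b • N.normForm 0 x + c • N.normForm 1 x = 0) : b = 0 ∧ c = 0 := by
  constructor
  · simpa [N.normForm_zero_frame₁ hx, N.normForm_one_frame₁] using
      DFunLike.congr_fun h (N.frame₁ x)
  · simpa [N.normForm_zero_frame₂, N.normForm_one_frame₂ hx] using
      DFunLike.congr_fun h (N.frame₂ x)

lemma sum_smul_form (hx : x ∈ W.domain) (l : Plane → Fin 4 → ℝ) :
    ∑ i, l x i • W.form i x
      = (N.coef l 0 x - N.coef l 2 x - N.a x * N.coef l 3 x) • N.normForm 0 x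
        + (N.coef l 1 x - N.coef l 2 x - N.coef l 3 x) • N.normForm 1 x := by
  simp only [Fin.sum_univ_four, smul_form_eq (N := N) hx, N.normForm_two hx, N.normForm_three hx]
  module

lemma smul_form_eq_coframe (hx : x ∈ W.domain) (l : Plane → Fin 4 → ℝ) :
    l x 0 • W.form 0 x = N.coef l 0 x • N.normForm 0 x + (0 : ℝ) • N.normForm 1 x ∧
    l x 1 • W.form 1 x = (0 : ℝ) • N.normForm 0 x + N.coef l 1 x • N.normForm 1 x ∧
    l x 2 • W.form 2 x
      = (-N.coef l 2 x) • N.normForm 0 x + (-N.coef l 2 x) • N.normForm 1 x ∧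
    l x 3 • W.form 3 x
      = (-(N.a x * N.coef l 3 x)) • N.normForm 0 x + (-N.coef l 3 x) • N.normForm 1 x := by
  simp only [smul_form_eq (N := N) hx, N.normForm_two hx, N.normForm_three hx]
  refine ⟨?_, ?_, ?_, ?_⟩ <;> module

lemma contDiffAt_coef (hx : x ∈ W.domain) {l : Plane → Fin 4 → ℝ} (hl : ContDiffAt ℝ ∞ l x)
    (i : Fin 4) : ContDiffAt ℝ ∞ (N.coef l i) x :=
  (contDiffAt_pi.1 hl i).div ((N.scale_smooth i).contDiffAt (W.isOpen_domain.mem_nhds hx))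
    (N.scale_ne_zero i x hx)

/-- The equations for the exterior derivatives of an abelian relation. -/
lemma extD_smul_form {l : Plane → Fin 4 → ℝ} (hx : x ∈ W.domain) (hl : ContDiffAt ℝ ∞ l x) :
    extD (fun y => l y 0 • W.form 0 y) x = N.area x * (-N.δ₂ 1 (N.coef l 0) x) ∧
    extD (fun y => l y 1 • W.form 1 y) x = N.area x * N.δ₁ 1 (N.coef l 1) x ∧
    extD (fun y => l y 2 • W.form 2 y) x
      = N.area x * (N.δ₂ 1 (N.coef l 2) x - N.δ₁ 1 (N.coef l 2) x) ∧
    extD (fun y => l y 3 • W.form 3 y) x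
      = N.area x * (N.a x * N.δ₂ 1 (N.coef l 3) x + N.a₂ x * N.coef l 3 x
        - N.δ₁ 1 (N.coef l 3) x) := by
  have hn := W.isOpen_domain.mem_nhds hx
  have hc := fun i => hasCov_of_contDiffAt N 1 (contDiffAt_coef (N := N) hx hl i)
  have h0 : N.HasCov 1 (fun _ => 0) x 0 0 := by
    simpa using (hasCov_of_contDiffAt N 1 (contDiffAt_const (c := (0 : ℝ)))).const_mul 0
  have ha := (hasCov_a hx).mul (hc 3)
  refine ⟨?_, ?_, ?_, ?_⟩
  · rw [extD_congr (by filter_upwards [hn] with y hy using (smul_form_eq_coframe (N := N) hy l).1),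
      N.extD_coframe hx (hc 0).1 h0.1, h0.2.1, zero_sub]
  · rw [extD_congr (by filter_upwards [hn] with y hy using (smul_form_eq_coframe (N := N) hy l).2.1),
      N.extD_coframe hx h0.1 (hc 1).1, h0.2.2, sub_zero]
  · rw [extD_congr (by
        filter_upwards [hn] with y hy using (smul_form_eq_coframe (N := N) hy l).2.2.1),
      N.extD_coframe hx (hc 2).neg.1 (hc 2).neg.1, (hc 2).neg.2.1, (hc 2).neg.2.2]
    ring
  · rw [extD_congr (by
        filter_upwards [hn] with y hy using (smul_form_eq_coframe (N := N) hy l).2.2.2),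
      N.extD_coframe hx ha.neg.1 (hc 3).neg.1, (hc 3).neg.2.1, ha.neg.2.2]
    ring

lemma relation_coef (hp : p ∈ W.domain) {l : Plane → Fin 4 → ℝ} (hl : W.IsAbelianNear p l) :
    ∀ᶠ x in 𝓝 p, N.coef l 0 x = N.coef l 2 x + N.a x * N.coef l 3 x ∧
      N.coef l 1 x = N.coef l 2 x + N.coef l 3 x ∧
      l x = N.relation (N.coef l 2) (N.coef l 3) x := by
  filter_upwards [hl.2.1, W.isOpen_domain.mem_nhds hp] with x h1 hx
  rw [sum_smul_form (N := N) hx] at h1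
  obtain ⟨h2, h3⟩ := smul_coframe_inj hx h1
  have e0 : N.coef l 0 x = N.coef l 2 x + N.a x * N.coef l 3 x := by linarith
  have e1 : N.coef l 1 x = N.coef l 2 x + N.coef l 3 x := by linarith
  refine ⟨e0, e1, ?_⟩
  have hc : ∀ i, l x i = N.coef l i x * N.scale i x := fun i =>
    (div_mul_cancel₀ _ (N.scale_ne_zero i x hx)).symm
  funext i
  rw [relation, ← e0, ← e1]
  fin_cases i
  · exact hc 0
  · exact hc 1
  · exact hc 2
  · exact hc 3

lemma isSolutionNear_coef (hp : p ∈ W.domain) {l : Plane → Fin 4 → ℝ}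
    (hl : W.IsAbelianNear p l) : N.IsSolutionNear p (N.coef l 2) (N.coef l 3) := by
  filter_upwards [hl.1, (relation_coef (N := N) hp hl).eventually_nhds, hl.2.2 0, hl.2.2 1,
    hl.2.2 2, hl.2.2 3, W.isOpen_domain.mem_nhds hp] with x hsm hrel d0 d1 d2 d3 hx
  have hA := N.area_ne_zero hx
  obtain ⟨e0, e1, e2, e3⟩ := extD_smul_form (N := N) hx hsm
  rw [e0, mul_eq_zero, or_iff_right hA] at d0
  rw [e1, mul_eq_zero, or_iff_right hA] at d1
  rw [e2, mul_eq_zero, or_iff_right hA] at d2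
  rw [e3, mul_eq_zero, or_iff_right hA] at d3
  have hc := fun i => contDiffAt_coef (N := N) hx hsm i
  have hd := fun i => hasCov_of_contDiffAt N 1 (hc i)
  have h1 := ((hd 1).unique ((hd 2).add (hd 3)) (hrel.mono fun y hy => hy.2.1)).1
  refine ⟨hc 2, hc 3, (hd 2).congr_deriv ?_ ?_, ?_⟩ <;> linarith

lemma isAbelianNear_relation (hp : p ∈ W.domain) {u v : Plane → ℝ}
    (h : N.IsSolutionNear p u v) : W.IsAbelianNear p (N.relation u v) := by
  have hsm : ∀ᶠ x in 𝓝 p, ContDiffAt ℝ ∞ (N.relation u v) x := by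
    filter_upwards [h, W.isOpen_domain.mem_nhds hp] with x hx hxW
    have hn := W.isOpen_domain.mem_nhds hxW
    have hs := fun i => (N.scale_smooth i).contDiffAt hn
    rw [contDiffAt_pi]
    intro i
    fin_cases i
    · exact (hx.1.add ((N.a_smooth.contDiffAt hn).mul hx.2.1)).mul (hs 0)
    · exact (hx.1.add hx.2.1).mul (hs 1)
    · exact hx.1.mul (hs 2)
    · exact hx.2.1.mul (hs 3)
  have hc : ∀ y ∈ W.domain, N.coef (N.relation u v) 0 y = u y + N.a y * v y ∧
      N.coef (N.relation u v) 1 y = u y + v y ∧ N.coef (N.relation u v) 2 y = u y ∧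
      N.coef (N.relation u v) 3 y = v y := fun y hy =>
    ⟨mul_div_cancel_right₀ _ (N.scale_ne_zero 0 y hy),
      mul_div_cancel_right₀ _ (N.scale_ne_zero 1 y hy),
      mul_div_cancel_right₀ _ (N.scale_ne_zero 2 y hy),
      mul_div_cancel_right₀ _ (N.scale_ne_zero 3 y hy)⟩
  refine ⟨hsm, ?_, ?_⟩
  · filter_upwards [W.isOpen_domain.mem_nhds hp] with x hx
    obtain ⟨h0, h1, h2, h3⟩ := hc x hx
    rw [sum_smul_form (N := N) hx, h0, h1, h2, h3]
    module
  · have key : ∀ᶠ x in 𝓝 p, ∀ i, extD (fun y => N.relation u v y i • W.form i y) x = 0 := by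
      filter_upwards [h, hsm, W.isOpen_domain.mem_nhds hp] with x hx hxs hxW
      have hn := W.isOpen_domain.mem_nhds hxW
      have hu := hx.2.2.1
      have hv : N.HasCov 1 v x _ _ := (hasCov_of_contDiffAt N 1 hx.2.1).congr_deriv hx.2.2.2 rfl
      obtain ⟨e0, e1, e2, e3⟩ := extD_smul_form (N := N) hxW hxs
      have c0 := (hu.add ((hasCov_a hxW).mul hv)).congr
        (h := N.coef (N.relation u v) 0) (by filter_upwards [hn] with y hy using (hc y hy).1)
      have c1 := (hu.add hv).congr
        (h := N.coef (N.relation u v) 1) (by filter_upwards [hn] with y hy using (hc y hy).2.1)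
      have c2 := hu.congr
        (h := N.coef (N.relation u v) 2) (by filter_upwards [hn] with y hy using (hc y hy).2.2.1)
      have c3 := hv.congr
        (h := N.coef (N.relation u v) 3) (by filter_upwards [hn] with y hy using (hc y hy).2.2.2)
      intro i
      fin_cases i
      · refine e0.trans ?_
        rw [c0.2.2]
        ring
      · refine e1.trans ?_
        rw [c1.2.1]
        ring
      · refine e2.trans ?_
        rw [c2.2.1, c2.2.2]
        ring
      · refine e3.trans ?_
        rw [c3.2.1, c3.2.2, (hc x hxW).2.2.2]
        ring
    exact fun i => key.mono fun x hx => hx i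

/-! ### The rank -/

lemma exists_solution_of_rank_eq_one (hp : p ∈ W.domain) (hr : W.rank p hp = 1) :
    ∃ u v, N.IsSolutionNear p u v ∧ ¬ ∀ᶠ x in 𝓝 p, u x = 0 ∧ v x = 0 := by
  obtain ⟨⟨L, l, hl, rfl⟩, hL, -⟩ := rank_eq_one_iff.1 hr
  refine ⟨_, _, isSolutionNear_coef (N := N) hp hl, fun h0 => hL ?_⟩
  rw [Subtype.ext_iff]
  refine Germ.coe_eq.2 ?_
  filter_upwards [h0, relation_coef (N := N) hp hl] with x hx hx'
  rw [hx'.2.2]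
  funext i
  fin_cases i <;> simp [relation, hx.1, hx.2]

/-- In a space of dimension one all solutions are multiples of one, so the values `(u, v)` at `p` of
any two have zero determinant. Frobenius contradicts this by producing the values `(1, 0)` and `(0,
1)`. -/
lemma mul_eq_mul_of_rank_eq_one (hp : p ∈ W.domain) (hr : W.rank p hp = 1)
    {u v u' v' : Plane → ℝ} (h : N.IsSolutionNear p u v) (h' : N.IsSolutionNear p u' v') :
    u p * v' p = u' p * v p := by
  obtain ⟨⟨L, l, hl, rfl⟩, -, hgen⟩ := rank_eq_one_iff.1 hr
  have key : ∀ u v : Plane → ℝ, N.IsSolutionNear p u v →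
      ∃ r : ℝ, r * l p 2 = u p * N.scale 2 p ∧ r * l p 3 = v p * N.scale 3 p := by
    intro u v h
    obtain ⟨r, hr⟩ := hgen ⟨_, N.relation u v, isAbelianNear_relation hp h, rfl⟩
    have e : ((r • l : Plane → Fin 4 → ℝ) : Germ (𝓝 p) (Fin 4 → ℝ)) = N.relation u v :=
      congrArg Subtype.val hr
    have e' := (Germ.coe_eq.1 e).eq_of_nhds
    exact ⟨r, congrFun e' 2, congrFun e' 3⟩
  obtain ⟨r, h2, h3⟩ := key u v h
  obtain ⟨r', h2', h3'⟩ := key u' v' h'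
  have n2 := N.scale_ne_zero 2 p hp
  have n3 := N.scale_ne_zero 3 p hp
  have e : (u p * v' p - u' p * v p) * (N.scale 2 p * N.scale 3 p) = 0 := by
    linear_combination (- (v' p * N.scale 3 p)) * h2 - (r * l p 2) * h3'
      + (v p * N.scale 3 p) * h2' + (r' * l p 2) * h3
  rcases mul_eq_zero.1 e with h | h
  · linarith
  · exact absurd h (mul_ne_zero n2 n3)

/-- By `huniq` the linear functional `b u(p) + c v(p)` is injective on the solution space, so the
dimension is at most one; the given solution makes it exactly one. -/
lemma rank_eq_one_of_solution (hp : p ∈ W.domain) {u₀ v₀ : Plane → ℝ} {b c : ℝ}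
    (h₀ : N.IsSolutionNear p u₀ v₀) (hne : u₀ p ≠ 0 ∨ v₀ p ≠ 0)
    (huniq : ∀ u v, N.IsSolutionNear p u v → b * u p + c * v p = 0 →
      ∀ᶠ x in 𝓝 p, u x = 0 ∧ v x = 0) : W.rank p hp = 1 := by
  have hφ : b * u₀ p + c * v₀ p ≠ 0 := by
    intro h
    have h1 := (huniq u₀ v₀ h₀ h).self_of_nhds
    exact hne.elim (fun h => h h1.1) (fun h => h h1.2)
  set L₀ : W.abelianGerms p hp := ⟨_, N.relation u₀ v₀, isAbelianNear_relation hp h₀, rfl⟩ with hL₀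
  refine rank_eq_one_iff.2 ⟨L₀, fun h0 => ?_, ?_⟩
  · have h1 : ((N.relation u₀ v₀ : Plane → Fin 4 → ℝ) : Germ (𝓝 p) (Fin 4 → ℝ))
        = ((0 : Plane → Fin 4 → ℝ) : Germ (𝓝 p) (Fin 4 → ℝ)) := congrArg Subtype.val h0
    have h2 := (Germ.coe_eq.1 h1).eq_of_nhds
    have h3 : u₀ p * N.scale 2 p = 0 := congrFun h2 2
    have h4 : v₀ p * N.scale 3 p = 0 := congrFun h2 3
    rw [mul_eq_zero, or_iff_left (N.scale_ne_zero _ p hp)] at h3 h4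
    exact hne.elim (fun h => h h3) (fun h => h h4)
  · rintro ⟨L, l, hl, rfl⟩
    -- The multiple of the given solution for which the difference is killed by the functional.
    set r := (b * N.coef l 2 p + c * N.coef l 3 p) / (b * u₀ p + c * v₀ p) with hr
    refine ⟨r, ?_⟩
    obtain ⟨l', hl', e⟩ := ((⟨_, l, hl, rfl⟩ : W.abelianGerms p hp) - r • L₀).2
    have e1 : ((l - r • N.relation u₀ v₀ : Plane → Fin 4 → ℝ) : Germ (𝓝 p) (Fin 4 → ℝ)) = l' := e
    have e2 := Germ.coe_eq.1 e1
    have e3 := e2.eq_of_nhds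
    have n2 := N.scale_ne_zero 2 p hp
    have n3 := N.scale_ne_zero 3 p hp
    have c2 : N.coef l' 2 p = N.coef l 2 p - r * u₀ p := by
      have : l p 2 - r * (u₀ p * N.scale 2 p) = l' p 2 := congrFun e3 2
      rw [coef, coef, ← this]
      field_simp
    have c3 : N.coef l' 3 p = N.coef l 3 p - r * v₀ p := by
      have : l p 3 - r * (v₀ p * N.scale 3 p) = l' p 3 := congrFun e3 3
      rw [coef, coef, ← this]
      field_simp
    have hz := huniq _ _ (isSolutionNear_coef (N := N) hp hl') (by
      rw [c2, c3]
      have : r * (b * u₀ p + c * v₀ p) = b * N.coef l 2 p + c * N.coef l 3 p :=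
        div_mul_cancel₀ _ hφ
      linarith)
    rw [Subtype.ext_iff]
    refine Germ.coe_eq.2 ?_
    filter_upwards [hz, relation_coef (N := N) hp hl', e2] with x hx hx' hx2
    rw [hx'.2.2] at hx2
    have hzero : N.relation (N.coef l' 2) (N.coef l' 3) x = 0 := by
      funext i
      fin_cases i <;> simp [relation, hx.1, hx.2]
    rw [hzero] at hx2
    exact (sub_eq_zero.1 hx2).symm

end FourWeb.Normalization

namespace FourWeb.Normalization

variable {W : FourWeb} (N : W.Normalization)

/-! ### Smoothness of the invariants -/

lemma contDiffOn_a₁ : ContDiffOn ℝ ∞ N.a₁ W.domain :=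
  N.contDiffOn_δ₁ W.isOpen_domain subset_rfl 0 N.a_smooth

lemma contDiffOn_a₂ : ContDiffOn ℝ ∞ N.a₂ W.domain :=
  N.contDiffOn_δ₂ W.isOpen_domain subset_rfl 0 N.a_smooth

lemma contDiffOn_a₁₁ : ContDiffOn ℝ ∞ N.a₁₁ W.domain :=
  N.contDiffOn_δ₁ W.isOpen_domain subset_rfl 1 N.contDiffOn_a₁

lemma contDiffOn_a₁₂ : ContDiffOn ℝ ∞ N.a₁₂ W.domain :=
  N.contDiffOn_δ₂ W.isOpen_domain subset_rfl 1 N.contDiffOn_a₁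

lemma contDiffOn_a₂₂ : ContDiffOn ℝ ∞ N.a₂₂ W.domain :=
  N.contDiffOn_δ₂ W.isOpen_domain subset_rfl 1 N.contDiffOn_a₂

lemma contDiffOn_δ₁_a₂ : ContDiffOn ℝ ∞ (N.δ₁ 1 (N.δ₂ 0 N.a)) W.domain :=
  N.contDiffOn_δ₁ W.isOpen_domain subset_rfl 1 N.contDiffOn_a₂

lemma contDiffOn_a₁₁₂ : ContDiffOn ℝ ∞ N.a₁₁₂ W.domain :=
  (((N.contDiffOn_δ₂ W.isOpen_domain subset_rfl 2 N.contDiffOn_a₁₁).add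
    (N.contDiffOn_δ₁ W.isOpen_domain subset_rfl 2 N.contDiffOn_a₁₂)).add
    (N.contDiffOn_δ₁ W.isOpen_domain subset_rfl 2 N.contDiffOn_δ₁_a₂)).div_const 3

lemma contDiffOn_a₁₂₂ : ContDiffOn ℝ ∞ N.a₁₂₂ W.domain :=
  (((N.contDiffOn_δ₁ W.isOpen_domain subset_rfl 2 N.contDiffOn_a₂₂).add
    (N.contDiffOn_δ₂ W.isOpen_domain subset_rfl 2 N.contDiffOn_δ₁_a₂)).add
    (N.contDiffOn_δ₂ W.isOpen_domain subset_rfl 2 N.contDiffOn_a₁₂)).div_const 3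

lemma contDiffOn_K₁ : ContDiffOn ℝ ∞ N.K₁ W.domain :=
  N.contDiffOn_δ₁ W.isOpen_domain subset_rfl 2 N.contDiffOn_K

lemma contDiffOn_K₂ : ContDiffOn ℝ ∞ N.K₂ W.domain :=
  N.contDiffOn_δ₂ W.isOpen_domain subset_rfl 2 N.contDiffOn_K

/-- The coefficient of `w` in `δ₂ w`, where `w = δ₂ v`. -/
def q₀ (x : Plane) : ℝ :=
  (N.a₁ x + (3 * (N.a x * N.a₂ x) - 2 * N.a₂ x)) / (N.a x * (1 - N.a x))

/-- The coefficient of `v` in `δ₂ w`, where `w = δ₂ v`. -/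
def q₁ (x : Plane) : ℝ :=
  (N.a x * (N.a₂₂ x - N.K x) + N.a₁₂ x + N.a₂ x * N.a₂ x - N.a₂₂ x) / (N.a x * (1 - N.a x))

/-- The coefficient of `u` in `δ₂ w`, where `w = δ₂ v`. -/
def q₂ (x : Plane) : ℝ := (-N.K x) / (N.a x * (1 - N.a x))

/-- The coefficient of `w` in `δ₁ w`, where `w = δ₂ v`. -/
def r₀ (x : Plane) : ℝ := N.a x * N.q₀ x + 2 * N.a₂ x

/-- The coefficient of `v` in `δ₁ w`, where `w = δ₂ v`. -/
def r₁ (x : Plane) : ℝ := N.a x * N.q₁ x + (N.a₂₂ x - N.K x)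

/-- The coefficient of `u` in `δ₁ w`, where `w = δ₂ v`. -/
def r₂ (x : Plane) : ℝ := N.a x * N.q₂ x

/-- The first order invariants and the coefficients of the prolonged system are smooth. -/
lemma contDiffAt_invariants {x : Plane} (hx : x ∈ W.domain) :
    ContDiffAt ℝ ∞ N.c₀ x ∧ ContDiffAt ℝ ∞ N.c₁ x ∧ ContDiffAt ℝ ∞ N.c₂ x ∧
    ContDiffAt ℝ ∞ N.q₀ x ∧ ContDiffAt ℝ ∞ N.q₁ x ∧ ContDiffAt ℝ ∞ N.q₂ x ∧
    ContDiffAt ℝ ∞ N.r₀ x ∧ ContDiffAt ℝ ∞ N.r₁ x ∧ ContDiffAt ℝ ∞ N.r₂ x := by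
  have hn := W.isOpen_domain.mem_nhds hx
  have ha := N.a_smooth.contDiffAt hn
  have ha1 := N.contDiffOn_a₁.contDiffAt hn
  have ha2 := N.contDiffOn_a₂.contDiffAt hn
  have ha11 := N.contDiffOn_a₁₁.contDiffAt hn
  have ha12 := N.contDiffOn_a₁₂.contDiffAt hn
  have ha22 := N.contDiffOn_a₂₂.contDiffAt hn
  have ha112 := N.contDiffOn_a₁₁₂.contDiffAt hn
  have ha122 := N.contDiffOn_a₁₂₂.contDiffAt hn
  have hK := N.contDiffOn_K.contDiffAt hn
  have hK1 := N.contDiffOn_K₁.contDiffAt hn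
  have hK2 := N.contDiffOn_K₂.contDiffAt hn
  have n1 := N.a_ne_zero hx
  have n2 := N.one_sub_a_ne_zero hx
  have hq0 : ContDiffAt ℝ ∞ N.q₀ x := by
    unfold q₀
    fun_prop (disch := simp [n1, n2])
  have hq1 : ContDiffAt ℝ ∞ N.q₁ x := by
    unfold q₁
    fun_prop (disch := simp [n1, n2])
  have hq2 : ContDiffAt ℝ ∞ N.q₂ x := by
    unfold q₂
    fun_prop (disch := simp [n1, n2])
  refine ⟨?_, ?_, ?_, hq0, hq1, hq2, ?_, ?_, ?_⟩
  · unfold c₀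
    fun_prop (disch := simp [n1, n2])
  · unfold c₁
    fun_prop (disch := simp [n1, n2])
  · unfold c₂
    fun_prop (disch := simp [n1, n2])
  · unfold r₀
    fun_prop
  · unfold r₁
    fun_prop
  · unfold r₂
    fun_prop

lemma contDiffOn_c₀ : ContDiffOn ℝ ∞ N.c₀ W.domain := fun _ hx =>
  (N.contDiffAt_invariants hx).1.contDiffWithinAt

lemma contDiffOn_c₁ : ContDiffOn ℝ ∞ N.c₁ W.domain := fun _ hx =>
  (N.contDiffAt_invariants hx).2.1.contDiffWithinAt

lemma contDiffOn_c₂ : ContDiffOn ℝ ∞ N.c₂ W.domain := fun _ hx =>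
  (N.contDiffAt_invariants hx).2.2.1.contDiffWithinAt

variable {N} {p x : Plane}

/-! ### Covariant derivatives of the invariants -/

/-- The quotient rule for a denominator of weight 0. -/
lemma HasCov.div_scalar {k : ℕ} {f h : Plane → ℝ} {d₁ d₂ e₁ e₂ : ℝ} (hf : N.HasCov k f x d₁ d₂)
    (hh : N.HasCov 0 h x e₁ e₂) (h0 : h x ≠ 0) :
    N.HasCov k (fun y => f y / h y) x ((d₁ - f x / h x * e₁) / h x)
      ((d₂ - f x / h x * e₂) / h x) :=
  HasCov.div (l := 0) hf hh h0

lemma hasCov_a₁ (hx : x ∈ W.domain) : N.HasCov 1 N.a₁ x (N.a₁₁ x) (N.a₁₂ x) :=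
  hasCov_of_contDiffAt N 1 (N.contDiffOn_a₁.contDiffAt (W.isOpen_domain.mem_nhds hx))

lemma δ₁_a₂ (hx : x ∈ W.domain) : N.δ₁ 1 N.a₂ x = N.a₁₂ x := by
  have h := N.δ₁_δ₂_sub 0 hx (N.a_smooth.contDiffAt (W.isOpen_domain.mem_nhds hx))
  simp only [Nat.cast_zero, neg_zero, zero_mul] at h
  exact sub_eq_zero.1 h

lemma hasCov_a₂ (hx : x ∈ W.domain) : N.HasCov 1 N.a₂ x (N.a₁₂ x) (N.a₂₂ x) :=
  (hasCov_of_contDiffAt N 1 (N.contDiffOn_a₂.contDiffAt (W.isOpen_domain.mem_nhds hx))).congr_deriv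
    (δ₁_a₂ hx) rfl

lemma hasCov_K (hx : x ∈ W.domain) : N.HasCov 2 N.K x (N.K₁ x) (N.K₂ x) :=
  hasCov_of_contDiffAt N 2 (N.contDiffOn_K.contDiffAt (W.isOpen_domain.mem_nhds hx))

/-- Of the three terms in each symmetrized derivative two are equal to a derivative of `a₁₂`, since
`δ₁` and `δ₂` commute on weight 0. The third differs by a commutator on weight 1, and averaging
leaves a third of it. -/
lemma hasCov_a₁₂ (hx : x ∈ W.domain) :
    N.HasCov 2 N.a₁₂ x (N.a₁₁₂ x - N.K x * N.a₁ x / 3) (N.a₁₂₂ x + N.K x * N.a₂ x / 3) := by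
  have hn := W.isOpen_domain.mem_nhds hx
  have e : (N.δ₁ 1 (N.δ₂ 0 N.a)) =ᶠ[𝓝 x] N.a₁₂ := by
    filter_upwards [hn] with y hy using δ₁_a₂ hy
  have h12 := hasCov_of_contDiffAt N 2 (N.contDiffOn_a₁₂.contDiffAt hn)
  have h21 := h12.congr e
  have k1 := N.δ₁_δ₂_sub 1 hx (N.contDiffOn_a₁.contDiffAt hn)
  have k2 := N.δ₁_δ₂_sub 1 hx (N.contDiffOn_a₂.contDiffAt hn)
  have e2 : N.δ₂ 2 (N.δ₁ 1 N.a₂) x = N.δ₂ 2 N.a₁₂ x := h21.2.2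
  change N.δ₁ 2 N.a₁₂ x - N.δ₂ 2 (N.δ₁ 1 (N.δ₁ 0 N.a)) x = _ at k1
  change N.δ₁ 2 (N.δ₂ 1 (N.δ₂ 0 N.a)) x - N.δ₂ 2 (N.δ₁ 1 N.a₂) x = _ at k2
  have d1 : N.a₁₁₂ x = (N.δ₂ 2 (N.δ₁ 1 (N.δ₁ 0 N.a)) x + N.δ₁ 2 N.a₁₂ x
    + N.δ₁ 2 (N.δ₁ 1 (N.δ₂ 0 N.a)) x) / 3 := rfl
  have d2 : N.a₁₂₂ x = (N.δ₁ 2 (N.δ₂ 1 (N.δ₂ 0 N.a)) x + N.δ₂ 2 (N.δ₁ 1 (N.δ₂ 0 N.a)) x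
    + N.δ₂ 2 N.a₁₂ x) / 3 := rfl
  rw [h21.2.1] at d1
  rw [h21.2.2] at d2
  rw [e2] at k2
  push_cast at k1 k2
  refine h12.congr_deriv ?_ ?_ <;> linarith

/-- The derivative `N.δ₂ 2 N.a₂₂` needs no name, because it cancels in `curvature₁`. -/
lemma hasCov_a₂₂ (hx : x ∈ W.domain) :
    N.HasCov 2 N.a₂₂ x (N.a₁₂₂ x - 2 * N.K x * N.a₂ x / 3) (N.δ₂ 2 N.a₂₂ x) := by
  have hn := W.isOpen_domain.mem_nhds hx
  have e : (N.δ₁ 1 N.a₂) =ᶠ[𝓝 x] N.a₁₂ := by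
    filter_upwards [hn] with y hy using δ₁_a₂ hy
  have h12 := (hasCov_a₁₂ hx).congr e
  have k2 := N.δ₁_δ₂_sub 1 hx (N.contDiffOn_a₂.contDiffAt hn)
  change N.δ₁ 2 N.a₂₂ x - N.δ₂ 2 (N.δ₁ 1 N.a₂) x = _ at k2
  rw [h12.2.2] at k2
  push_cast at k2
  refine (hasCov_of_contDiffAt N 2 (N.contDiffOn_a₂₂.contDiffAt hn)).congr_deriv ?_ rfl
  linarith

lemma hasCov_denominator (hx : x ∈ W.domain) :
    N.HasCov 0 (fun y => N.a y * (1 - N.a y)) x (N.a₁ x * (1 - 2 * N.a x))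
      (N.a₂ x * (1 - 2 * N.a x)) :=
  ((hasCov_a hx).mul ((hasCov_const 1).sub (hasCov_a hx))).congr_deriv (by ring) (by ring)

lemma hasCov_q₀ (hx : x ∈ W.domain) : N.HasCov 1 N.q₀ x
    ((N.a₁₁ x + (3 * (N.a₁ x * N.a₂ x + N.a x * N.a₁₂ x) - 2 * N.a₁₂ x)
      - N.q₀ x * (N.a₁ x * (1 - 2 * N.a x))) / (N.a x * (1 - N.a x)))
    ((N.a₁₂ x + (3 * (N.a₂ x * N.a₂ x + N.a x * N.a₂₂ x) - 2 * N.a₂₂ x)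
      - N.q₀ x * (N.a₂ x * (1 - 2 * N.a x))) / (N.a x * (1 - N.a x))) :=
  ((hasCov_a₁ hx).add ((((hasCov_a hx).mul (hasCov_a₂ hx)).const_mul 3).sub
    ((hasCov_a₂ hx).const_mul 2))).div_scalar (hasCov_denominator hx)
    (mul_ne_zero (N.a_ne_zero hx) (N.one_sub_a_ne_zero hx))

lemma hasCov_q₁ (hx : x ∈ W.domain) : N.HasCov 2 N.q₁ x
    ((N.a₁ x * (N.a₂₂ x - N.K x)
        + N.a x * ((N.a₁₂₂ x - 2 * N.K x * N.a₂ x / 3) - N.K₁ x)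
        + (N.a₁₁₂ x - N.K x * N.a₁ x / 3) + (N.a₁₂ x * N.a₂ x + N.a₂ x * N.a₁₂ x)
        - (N.a₁₂₂ x - 2 * N.K x * N.a₂ x / 3)
        - N.q₁ x * (N.a₁ x * (1 - 2 * N.a x))) / (N.a x * (1 - N.a x)))
    ((N.a₂ x * (N.a₂₂ x - N.K x) + N.a x * (N.δ₂ 2 N.a₂₂ x - N.K₂ x)
        + (N.a₁₂₂ x + N.K x * N.a₂ x / 3) + (N.a₂₂ x * N.a₂ x + N.a₂ x * N.a₂₂ x)
        - N.δ₂ 2 N.a₂₂ x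
        - N.q₁ x * (N.a₂ x * (1 - 2 * N.a x))) / (N.a x * (1 - N.a x))) :=
  (((((hasCov_a hx).mul ((hasCov_a₂₂ hx).sub (hasCov_K hx))).add (hasCov_a₁₂ hx)).add
    ((hasCov_a₂ hx).mul (hasCov_a₂ hx))).sub (hasCov_a₂₂ hx)).div_scalar (hasCov_denominator hx)
    (mul_ne_zero (N.a_ne_zero hx) (N.one_sub_a_ne_zero hx))

lemma hasCov_q₂ (hx : x ∈ W.domain) : N.HasCov 2 N.q₂ x
    ((-N.K₁ x - N.q₂ x * (N.a₁ x * (1 - 2 * N.a x))) / (N.a x * (1 - N.a x)))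
    ((-N.K₂ x - N.q₂ x * (N.a₂ x * (1 - 2 * N.a x))) / (N.a x * (1 - N.a x))) :=
  (hasCov_K hx).neg.div_scalar (hasCov_denominator hx)
    (mul_ne_zero (N.a_ne_zero hx) (N.one_sub_a_ne_zero hx))

/-- The curvature of the prolonged system. -/
lemma curvature₀ (hx : x ∈ W.domain) :
    N.δ₁ 1 N.q₀ x - N.δ₂ 1 N.r₀ x + 2 * N.K x
      = 4 * N.c₀ x + (-(N.r₂ x * N.a x) + N.r₁ x + N.r₀ x * N.q₀ x)
        - (-(N.q₂ x * N.a x) + N.q₁ x * N.a x + N.q₀ x * N.r₀ x) := by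
  have n1 := N.a_ne_zero hx
  have n2 := N.one_sub_a_ne_zero hx
  have hq := hasCov_q₀ (N := N) hx
  have hr : N.HasCov 1 N.r₀ x _ _ := ((hasCov_a hx).mul hq).add ((hasCov_a₂ hx).const_mul 2)
  rw [hq.2.1, hr.2.2]
  simp only [r₀, r₁, r₂, q₀, q₁, q₂, c₀]
  field_simp
  ring

/-- With `curvature₀` and `curvature₂` this is the bottom row of the curvature of the system for
`(u, v, w)`. The term `2 K` of `curvature₀` is the weight of `w` on the diagonal; off the diagonal
there is none. -/
lemma curvature₁ (hx : x ∈ W.domain) :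
    N.δ₁ 2 N.q₁ x - N.δ₂ 2 N.r₁ x
      = 4 * N.c₁ x + (-(N.r₂ x * N.a₂ x) + N.r₀ x * N.q₁ x)
        - (-(N.q₂ x * N.a₂ x) + N.q₁ x * N.a₂ x + N.q₀ x * N.r₁ x) := by
  have n1 := N.a_ne_zero hx
  have n2 := N.one_sub_a_ne_zero hx
  have hq := hasCov_q₁ (N := N) hx
  have hr : N.HasCov 2 N.r₁ x _ _ := ((hasCov_a hx).mul hq).add ((hasCov_a₂₂ hx).sub (hasCov_K hx))
  rw [hq.2.1, hr.2.2]
  simp only [r₀, r₁, r₂, q₀, q₁, q₂, c₁]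
  field_simp
  ring

lemma curvature₂ (hx : x ∈ W.domain) :
    N.δ₁ 2 N.q₂ x - N.δ₂ 2 N.r₂ x
      = 4 * N.c₂ x + N.r₀ x * N.q₂ x - N.q₀ x * N.r₂ x := by
  have n1 := N.a_ne_zero hx
  have n2 := N.one_sub_a_ne_zero hx
  have hq := hasCov_q₂ (N := N) hx
  have hr : N.HasCov 2 N.r₂ x _ _ := (hasCov_a hx).mul hq
  rw [hq.2.1, hr.2.2]
  simp only [r₀, r₂, q₀, q₂, c₂]
  field_simp
  ring

/-! ### The prolonged system -/

/-- The second derivatives of a solution. -/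
lemma IsSolutionNear.hasCov_w {u v : Plane → ℝ} (hp : p ∈ W.domain)
    (h : N.IsSolutionNear p u v) : ∀ᶠ x in 𝓝 p, N.HasCov 2 (N.δ₂ 1 v) x
      (N.r₀ x * N.δ₂ 1 v x + N.r₁ x * v x + N.r₂ x * u x)
      (N.q₀ x * N.δ₂ 1 v x + N.q₁ x * v x + N.q₂ x * u x) := by
  filter_upwards [h.eventually_nhds, W.isOpen_domain.mem_nhds hp] with x hs hx
  have n1 := N.a_ne_zero hx
  have n2 := N.one_sub_a_ne_zero hx
  obtain ⟨hu, hv, hcu, hv1⟩ := hs.self_of_nhds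
  have hcv : N.HasCov 1 v x _ (N.δ₂ 1 v x) := (hasCov_of_contDiffAt N 1 hv).congr_deriv hv1 rfl
  have hw : ContDiffAt ℝ ∞ (N.δ₂ 1 v) x := by
    have h1 := hv.fderiv_right (m := ∞) (by simp)
    have hn := W.isOpen_domain.mem_nhds hx
    exact (h1.clm_apply (N.contDiffOn_frame₂.contDiffAt hn)).sub
      ((contDiffAt_const.mul (N.contDiffOn_g₂.contDiffAt hn)).mul hv)
  have hcw := hasCov_of_contDiffAt N 2 hw
  have hq := ((hasCov_a hx).mul hcw).add ((hasCov_a₂ hx).mul hcv)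
  -- The commutators on `v` and `u` are two linear equations for `δ₁ w` and `δ₂ w`. Their
  -- determinant is `a * (1 - a)` up to sign, which general position makes nonzero.
  have k1 := N.δ₁_δ₂_sub 1 hx hv
  have k2 := N.δ₁_δ₂_sub 1 hx hu
  have e1 := hq.congr (h := N.δ₁ 1 v) (hs.mono fun y hy => hy.2.2.2)
  have e2 := hq.neg.congr (h := N.δ₁ 1 u) (hs.mono fun y hy => hy.2.2.1.2.1)
  have e3 := hq.neg.congr (h := N.δ₂ 1 u) (hs.mono fun y hy => hy.2.2.1.2.2)
  change N.δ₁ 2 (N.δ₂ 1 v) x - N.δ₂ 2 (N.δ₁ 1 v) x = _ at k1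
  change N.δ₁ 2 (N.δ₂ 1 u) x - N.δ₂ 2 (N.δ₁ 1 u) x = _ at k2
  rw [e1.2.2] at k1
  rw [e3.2.1, e2.2.2] at k2
  push_cast at k1 k2
  have w2 : N.δ₂ 2 (N.δ₂ 1 v) x = N.q₀ x * N.δ₂ 1 v x + N.q₁ x * v x + N.q₂ x * u x := by
    simp only [q₀, q₁, q₂]
    field_simp
    linear_combination k2 + N.a x * k1
  refine hcw.congr_deriv ?_ w2
  rw [w2] at k1
  simp only [r₀, r₁, r₂]
  linear_combination k1

/-- The obstruction: every solution satisfies a linear relation of the first order. -/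
lemma IsSolutionNear.obstruction {u v : Plane → ℝ} (hp : p ∈ W.domain)
    (h : N.IsSolutionNear p u v) :
    ∀ᶠ x in 𝓝 p, N.c₀ x * N.δ₂ 1 v x + N.c₁ x * v x + N.c₂ x * u x = 0 := by
  filter_upwards [(h.hasCov_w hp).eventually_nhds, h, W.isOpen_domain.mem_nhds hp]
    with x hws ⟨hu, hv, hcu, hv1⟩ hx
  have hcw := hws.self_of_nhds
  have hcv : N.HasCov 1 v x _ (N.δ₂ 1 v x) := (hasCov_of_contDiffAt N 1 hv).congr_deriv hv1 rfl
  have hw : ContDiffAt ℝ ∞ (N.δ₂ 1 v) x := by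
    have h1 := hv.fderiv_right (m := ∞) (by simp)
    have hn := W.isOpen_domain.mem_nhds hx
    exact (h1.clm_apply (N.contDiffOn_frame₂.contDiffAt hn)).sub
      ((contDiffAt_const.mul (N.contDiffOn_g₂.contDiffAt hn)).mul hv)
  obtain ⟨-, -, -, s0, s1, s2, t0, t1, t2⟩ := N.contDiffAt_invariants hx
  -- The system is now closed, so the commutator on `w` determines nothing new and is a condition on
  -- `(u, v, w)` itself.
  have k := N.δ₁_δ₂_sub 2 hx hw
  have d2 := ((((hasCov_of_contDiffAt N 1 s0).mul hcw).add
    ((hasCov_of_contDiffAt N 2 s1).mul hcv)).add ((hasCov_of_contDiffAt N 2 s2).mul hcu)).congr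
      (h := N.δ₂ 2 (N.δ₂ 1 v)) (hws.mono fun y hy => hy.2.2)
  have d1 := ((((hasCov_of_contDiffAt N 1 t0).mul hcw).add
    ((hasCov_of_contDiffAt N 2 t1).mul hcv)).add ((hasCov_of_contDiffAt N 2 t2).mul hcu)).congr
      (h := N.δ₁ 2 (N.δ₂ 1 v)) (hws.mono fun y hy => hy.2.1)
  change N.δ₁ 3 (N.δ₂ 2 (N.δ₂ 1 v)) x - N.δ₂ 3 (N.δ₁ 2 (N.δ₂ 1 v)) x = _ at k
  rw [d2.2.1, d1.2.2] at k
  push_cast at k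
  have k0 := curvature₀ (N := N) hx
  have k1 := curvature₁ (N := N) hx
  have k2 := curvature₂ (N := N) hx
  linear_combination (1 / 4) * k - (1 / 4) * (N.δ₂ 1 v x) * k0 - (1 / 4) * (v x) * k1
    - (1 / 4) * (u x) * k2

end FourWeb.Normalization

namespace FourWeb.Normalization

variable {W : FourWeb} (N : W.Normalization)

/-! ### The prolonged system as a linear system -/

/-- The matrix of the derivatives in the first direction, for `(u, v, w)`. -/
def prolong₁ : Fin 3 → Fin 3 → Plane → ℝ :=
  ![![fun _ => 0, fun x => -N.a₂ x, fun x => -N.a x], ![fun _ => 0, N.a₂, N.a],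
    ![N.r₂, N.r₁, N.r₀]]

/-- The matrix of the derivatives in the second direction, for `(u, v, w)`. -/
def prolong₂ : Fin 3 → Fin 3 → Plane → ℝ :=
  ![![fun _ => 0, fun x => -N.a₂ x, fun x => -N.a x], ![fun _ => 0, fun _ => 0, fun _ => 1],
    ![N.q₂, N.q₁, N.q₀]]

lemma contDiffOn_prolong₁ (j l : Fin 3) : ContDiffOn ℝ ∞ (N.prolong₁ j l) W.domain := by
  fin_cases j <;> fin_cases l
  · exact contDiffOn_const
  · exact N.contDiffOn_a₂.neg
  · exact N.a_smooth.neg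
  · exact contDiffOn_const
  · exact N.contDiffOn_a₂
  · exact N.a_smooth
  · exact fun x hx => (N.contDiffAt_invariants hx).2.2.2.2.2.2.2.2.contDiffWithinAt
  · exact fun x hx => (N.contDiffAt_invariants hx).2.2.2.2.2.2.2.1.contDiffWithinAt
  · exact fun x hx => (N.contDiffAt_invariants hx).2.2.2.2.2.2.1.contDiffWithinAt

lemma contDiffOn_prolong₂ (j l : Fin 3) : ContDiffOn ℝ ∞ (N.prolong₂ j l) W.domain := by
  fin_cases j <;> fin_cases l
  · exact contDiffOn_const
  · exact N.contDiffOn_a₂.neg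
  · exact N.a_smooth.neg
  · exact contDiffOn_const
  · exact contDiffOn_const
  · exact contDiffOn_const
  · exact fun x hx => (N.contDiffAt_invariants hx).2.2.2.2.2.1.contDiffWithinAt
  · exact fun x hx => (N.contDiffAt_invariants hx).2.2.2.2.1.contDiffWithinAt
  · exact fun x hx => (N.contDiffAt_invariants hx).2.2.2.1.contDiffWithinAt

variable {N} {p x : Plane} {u v : Plane → ℝ}

lemma isSolutionNear_of_hasCov (h : ∀ᶠ x in 𝓝 p, ContDiffAt ℝ ∞ u x ∧ ContDiffAt ℝ ∞ v x ∧
    ∃ w : ℝ, N.HasCov 1 u x (-(N.a x * w + N.a₂ x * v x)) (-(N.a x * w + N.a₂ x * v x)) ∧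
      N.HasCov 1 v x (N.a x * w + N.a₂ x * v x) w) : N.IsSolutionNear p u v := by
  filter_upwards [h] with x ⟨hu, hv, w, hcu, hcv⟩
  refine ⟨hu, hv, ?_⟩
  rw [hcv.2.1, hcv.2.2]
  exact ⟨hcu, rfl⟩

/-- A solution either vanishes near `p`, or its first jet has no zeros near `p`. -/
lemma IsSolutionNear.zero_or_ne_zero (hp : p ∈ W.domain) (h : N.IsSolutionNear p u v) :
    (∀ᶠ x in 𝓝 p, u x = 0 ∧ v x = 0) ∨
      ∀ᶠ x in 𝓝 p, ¬ (u x = 0 ∧ v x = 0 ∧ N.δ₂ 1 v x = 0) := by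
  have key := cov_solution_zero_or_ne_zero (N := N) (k := ![1, 1, 2]) (s := ![u, v, N.δ₂ 1 v])
    W.isOpen_domain subset_rfl hp N.contDiffOn_prolong₁ N.contDiffOn_prolong₂ (by
      filter_upwards [h, h.hasCov_w hp] with x ⟨_, hv, hcu, hv1⟩ hw j
      have hcv := (hasCov_of_contDiffAt N 1 hv).congr_deriv hv1 rfl
      fin_cases j <;> simp only [Fin.sum_univ_three]
      · exact hcu.congr_deriv (by simp [prolong₁]) (by simp [prolong₂])
      · exact hcv.congr_deriv (by simp [prolong₁]; ring) (by simp [prolong₂])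
      · exact hw.congr_deriv (by simp [prolong₁]; ring) (by simp [prolong₂]; ring))
  refine key.imp (fun h => h.mono fun x hx => ⟨hx 0, hx 1⟩) (fun h => h.mono ?_)
  rintro x ⟨j, hj⟩ ⟨h0, h1, h2⟩
  fin_cases j
  · exact hj h0
  · exact hj h1
  · exact hj h2

lemma IsSolutionNear.eventually_eq_zero (hp : p ∈ W.domain) (h : N.IsSolutionNear p u v)
    (hu : u p = 0) (hv : v p = 0) (hw : N.δ₂ 1 v p = 0) : ∀ᶠ x in 𝓝 p, u x = 0 ∧ v x = 0 :=
  (h.zero_or_ne_zero hp).resolve_right fun hne => hne.self_of_nhds ⟨hu, hv, hw⟩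

/-- A web with vanishing obstruction does not have rank one. -/
lemma rank_ne_one_of_obstruction_eq_zero (hp : p ∈ W.domain) (h0 : VanishesNear N.c₀ p)
    (h1 : VanishesNear N.c₁ p) (h2 : VanishesNear N.c₂ p) : W.rank p hp ≠ 1 := by
  intro hr
  obtain ⟨U, hU, hUo, hpU⟩ := eventually_nhds_iff.1
    (h0.and (h1.and (h2.and (W.isOpen_domain.mem_nhds hp))))
  have hUW : U ⊆ W.domain := fun x hx => (hU x hx).2.2.2
  have key : ∀ s₀ : Fin 3 → ℝ, ∃ u v, N.IsSolutionNear p u v ∧ u p = s₀ 0 ∧ v p = s₀ 1 := by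
    intro s₀
    obtain ⟨s, hs0, hs⟩ := exists_cov_solution (N := N) (k := ![1, 1, 2]) hUo hUW hpU
      (M₁ := N.prolong₁) (M₂ := N.prolong₂)
      (by intro j l; fin_cases j <;> fin_cases l <;> simp)
      (fun j l => (N.contDiffOn_prolong₁ j l).mono hUW)
      (fun j l => (N.contDiffOn_prolong₂ j l).mono hUW) (by
        intro x hx j l
        obtain ⟨e0, e1, e2, hxW⟩ := hU x hx
        have k0 := curvature₀ (N := N) hxW
        have k1 := curvature₁ (N := N) hxW
        have k2 := curvature₂ (N := N) hxW
        rw [e0] at k0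
        rw [e1] at k1
        rw [e2] at k2
        have ha := hasCov_a (N := N) hxW
        have ha2 := hasCov_a₂ (N := N) hxW
        have z0 : ∀ m, N.HasCov m (fun _ => 0) x 0 0 := fun m =>
          ⟨differentiableAt_const 0, by simp [δ₁], by simp [δ₂]⟩
        have o0 := hasCov_const (N := N) (x := x) 1
        have n1 := N.a_ne_zero hxW
        have n2 := N.one_sub_a_ne_zero hxW
        -- The rows of `u` and `v` are flat by the choice of `q₀, …, r₂`; only the bottom row sees
        -- `c₀`, `c₁`, `c₂`.
        fin_cases j <;> fin_cases l <;>
          simp [Fin.sum_univ_three, prolong₁, prolong₂, ha.2.2, ha2.2.2, ha.neg.2.1, ha.neg.2.2,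
            ha2.neg.2.1, ha2.neg.2.2, (z0 1).2.1, (z0 1).2.2, o0.2.1]
        all_goals first
          | linarith
          | (simp only [r₀, r₁, r₂, q₀, q₁, q₂]
             field_simp
             ring)) s₀
    refine ⟨s 0, s 1, isSolutionNear_of_hasCov (hs.mono fun x hx => ⟨(hx 0).1, (hx 1).1, s 2 x,
      (hx 0).2.congr_deriv ?_ ?_, (hx 1).2.congr_deriv ?_ ?_⟩), hs0 0, hs0 1⟩ <;>
      (simp only [Fin.sum_univ_three]; simp [prolong₁, prolong₂] <;> ring)
  obtain ⟨u, v, h, hu, hv⟩ := key ![1, 0, 0]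
  obtain ⟨u', v', h', hu', hv'⟩ := key ![0, 1, 0]
  have e := mul_eq_mul_of_rank_eq_one hp hr h h'
  rw [hu, hv, hu', hv'] at e
  simp at e

/-! ### Scalar equations -/

/-- In the commutator on `f` the products `z₁ z₂` cancel, leaving `(δ₁ z₂ - δ₂ z₁ + K) f = 0`. -/
lemma closed_of_scalar_solution {f z₁ z₂ : Plane → ℝ} (hx : x ∈ W.domain)
    (hf : ∀ᶠ y in 𝓝 x, ContDiffAt ℝ ∞ f y ∧ N.HasCov 1 f y (z₁ y * f y) (z₂ y * f y))
    (h₁ : DifferentiableAt ℝ z₁ x) (h₂ : DifferentiableAt ℝ z₂ x) (h0 : f x ≠ 0) :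
    N.δ₁ 1 z₂ x - N.δ₂ 1 z₁ x + N.K x = 0 := by
  have k := N.δ₁_δ₂_sub 1 hx hf.self_of_nhds.1
  have hc := hf.self_of_nhds.2
  have hz1 : N.HasCov 1 z₁ x _ _ := ⟨h₁, rfl, rfl⟩
  have hz2 : N.HasCov 1 z₂ x _ _ := ⟨h₂, rfl, rfl⟩
  have d2 := (hz2.mul hc).congr (h := N.δ₂ 1 f) (hf.mono fun y hy => hy.2.2.2)
  have d1 := (hz1.mul hc).congr (h := N.δ₁ 1 f) (hf.mono fun y hy => hy.2.2.1)
  change N.δ₁ 2 (N.δ₂ 1 f) x - N.δ₂ 2 (N.δ₁ 1 f) x = _ at k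
  rw [d2.2.1, d1.2.2] at k
  push_cast at k
  apply mul_right_cancel₀ h0
  linear_combination k

lemma exists_scalar_solution {z₁ z₂ : Plane → ℝ} {U : Set Plane} (hU : IsOpen U)
    (hUW : U ⊆ W.domain) (hp : p ∈ U) (h₁ : ContDiffOn ℝ ∞ z₁ U) (h₂ : ContDiffOn ℝ ∞ z₂ U)
    (hz : ∀ x ∈ U, N.δ₁ 1 z₂ x - N.δ₂ 1 z₁ x + N.K x = 0) :
    ∃ f : Plane → ℝ, f p = 1 ∧
      ∀ᶠ x in 𝓝 p, ContDiffAt ℝ ∞ f x ∧ N.HasCov 1 f x (z₁ x * f x) (z₂ x * f x) := by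
  obtain ⟨s, hs0, hs⟩ := exists_cov_solution (N := N) (n := 1) (k := fun _ => 1) hU hUW hp
    (M₁ := fun _ _ => z₁) (M₂ := fun _ _ => z₂) (by simp) (fun _ _ => h₁) (fun _ _ => h₂)
    (by
      intro x hx j l
      have h := hz x hx
      simp [Subsingleton.elim j l]
      linarith) (fun _ => 1)
  exact ⟨s 0, hs0 0, hs.mono fun x hx => ⟨(hx 0).1, by simpa using (hx 0).2⟩⟩

end FourWeb.Normalization

namespace FourWeb.Normalization

variable {W : FourWeb} {N : W.Normalization} {p x : Plane} {u v : Plane → ℝ}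

/-! ### Covariant derivatives of the coefficients of the obstruction -/

lemma hasCov_c₀ (hx : x ∈ W.domain) : N.HasCov 2 N.c₀ x (N.c₀₁ x) (N.c₀₂ x) :=
  hasCov_of_contDiffAt N 2 (N.contDiffOn_c₀.contDiffAt (W.isOpen_domain.mem_nhds hx))

lemma hasCov_c₁ (hx : x ∈ W.domain) : N.HasCov 3 N.c₁ x (N.c₁₁ x) (N.c₁₂ x) :=
  hasCov_of_contDiffAt N 3 (N.contDiffOn_c₁.contDiffAt (W.isOpen_domain.mem_nhds hx))

lemma hasCov_c₂ (hx : x ∈ W.domain) : N.HasCov 3 N.c₂ x (N.c₂₁ x) (N.c₂₂ x) :=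
  hasCov_of_contDiffAt N 3 (N.contDiffOn_c₂.contDiffAt (W.isOpen_domain.mem_nhds hx))

lemma contDiffOn_c₁₁ : ContDiffOn ℝ ∞ N.c₁₁ W.domain :=
  N.contDiffOn_δ₁ W.isOpen_domain subset_rfl 3 N.contDiffOn_c₁

lemma contDiffOn_c₂₁ : ContDiffOn ℝ ∞ N.c₂₁ W.domain :=
  N.contDiffOn_δ₁ W.isOpen_domain subset_rfl 3 N.contDiffOn_c₂

lemma hasCov_c₁₁ (hx : x ∈ W.domain) : N.HasCov 4 N.c₁₁ x (N.c₁₁₁ x) (N.c₁₁₂ x) :=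
  hasCov_of_contDiffAt N 4 (contDiffOn_c₁₁.contDiffAt (W.isOpen_domain.mem_nhds hx))

lemma hasCov_c₂₁ (hx : x ∈ W.domain) : N.HasCov 4 N.c₂₁ x (N.c₂₁₁ x) (N.c₂₁₂ x) :=
  hasCov_of_contDiffAt N 4 (contDiffOn_c₂₁.contDiffAt (W.isOpen_domain.mem_nhds hx))

lemma hasCov_zero (k : ℕ) : N.HasCov k (fun _ => 0) x 0 0 :=
  ⟨differentiableAt_const 0, by simp [δ₁], by simp [δ₂]⟩

/-- A solution has the covariant derivatives prescribed by the system, and satisfies the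
obstruction relation, near every point near `p`. -/
lemma IsSolutionNear.eventually_nhds_obstruction (hp : p ∈ W.domain)
    (h : N.IsSolutionNear p u v) : ∀ᶠ x in 𝓝 p, x ∈ W.domain ∧
      N.HasCov 1 u x (-(N.a x * N.δ₂ 1 v x + N.a₂ x * v x))
        (-(N.a x * N.δ₂ 1 v x + N.a₂ x * v x)) ∧
      N.HasCov 1 v x (N.a x * N.δ₂ 1 v x + N.a₂ x * v x) (N.δ₂ 1 v x) ∧
      ∀ᶠ y in 𝓝 x, N.c₀ y * N.δ₂ 1 v y + N.c₁ y * v y + N.c₂ y * u y = 0 := by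
  filter_upwards [h, (h.obstruction hp).eventually_nhds, W.isOpen_domain.mem_nhds hp]
    with x ⟨_, hv, hcu, hv1⟩ ho hx
  exact ⟨hx, hcu, (hasCov_of_contDiffAt N 1 hv).congr_deriv hv1 rfl, ho⟩

/-! ### Webs with an obstruction of the form `c₂ u` -/

/-- The obstruction is `c₂ u = 0`, so `u = 0`. Then `δ₁ u = 0` reads `a w + a₂ v = 0`, which gives
both derivatives of `v`. -/
lemma IsSolutionNear.of_c₁_eq_zero (hp : p ∈ W.domain) (h0 : VanishesNear N.c₀ p)
    (h1 : VanishesNear N.c₁ p) (h2 : N.c₂ p ≠ 0) (h : N.IsSolutionNear p u v) :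
    ∀ᶠ x in 𝓝 p, u x = 0 ∧ ContDiffAt ℝ ∞ v x ∧
      N.HasCov 1 v x (0 * v x) (-N.a₂ x / N.a x * v x) := by
  have h2' := (N.contDiffOn_c₂.continuousOn.continuousAt
    (W.isOpen_domain.mem_nhds hp)).eventually_ne h2
  have hu0 : ∀ᶠ x in 𝓝 p, u x = 0 := by
    filter_upwards [h.obstruction hp, h0, h1, h2'] with x ho e0 e1 e2
    rw [e0, e1] at ho
    simpa [e2] using ho
  filter_upwards [h, h.eventually_nhds_obstruction hp, hu0.eventually_nhds]
    with x hs ⟨hx, hcu, hcv, _⟩ hz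
  have n1 := N.a_ne_zero hx
  have e := (hcu.eq_zero hz).1
  refine ⟨hz.self_of_nhds, hs.2.1, hcv.congr_deriv (by linarith) ?_⟩
  field_simp
  linarith

lemma curvature_of_c₁_eq_zero (hx : x ∈ W.domain) :
    N.δ₁ 1 (fun y => -N.a₂ y / N.a y) x - N.δ₂ 1 (fun _ => 0) x + N.K x
      = -(N.J₄ x / N.a x ^ 2) := by
  have n1 := N.a_ne_zero hx
  rw [((hasCov_a₂ hx).neg.div_scalar (hasCov_a hx) n1).2.1, (hasCov_zero (N := N) 1).2.2, J₄]
  field_simp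
  ring

/-- The whole jet `(u, v, w)` is a multiple of `v`, so for a nonzero solution `v` has no zeros near
`p` and the scalar equation must be integrable. The other cases with `c₀ = 0` follow the same
pattern. -/
lemma rank_eq_one_imp_J₄ (hp : p ∈ W.domain) (h0 : VanishesNear N.c₀ p)
    (h1 : VanishesNear N.c₁ p) (h2 : N.c₂ p ≠ 0) (hr : W.rank p hp = 1) :
    VanishesNear N.J₄ p := by
  obtain ⟨u, v, h, hne⟩ := exists_solution_of_rank_eq_one (N := N) hp hr
  have hs := h.of_c₁_eq_zero hp h0 h1 h2
  filter_upwards [hs.eventually_nhds, (h.zero_or_ne_zero hp).resolve_left hne,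
    W.isOpen_domain.mem_nhds hp] with x hx hxne hxW
  have n1 := N.a_ne_zero hxW
  have hd := (hasCov_a₂ hxW).neg.div_scalar (hasCov_a hxW) n1
  have hv : v x ≠ 0 := by
    intro hv
    refine hxne ⟨hx.self_of_nhds.1, hv, ?_⟩
    rw [hx.self_of_nhds.2.2.2.2, hv, mul_zero]
  have k := closed_of_scalar_solution (z₁ := fun _ => 0) (z₂ := fun y => -N.a₂ y / N.a y) hxW
    (hx.mono fun y hy => hy.2) (differentiableAt_const 0) hd.1 hv
  rw [curvature_of_c₁_eq_zero hxW, neg_eq_zero, div_eq_zero_iff,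
    or_iff_left (pow_ne_zero 2 n1)] at k
  exact k

lemma rank_eq_one_of_J₄ (hp : p ∈ W.domain) (h0 : VanishesNear N.c₀ p)
    (h1 : VanishesNear N.c₁ p) (h2 : N.c₂ p ≠ 0) (hJ : VanishesNear N.J₄ p) :
    W.rank p hp = 1 := by
  obtain ⟨U, hU, hUo, hpU⟩ := eventually_nhds_iff.1 (hJ.and (W.isOpen_domain.mem_nhds hp))
  have hUW : U ⊆ W.domain := fun x hx => (hU x hx).2
  obtain ⟨f, hf1, hf⟩ := exists_scalar_solution (N := N) (z₁ := fun _ => 0)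
    (z₂ := fun y => -N.a₂ y / N.a y) hUo hUW hpU contDiffOn_const
    (((N.contDiffOn_a₂.neg).div N.a_smooth fun x hx => N.a_ne_zero hx).mono hUW) (fun x hx => by
      rw [curvature_of_c₁_eq_zero (hUW hx), (hU x hx).1, zero_div, neg_zero])
  have hsol : N.IsSolutionNear p (fun _ => 0) f := by
    refine isSolutionNear_of_hasCov ?_
    filter_upwards [hf, W.isOpen_domain.mem_nhds hp] with x hx hxW
    have n1 := N.a_ne_zero hxW
    refine ⟨contDiffAt_const, hx.1, -N.a₂ x / N.a x * f x,
      (hasCov_zero 1).congr_deriv ?_ ?_, hx.2.congr_deriv ?_ rfl⟩ <;>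
    · field_simp
      ring
  refine rank_eq_one_of_solution hp (b := 0) (c := 1) hsol (Or.inr (by rw [hf1]; norm_num)) ?_
  intro u v h hv
  have hx := (h.of_c₁_eq_zero hp h0 h1 h2).self_of_nhds
  have hv' : v p = 0 := by linarith
  refine h.eventually_eq_zero hp hx.1 hv' ?_
  rw [hx.2.2.2.2, hv', mul_zero]

/-! ### Webs with an obstruction of the form `c₁ (u + v)` -/

/-- The obstruction is `c₁ (u + v) = 0`. The derivative of `u + v = 0` in the second direction gives
`(1 - a) w = a₂ v`, and then `δ₁ v = a w + a₂ v = w`. -/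
lemma IsSolutionNear.of_c₁_eq_c₂ (hp : p ∈ W.domain) (h0 : VanishesNear N.c₀ p)
    (h12 : VanishesNear (fun x => N.c₁ x - N.c₂ x) p) (h1 : N.c₁ p ≠ 0)
    (h : N.IsSolutionNear p u v) :
    ∀ᶠ x in 𝓝 p, u x = -v x ∧ ContDiffAt ℝ ∞ v x ∧
      N.HasCov 1 v x (N.a₂ x / (1 - N.a x) * v x) (N.a₂ x / (1 - N.a x) * v x) := by
  have h1' := (N.contDiffOn_c₁.continuousOn.continuousAt
    (W.isOpen_domain.mem_nhds hp)).eventually_ne h1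
  have hu0 : ∀ᶠ x in 𝓝 p, u x + v x = 0 := by
    filter_upwards [h.obstruction hp, h0, h12, h1'] with x ho e0 e12 e1
    rw [e0, ← sub_eq_zero.1 e12] at ho
    apply mul_left_cancel₀ e1
    linear_combination ho
  filter_upwards [h, h.eventually_nhds_obstruction hp, hu0.eventually_nhds]
    with x hs ⟨hx, hcu, hcv, _⟩ hz
  have n1 := N.one_sub_a_ne_zero hx
  have e := ((hcu.add hcv).eq_zero hz).2
  have e' : N.δ₂ 1 v x = N.a₂ x / (1 - N.a x) * v x := by
    field_simp
    linarith
  refine ⟨by linarith [hz.self_of_nhds], hs.2.1, hcv.congr_deriv ?_ e'⟩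
  rw [← e']
  linarith

lemma hasCov_one_sub_a (hx : x ∈ W.domain) :
    N.HasCov 0 (fun y => 1 - N.a y) x (0 - N.a₁ x) (0 - N.a₂ x) :=
  (hasCov_const 1).sub (hasCov_a hx)

lemma curvature_of_c₁_eq_c₂ (hx : x ∈ W.domain) :
    N.δ₁ 1 (fun y => N.a₂ y / (1 - N.a y)) x - N.δ₂ 1 (fun y => N.a₂ y / (1 - N.a y)) x + N.K x
      = -(N.J₃ x / (1 - N.a x) ^ 2) := by
  have n1 := N.one_sub_a_ne_zero hx
  have h := (hasCov_a₂ hx).div_scalar (hasCov_one_sub_a hx) n1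
  rw [h.2.1, h.2.2, J₃]
  field_simp
  ring

lemma rank_eq_one_imp_J₃ (hp : p ∈ W.domain) (h0 : VanishesNear N.c₀ p)
    (h12 : VanishesNear (fun x => N.c₁ x - N.c₂ x) p) (h1 : N.c₁ p ≠ 0)
    (hr : W.rank p hp = 1) : VanishesNear N.J₃ p := by
  obtain ⟨u, v, h, hne⟩ := exists_solution_of_rank_eq_one (N := N) hp hr
  have hs := h.of_c₁_eq_c₂ hp h0 h12 h1
  filter_upwards [hs.eventually_nhds, (h.zero_or_ne_zero hp).resolve_left hne,
    W.isOpen_domain.mem_nhds hp] with x hx hxne hxW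
  have n1 := N.one_sub_a_ne_zero hxW
  have hd := (hasCov_a₂ hxW).div_scalar (hasCov_one_sub_a hxW) n1
  have hv : v x ≠ 0 := by
    intro hv
    refine hxne ⟨by rw [hx.self_of_nhds.1, hv, neg_zero], hv, ?_⟩
    rw [hx.self_of_nhds.2.2.2.2, hv, mul_zero]
  have k := closed_of_scalar_solution (z₁ := fun y => N.a₂ y / (1 - N.a y))
    (z₂ := fun y => N.a₂ y / (1 - N.a y)) hxW (hx.mono fun y hy => hy.2) hd.1 hd.1 hv
  rw [curvature_of_c₁_eq_c₂ hxW, neg_eq_zero, div_eq_zero_iff,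
    or_iff_left (pow_ne_zero 2 n1)] at k
  exact k

lemma rank_eq_one_of_J₃ (hp : p ∈ W.domain) (h0 : VanishesNear N.c₀ p)
    (h12 : VanishesNear (fun x => N.c₁ x - N.c₂ x) p) (h1 : N.c₁ p ≠ 0)
    (hJ : VanishesNear N.J₃ p) : W.rank p hp = 1 := by
  obtain ⟨U, hU, hUo, hpU⟩ := eventually_nhds_iff.1 (hJ.and (W.isOpen_domain.mem_nhds hp))
  have hUW : U ⊆ W.domain := fun x hx => (hU x hx).2
  have hsm : ContDiffOn ℝ ∞ (fun y => N.a₂ y / (1 - N.a y)) U :=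
    (N.contDiffOn_a₂.div (contDiffOn_const.sub N.a_smooth)
      fun x hx => N.one_sub_a_ne_zero hx).mono hUW
  obtain ⟨f, hf1, hf⟩ := exists_scalar_solution (N := N) hUo hUW hpU hsm hsm (fun x hx => by
      rw [curvature_of_c₁_eq_c₂ (hUW hx), (hU x hx).1, zero_div, neg_zero])
  have hsol : N.IsSolutionNear p (fun y => -f y) f := by
    refine isSolutionNear_of_hasCov ?_
    filter_upwards [hf, W.isOpen_domain.mem_nhds hp] with x hx hxW
    have n1 := N.one_sub_a_ne_zero hxW
    refine ⟨hx.1.neg, hx.1, N.a₂ x / (1 - N.a x) * f x,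
      hx.2.neg.congr_deriv ?_ ?_, hx.2.congr_deriv ?_ rfl⟩ <;>
    · field_simp
      ring
  refine rank_eq_one_of_solution hp (b := 0) (c := 1) hsol (Or.inr (by rw [hf1]; norm_num)) ?_
  intro u v h hv
  have hx := (h.of_c₁_eq_c₂ hp h0 h12 h1).self_of_nhds
  have hv' : v p = 0 := by linarith
  refine h.eventually_eq_zero hp (by rw [hx.1, hv', neg_zero]) hv' ?_
  rw [hx.2.2.2.2, hv', mul_zero]

/-! ### Webs with an obstruction `c₁ v + c₂ u`, where `c₁ (c₁ - c₂) ≠ 0` -/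

/-- The logarithmic derivative of `u`, in both directions, if `c₁ v + c₂ u = 0`. -/
def logDeriv (N : W.Normalization) (x : Plane) : ℝ :=
  (N.c₁ x * N.c₂₁ x - N.c₂ x * N.c₁₁ x) / (N.c₁ x * (N.c₁ x - N.c₂ x))

/-- The same function is the logarithmic derivative in both directions, so its integrability
condition is `d₁ - d₂ + K = 0`; clearing denominators turns this into `J₂ = 0`. -/
lemma hasCov_logDeriv (hx : x ∈ W.domain) (h1 : N.c₁ x ≠ 0) (h12 : N.c₁ x - N.c₂ x ≠ 0) :
    ∃ d₁ d₂, N.HasCov 1 N.logDeriv x d₁ d₂ ∧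
      (d₁ - d₂ + N.K x) * (N.c₁ x * (N.c₁ x - N.c₂ x)) ^ 2 = N.J₂ x := by
  have num : N.HasCov 7 (fun y => N.c₁ y * N.c₂₁ y - N.c₂ y * N.c₁₁ y) x _ _ :=
    ((hasCov_c₁ hx).mul (hasCov_c₂₁ hx)).sub ((hasCov_c₂ hx).mul (hasCov_c₁₁ hx))
  have den : N.HasCov 6 (fun y => N.c₁ y * (N.c₁ y - N.c₂ y)) x _ _ :=
    (hasCov_c₁ hx).mul ((hasCov_c₁ hx).sub (hasCov_c₂ hx))
  refine ⟨_, _, HasCov.div (k := 1) (l := 6) num den (mul_ne_zero h1 h12), ?_⟩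
  simp only [J₂]
  field_simp
  ring

lemma contDiffOn_logDeriv {U : Set Plane} (hUW : U ⊆ W.domain)
    (hU : ∀ x ∈ U, N.c₁ x ≠ 0 ∧ N.c₁ x - N.c₂ x ≠ 0) : ContDiffOn ℝ ∞ N.logDeriv U :=
  (((N.contDiffOn_c₁.mul contDiffOn_c₂₁).sub (N.contDiffOn_c₂.mul contDiffOn_c₁₁)).mono hUW).div
    ((N.contDiffOn_c₁.mul (N.contDiffOn_c₁.sub N.contDiffOn_c₂)).mono hUW)
    fun x hx => mul_ne_zero (hU x hx).1 (hU x hx).2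

lemma eventually_c₁_ne (hp : p ∈ W.domain) (h1 : N.c₁ p ≠ 0) (h12 : N.c₁ p ≠ N.c₂ p) :
    ∀ᶠ x in 𝓝 p, N.c₁ x ≠ 0 ∧ N.c₁ x - N.c₂ x ≠ 0 := by
  have hn := W.isOpen_domain.mem_nhds hp
  exact ((N.contDiffOn_c₁.continuousOn.continuousAt hn).eventually_ne h1).and
    (((N.contDiffOn_c₁.sub N.contDiffOn_c₂).continuousOn.continuousAt hn).eventually_ne
      (sub_ne_zero.2 h12))

/-- Differentiate `c₁ v + c₂ u = 0`. Because `δ₁ v = -δ₁ u`, the first direction determines `δ₁ u`,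
which is also `δ₂ u`. The second direction is then a condition on `u` alone, namely `J₁ u = 0`. -/
lemma IsSolutionNear.of_c₀_eq_zero (hp : p ∈ W.domain) (h0 : VanishesNear N.c₀ p)
    (h1 : N.c₁ p ≠ 0) (h12 : N.c₁ p ≠ N.c₂ p) (h : N.IsSolutionNear p u v) :
    ∀ᶠ x in 𝓝 p, v x = -(N.c₂ x / N.c₁ x * u x) ∧ N.J₁ x * u x = 0 ∧ ContDiffAt ℝ ∞ u x ∧
      N.HasCov 1 u x (N.logDeriv x * u x) (N.logDeriv x * u x) := by
  have hu0 : ∀ᶠ x in 𝓝 p, N.c₁ x * v x + N.c₂ x * u x = 0 := by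
    filter_upwards [h.obstruction hp, h0] with x ho e0
    rw [e0] at ho
    linarith
  filter_upwards [h, h.eventually_nhds_obstruction hp, hu0.eventually_nhds,
    eventually_c₁_ne hp h1 h12] with x hs ⟨hx, hcu, hcv, _⟩ hz ⟨n1, n12⟩
  obtain ⟨e1, e2⟩ := ((((hasCov_c₁ hx).mul hcv).add ((hasCov_c₂ hx).mul hcu)).eq_zero hz)
  have e0 := hz.self_of_nhds
  have e3 : -(N.a x * N.δ₂ 1 v x + N.a₂ x * v x) = N.logDeriv x * u x := by
    rw [logDeriv]
    field_simp
    linear_combination (-N.c₁ x) * e1 + N.c₁₁ x * e0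
  refine ⟨?_, ?_, hs.1, hcu.congr_deriv e3 e3⟩
  · field_simp
    linarith
  · simp only [J₁]
    linear_combination (N.c₁ x - N.c₂ x) * (N.a x * N.c₁ x * e2
      + (N.a₂ x * N.c₁ x - N.a x * N.c₁₂ x) * e0)
      - (N.c₁ x - N.a x * N.c₂ x) * (N.c₁ x * e1 - N.c₁₁ x * e0)

lemma rank_eq_one_imp_J₁_J₂ (hp : p ∈ W.domain) (h0 : VanishesNear N.c₀ p)
    (h1 : N.c₁ p ≠ 0) (h12 : N.c₁ p ≠ N.c₂ p) (hr : W.rank p hp = 1) :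
    VanishesNear N.J₁ p ∧ VanishesNear N.J₂ p := by
  obtain ⟨u, v, h, hne⟩ := exists_solution_of_rank_eq_one (N := N) hp hr
  have hs := h.of_c₀_eq_zero hp h0 h1 h12
  have key : ∀ᶠ x in 𝓝 p, N.J₁ x = 0 ∧ N.J₂ x = 0 := by
    filter_upwards [hs.eventually_nhds, (h.zero_or_ne_zero hp).resolve_left hne, h,
      W.isOpen_domain.mem_nhds hp, eventually_c₁_ne hp h1 h12]
      with x hx hxne hsol hxW ⟨n1, n12⟩
    obtain ⟨ev, eJ, -, hcu⟩ := hx.self_of_nhds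
    have hu : u x ≠ 0 := by
      intro hu
      have hv : v x = 0 := by rw [ev, hu, mul_zero, neg_zero]
      refine hxne ⟨hu, hv, ?_⟩
      have e := hsol.2.2.1.2.1
      rw [hcu.2.1, hu, hv] at e
      simpa [N.a_ne_zero hxW] using e
    obtain ⟨d₁, d₂, hd, hd'⟩ := hasCov_logDeriv hxW n1 n12
    have k := closed_of_scalar_solution (z₁ := N.logDeriv) (z₂ := N.logDeriv) hxW
      (hx.mono fun y hy => hy.2.2) hd.1 hd.1 hu
    rw [hd.2.1, hd.2.2] at k
    refine ⟨(mul_eq_zero.1 eJ).resolve_right hu, ?_⟩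
    rw [← hd', k, zero_mul]
  exact ⟨key.mono fun x hx => hx.1, key.mono fun x hx => hx.2⟩

lemma rank_eq_one_of_J₁_J₂ (hp : p ∈ W.domain) (h0 : VanishesNear N.c₀ p)
    (h1 : N.c₁ p ≠ 0) (h12 : N.c₁ p ≠ N.c₂ p) (hJ₁ : VanishesNear N.J₁ p)
    (hJ₂ : VanishesNear N.J₂ p) : W.rank p hp = 1 := by
  obtain ⟨U, hU, hUo, hpU⟩ := eventually_nhds_iff.1
    (hJ₂.and ((eventually_c₁_ne hp h1 h12).and (W.isOpen_domain.mem_nhds hp)))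
  have hUW : U ⊆ W.domain := fun x hx => (hU x hx).2.2
  have hsm : ContDiffOn ℝ ∞ N.logDeriv U := contDiffOn_logDeriv hUW fun x hx => (hU x hx).2.1
  obtain ⟨f, hf1, hf⟩ := exists_scalar_solution (N := N) hUo hUW hpU hsm hsm (fun x hx => by
    obtain ⟨e, ⟨n1, n12⟩, hxW⟩ := hU x hx
    obtain ⟨d₁, d₂, hd, hd'⟩ := hasCov_logDeriv hxW n1 n12
    rw [hd.2.1, hd.2.2]
    rw [e] at hd'
    exact (mul_eq_zero.1 hd').resolve_right (pow_ne_zero 2 (mul_ne_zero n1 n12)))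
  have hsol : N.IsSolutionNear p f (fun y => -(N.c₂ y / N.c₁ y * f y)) := by
    refine isSolutionNear_of_hasCov ?_
    filter_upwards [hf, hJ₁, eventually_c₁_ne hp h1 h12, W.isOpen_domain.mem_nhds hp]
      with x hx e1 ⟨n1, n12⟩ hxW
    have hn := W.isOpen_domain.mem_nhds hxW
    have hr : N.HasCov 0 (fun y => N.c₂ y / N.c₁ y) x _ _ :=
      HasCov.div (k := 0) (l := 3) (hasCov_c₂ hxW) (hasCov_c₁ hxW) n1
    have hv := (hr.mul hx.2).neg
    -- `J₁ = 0` makes `w`, computed as the second derivative of `v = -(c₂ / c₁) u`, satisfy `δ₁ u =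
    -- -(a w + a₂ v)`.
    have key : N.logDeriv x - N.a x * ((N.c₂₂ x - N.c₂ x / N.c₁ x * N.c₁₂ x) / N.c₁ x
        + N.c₂ x / N.c₁ x * N.logDeriv x) - N.a₂ x * (N.c₂ x / N.c₁ x) = 0 := by
      have e : N.logDeriv x - N.a x * ((N.c₂₂ x - N.c₂ x / N.c₁ x * N.c₁₂ x) / N.c₁ x
        + N.c₂ x / N.c₁ x * N.logDeriv x) - N.a₂ x * (N.c₂ x / N.c₁ x)
          = -(N.J₁ x / (N.c₁ x ^ 2 * (N.c₁ x - N.c₂ x))) := by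
        simp only [J₁, logDeriv]
        field_simp
        ring
      rw [e, e1, zero_div, neg_zero]
    -- This is `δ₁ v = -δ₁ u`, which holds by the choice of `logDeriv`.
    have key' : (N.c₂₁ x - N.c₂ x / N.c₁ x * N.c₁₁ x) / N.c₁ x
        + N.c₂ x / N.c₁ x * N.logDeriv x = N.logDeriv x := by
      simp only [logDeriv]
      field_simp
      ring
    refine ⟨hx.1, ((((N.contDiffOn_c₂.contDiffAt hn).div (N.contDiffOn_c₁.contDiffAt hn)
      n1).mul hx.1)).neg, _, hx.2.congr_deriv ?_ ?_, hv.congr_deriv ?_ rfl⟩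
    · linear_combination (f x) * key
    · linear_combination (f x) * key
    · linear_combination (-f x) * key' - (f x) * key
  refine rank_eq_one_of_solution hp (b := 1) (c := 0) hsol (Or.inl (by rw [hf1]; norm_num)) ?_
  intro u v h hu
  obtain ⟨ev, -, -, hcu⟩ := (h.of_c₀_eq_zero hp h0 h1 h12).self_of_nhds
  have hu' : u p = 0 := by linarith
  have hv : v p = 0 := by rw [ev, hu', mul_zero, neg_zero]
  refine h.eventually_eq_zero hp hu' hv ?_
  have e := h.self_of_nhds.2.2.1.2.1
  rw [hcu.2.1, hu', hv] at e
  simpa [N.a_ne_zero hp] using e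

/-! ### Webs with a nonzero coefficient `c₀` -/

lemma contDiffAt_G (hx : x ∈ W.domain) : ContDiffAt ℝ ∞ N.G₁₁ x ∧ ContDiffAt ℝ ∞ N.G₁₂ x ∧
    ContDiffAt ℝ ∞ N.G₂₁ x ∧ ContDiffAt ℝ ∞ N.G₂₂ x := by
  have hn := W.isOpen_domain.mem_nhds hx
  have ha := N.a_smooth.contDiffAt hn
  have ha1 := N.contDiffOn_a₁.contDiffAt hn
  have ha2 := N.contDiffOn_a₂.contDiffAt hn
  have ha12 := N.contDiffOn_a₁₂.contDiffAt hn
  have ha22 := N.contDiffOn_a₂₂.contDiffAt hn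
  have hK := N.contDiffOn_K.contDiffAt hn
  have hc0 := N.contDiffOn_c₀.contDiffAt hn
  have hc1 := N.contDiffOn_c₁.contDiffAt hn
  have hc2 := N.contDiffOn_c₂.contDiffAt hn
  have hc01 : ContDiffAt ℝ ∞ N.c₀₁ x :=
    (N.contDiffOn_δ₁ W.isOpen_domain subset_rfl 2 N.contDiffOn_c₀).contDiffAt hn
  have hc02 : ContDiffAt ℝ ∞ N.c₀₂ x :=
    (N.contDiffOn_δ₂ W.isOpen_domain subset_rfl 2 N.contDiffOn_c₀).contDiffAt hn
  have hc11 : ContDiffAt ℝ ∞ N.c₁₁ x :=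
    (N.contDiffOn_δ₁ W.isOpen_domain subset_rfl 3 N.contDiffOn_c₁).contDiffAt hn
  have hc12 : ContDiffAt ℝ ∞ N.c₁₂ x :=
    (N.contDiffOn_δ₂ W.isOpen_domain subset_rfl 3 N.contDiffOn_c₁).contDiffAt hn
  have hc21 : ContDiffAt ℝ ∞ N.c₂₁ x :=
    (N.contDiffOn_δ₁ W.isOpen_domain subset_rfl 3 N.contDiffOn_c₂).contDiffAt hn
  have hc22 : ContDiffAt ℝ ∞ N.c₂₂ x :=
    (N.contDiffOn_δ₂ W.isOpen_domain subset_rfl 3 N.contDiffOn_c₂).contDiffAt hn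
  refine ⟨?_, ?_, ?_, ?_⟩
  · unfold G₁₁
    fun_prop
  · unfold G₁₂
    fun_prop
  · unfold G₂₁
    fun_prop
  · unfold G₂₂
    fun_prop

lemma hasCov_G₂₁ (hx : x ∈ W.domain) : N.HasCov 6 N.G₂₁ x (N.δ₁ 6 N.G₂₁ x) (N.δ₂ 6 N.G₂₁ x) :=
  hasCov_of_contDiffAt N 6 (contDiffAt_G hx).2.2.1

lemma hasCov_G₂₂ (hx : x ∈ W.domain) : N.HasCov 6 N.G₂₂ x (N.δ₁ 6 N.G₂₂ x) (N.δ₂ 6 N.G₂₂ x) :=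
  hasCov_of_contDiffAt N 6 (contDiffAt_G hx).2.2.2

/-- The second obstructions: linear relations between `u` and `v`. -/
lemma IsSolutionNear.G_relations (hp : p ∈ W.domain) (h : N.IsSolutionNear p u v) :
    ∀ᶠ x in 𝓝 p, N.G₁₁ x * u x + N.G₁₂ x * v x = 0 ∧ N.G₂₁ x * u x + N.G₂₂ x * v x = 0 := by
  filter_upwards [h.eventually_nhds_obstruction hp, h.hasCov_w hp] with x ⟨hx, hcu, hcv, ho⟩ hcw
  have n1 := N.a_ne_zero hx
  have n2 := N.one_sub_a_ne_zero hx
  have L := ho.self_of_nhds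
  -- Differentiate the obstruction in both directions. As `rᵢ` is `a qᵢ` plus known terms, `a (e1 -
  -- e2)` contains `qᵢ` only through the polynomial `a (1 - a) qᵢ`, and `e1 - a e2` does not contain
  -- it at all. The relation `L` then removes `w`.
  obtain ⟨e1, e2⟩ := ((((hasCov_c₀ hx).mul hcw).add ((hasCov_c₁ hx).mul hcv)).add
    ((hasCov_c₂ hx).mul hcu)).eq_zero ho
  constructor
  · have k0 : N.a x * (1 - N.a x) * N.q₀ x = N.a₁ x + 3 * N.a x * N.a₂ x - 2 * N.a₂ x := by
      simp only [q₀]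
      field_simp
      ring
    have k1 : N.a x * (1 - N.a x) * N.q₁ x
        = N.a x * (N.a₂₂ x - N.K x) + N.a₁₂ x + N.a₂ x ^ 2 - N.a₂₂ x := by
      simp only [q₁]
      field_simp
    have k2 : N.a x * (1 - N.a x) * N.q₂ x = -N.K x := by
      simp only [q₂]
      field_simp
    simp only [r₀, r₁, r₂] at e1
    simp only [G₁₁, G₁₂]
    linear_combination (-N.a x * N.c₀ x) * (e1 - e2)
      + N.a x * (N.c₀₁ x - N.c₀₂ x + N.c₀ x * (N.a x * N.q₀ x + 2 * N.a₂ x - N.q₀ x) + (N.a x - 1) * N.c₁ x) * L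
      - (N.c₀ x ^ 2 * N.δ₂ 1 v x - N.c₀ x * (N.c₀ x * N.δ₂ 1 v x + N.c₁ x * v x + N.c₂ x * u x)) * k0
      - (N.c₀ x ^ 2 * v x) * k1 - (N.c₀ x ^ 2 * u x) * k2
  · simp only [r₀, r₁, r₂] at e1
    simp only [G₂₁, G₂₂]
    linear_combination N.c₀ x * (e1 - N.a x * e2)
      - (N.c₀₁ x - N.a x * N.c₀₂ x + 2 * N.a₂ x * N.c₀ x
        - N.a x * N.c₂ x + N.a x * N.a x * N.c₂ x) * L

lemma eventually_c₀_ne (hp : p ∈ W.domain) (h0 : N.c₀ p ≠ 0) : ∀ᶠ x in 𝓝 p, N.c₀ x ≠ 0 :=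
  (N.contDiffOn_c₀.continuousOn.continuousAt (W.isOpen_domain.mem_nhds hp)).eventually_ne h0

lemma rank_eq_one_imp_J₁₀_J₁₁_J₁₂ (hp : p ∈ W.domain) (h0 : N.c₀ p ≠ 0)
    (hr : W.rank p hp = 1) :
    VanishesNear N.J₁₀ p ∧ VanishesNear N.J₁₁ p ∧ VanishesNear N.J₁₂ p := by
  obtain ⟨u, v, h, hne⟩ := exists_solution_of_rank_eq_one (N := N) hp hr
  have key : ∀ᶠ x in 𝓝 p, N.J₁₀ x = 0 ∧ N.J₁₁ x = 0 ∧ N.J₁₂ x = 0 := by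
    filter_upwards [h.eventually_nhds_obstruction hp, (h.G_relations hp).eventually_nhds,
      (h.zero_or_ne_zero hp).resolve_left hne, eventually_c₀_ne hp h0]
      with x ⟨hx, hcu, hcv, ho⟩ hG hxne n0
    have L := ho.self_of_nhds
    obtain ⟨g1, g2⟩ := hG.self_of_nhds
    obtain ⟨e1, e2⟩ := (((hasCov_G₂₁ hx).mul hcu).add ((hasCov_G₂₂ hx).mul hcv)).eq_zero
      (hG.mono fun y hy => hy.2)
    have huv : u x ≠ 0 ∨ v x ≠ 0 := by
      by_contra! hcon
      refine hxne ⟨hcon.1, hcon.2, ?_⟩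
      rw [hcon.1, hcon.2] at L
      simpa [n0] using L
    -- The second row of `G` annihilates the nonzero vector `(u, v)`, hence is a multiple of `(v,
    -- -u)`, possibly zero. This makes `J₁₀`, `J₁₁`, `J₁₂` multiples of known relations.
    obtain ⟨t, t1, t2⟩ : ∃ t, N.G₂₁ x = t * v x ∧ N.G₂₂ x = -t * u x := by
      rcases huv with hu | hv
      · refine ⟨-N.G₂₂ x / u x, ?_, ?_⟩
        · field_simp
          linarith
        · field_simp
      · refine ⟨N.G₂₁ x / v x, ?_, ?_⟩
        · field_simp
        · field_simp
          linarith
    refine ⟨?_, ?_, ?_⟩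
    · rw [J₁₀, t1, t2]
      linear_combination (-t) * g1
    · simp only [J₁₁]
      rw [t1, t2] at e1 ⊢
      linear_combination (-N.c₀ x * t) * e1 - (N.a x * t ^ 2 * (u x + v x)) * L
    · simp only [J₁₂]
      rw [t1, t2] at e2 ⊢
      linear_combination (-N.c₀ x * t) * e2 - (t ^ 2 * (N.a x * v x + u x)) * L
  exact ⟨key.mono fun x hx => hx.1, key.mono fun x hx => hx.2.1, key.mono fun x hx => hx.2.2⟩

/-! #### The case of a reduced system of rank two -/

/-- The coefficient of `v` in `w`, from the obstruction relation. -/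
def wv (N : W.Normalization) (x : Plane) : ℝ := -N.c₁ x / N.c₀ x

/-- The coefficient of `u` in `w`, from the obstruction relation. -/
def wu (N : W.Normalization) (x : Plane) : ℝ := -N.c₂ x / N.c₀ x

lemma hasCov_wv (hx : x ∈ W.domain) (h0 : N.c₀ x ≠ 0) : N.HasCov 1 N.wv x
    ((-N.c₁₁ x - N.wv x * N.c₀₁ x) / N.c₀ x) ((-N.c₁₂ x - N.wv x * N.c₀₂ x) / N.c₀ x) :=
  HasCov.div (k := 1) (l := 2) (hasCov_c₁ hx).neg (hasCov_c₀ hx) h0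

lemma hasCov_wu (hx : x ∈ W.domain) (h0 : N.c₀ x ≠ 0) : N.HasCov 1 N.wu x
    ((-N.c₂₁ x - N.wu x * N.c₀₁ x) / N.c₀ x) ((-N.c₂₂ x - N.wu x * N.c₀₂ x) / N.c₀ x) :=
  HasCov.div (k := 1) (l := 2) (hasCov_c₂ hx).neg (hasCov_c₀ hx) h0

/-- The matrix of the derivatives in the first direction, for `(u, v)`. -/
def reduced₁ (N : W.Normalization) : Fin 2 → Fin 2 → Plane → ℝ :=
  ![![fun x => -(N.a x * N.wu x), fun x => -(N.a x * N.wv x + N.a₂ x)],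
    ![fun x => N.a x * N.wu x, fun x => N.a x * N.wv x + N.a₂ x]]

/-- The matrix of the derivatives in the second direction, for `(u, v)`. -/
def reduced₂ (N : W.Normalization) : Fin 2 → Fin 2 → Plane → ℝ :=
  ![![fun x => -(N.a x * N.wu x), fun x => -(N.a x * N.wv x + N.a₂ x)], ![N.wu, N.wv]]

/-- The four entries of the curvature of the reduced system are the `Gᵢⱼ`, up to sign and powers of
`c₀`. -/
lemma reduced_flat (hx : x ∈ W.domain) (h0 : N.c₀ x ≠ 0) (h11 : N.G₁₁ x = 0) (h12 : N.G₁₂ x = 0)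
    (h21 : N.G₂₁ x = 0) (h22 : N.G₂₂ x = 0) (j l : Fin 2) :
    N.δ₁ 1 (N.reduced₂ j l) x - N.δ₂ 1 (N.reduced₁ j l) x + (if j = l then 1 else 0) * N.K x
      = ∑ m, (N.reduced₁ j m x * N.reduced₂ m l x - N.reduced₂ j m x * N.reduced₁ m l x) := by
  have hv := hasCov_wv hx h0
  have hu := hasCov_wu hx h0
  have hav := ((hasCov_a hx).mul hv).add (hasCov_a₂ hx)
  have hau := (hasCov_a hx).mul hu
  simp only [G₁₁] at h11
  simp only [G₁₂] at h12
  simp only [G₂₁] at h21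
  simp only [G₂₂] at h22
  simp only [Fin.sum_univ_two]
  fin_cases j <;> fin_cases l <;>
    simp [-neg_add_rev, reduced₁, reduced₂, hv.2.1, hu.2.1, hav.2.2, hau.2.2, hav.neg.2.1,
      hav.neg.2.2, hau.neg.2.1, hau.neg.2.2] <;>
    simp only [wv, wu] <;> field_simp
  · linear_combination (-1 : ℝ) * h11
  · linear_combination (-1 : ℝ) * h12
  · linear_combination (-1 : ℝ) * h21
  · linear_combination (-1 : ℝ) * h22

lemma contDiffOn_reduced {U : Set Plane} (hUW : U ⊆ W.domain) (hU : ∀ x ∈ U, N.c₀ x ≠ 0)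
    (j l : Fin 2) : ContDiffOn ℝ ∞ (N.reduced₁ j l) U ∧ ContDiffOn ℝ ∞ (N.reduced₂ j l) U := by
  have hv : ContDiffOn ℝ ∞ N.wv U :=
    (N.contDiffOn_c₁.mono hUW).neg.div (N.contDiffOn_c₀.mono hUW) hU
  have hu : ContDiffOn ℝ ∞ N.wu U :=
    (N.contDiffOn_c₂.mono hUW).neg.div (N.contDiffOn_c₀.mono hUW) hU
  have ha := N.a_smooth.mono hUW
  have ha2 := N.contDiffOn_a₂.mono hUW
  have hau := ha.mul hu
  have hav := (ha.mul hv).add ha2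
  fin_cases j <;> fin_cases l
  · exact ⟨hau.neg, hau.neg⟩
  · exact ⟨hav.neg, hav.neg⟩
  · exact ⟨hau, hu⟩
  · exact ⟨hav, hv⟩

/-- If all the second obstructions vanish, then the web does not have rank one. -/
lemma rank_ne_one_of_G_eq_zero (hp : p ∈ W.domain) (h0 : N.c₀ p ≠ 0)
    (hG : VanishesNear N.G₁₁ p ∧ VanishesNear N.G₁₂ p ∧ VanishesNear N.G₂₁ p ∧
      VanishesNear N.G₂₂ p) : W.rank p hp ≠ 1 := by
  intro hr
  obtain ⟨U, hU, hUo, hpU⟩ := eventually_nhds_iff.1 ((hG.1.and (hG.2.1.and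
    (hG.2.2.1.and hG.2.2.2))).and ((eventually_c₀_ne hp h0).and (W.isOpen_domain.mem_nhds hp)))
  have hUW : U ⊆ W.domain := fun x hx => (hU x hx).2.2
  have key : ∀ s₀ : Fin 2 → ℝ, ∃ u v, N.IsSolutionNear p u v ∧ u p = s₀ 0 ∧ v p = s₀ 1 := by
    intro s₀
    obtain ⟨s, hs0, hs⟩ := exists_cov_solution (N := N) (k := fun _ => 1) hUo hUW hpU
      (M₁ := N.reduced₁) (M₂ := N.reduced₂) (by simp)
      (fun j l => (contDiffOn_reduced hUW (fun x hx => (hU x hx).2.1) j l).1)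
      (fun j l => (contDiffOn_reduced hUW (fun x hx => (hU x hx).2.1) j l).2) (by
        intro x hx j l
        obtain ⟨⟨e11, e12, e21, e22⟩, n0, hxW⟩ := hU x hx
        simpa using reduced_flat hxW n0 e11 e12 e21 e22 j l) s₀
    refine ⟨s 0, s 1, isSolutionNear_of_hasCov (hs.mono fun x hx => ⟨(hx 0).1, (hx 1).1,
      N.wu x * s 0 x + N.wv x * s 1 x, (hx 0).2.congr_deriv ?_ ?_,
      (hx 1).2.congr_deriv ?_ ?_⟩), hs0 0, hs0 1⟩ <;>
      simp only [Fin.sum_univ_two] <;> simp [reduced₁, reduced₂] <;> ring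
  obtain ⟨u, v, h, hu, hv⟩ := key ![1, 0]
  obtain ⟨u', v', h', hu', hv'⟩ := key ![0, 1]
  have e := mul_eq_mul_of_rank_eq_one hp hr h h'
  rw [hu, hv, hu', hv'] at e
  simp at e

/-! #### The case of a reduced system of rank one, solved for `u` -/

/-- The ratio `u / v`, from the second obstruction. -/
def ratio₁ (N : W.Normalization) (x : Plane) : ℝ := -N.G₂₂ x / N.G₂₁ x

/-- The ratio `w / v`, from both obstructions. -/
def slope₁ (N : W.Normalization) (x : Plane) : ℝ := -(N.c₁ x + N.c₂ x * N.ratio₁ x) / N.c₀ x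

/-- `J₁₁ = J₁₂ = 0` says that the ratio `t = u / v` prescribed by the second row of `G` has the
derivatives that the system forces on it when `w` is `slope₁` times `v`. -/
lemma hasCov_ratio₁ (hx : x ∈ W.domain) (h0 : N.c₀ x ≠ 0) (hG : N.G₂₁ x ≠ 0) (h11 : N.J₁₁ x = 0)
    (h12 : N.J₁₂ x = 0) : N.HasCov 0 N.ratio₁ x
      (-((N.a x * N.slope₁ x + N.a₂ x) * (1 + N.ratio₁ x)))
      (-(N.ratio₁ x * N.slope₁ x + (N.a x * N.slope₁ x + N.a₂ x))) := by
  have h : N.HasCov 0 N.ratio₁ x _ _ :=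
    HasCov.div (k := 0) (l := 6) (hasCov_G₂₂ hx).neg (hasCov_G₂₁ hx) hG
  simp only [J₁₁] at h11
  simp only [J₁₂] at h12
  refine h.congr_deriv ?_ ?_
  · simp only [slope₁, ratio₁]
    field_simp
    linear_combination h11
  · simp only [slope₁, ratio₁]
    field_simp
    linear_combination h12

/-- The integrability condition comes from the commutator on `v`, so it is the second relation `G₂₁
t + G₂₂ = 0`, true by the definition of the ratio `t`. -/
lemma hasCov_slope₁ (hx : x ∈ W.domain) (h0 : N.c₀ x ≠ 0) (hG : N.G₂₁ x ≠ 0)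
    (h11 : N.J₁₁ x = 0) (h12 : N.J₁₂ x = 0) : ∃ d₁ d₂, N.HasCov 1 N.slope₁ x d₁ d₂ ∧
      d₁ - (N.a₂ x * N.slope₁ x + N.a x * d₂ + N.a₂₂ x) + N.K x = 0 := by
  have h : N.HasCov 1 N.slope₁ x _ _ := HasCov.div (k := 1) (l := 2)
    ((hasCov_c₁ hx).add ((hasCov_c₂ hx).mul (hasCov_ratio₁ hx h0 hG h11 h12))).neg
    (hasCov_c₀ hx) h0
  refine ⟨_, _, h, ?_⟩
  have e : N.G₂₁ x * N.ratio₁ x + N.G₂₂ x = 0 := by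
    simp only [ratio₁]
    field_simp
    ring
  simp only [G₂₁, G₂₂] at e
  simp only [slope₁]
  generalize N.ratio₁ x = t at e
  field_simp
  linear_combination (-1 : ℝ) * e

lemma rank_eq_one_of_G₂₁_ne_zero (hp : p ∈ W.domain) (h0 : N.c₀ p ≠ 0) (hG : N.G₂₁ p ≠ 0)
    (h11 : VanishesNear N.J₁₁ p) (h12 : VanishesNear N.J₁₂ p) : W.rank p hp = 1 := by
  obtain ⟨U, hU, hUo, hpU⟩ := eventually_nhds_iff.1 ((h11.and h12).and
    (((contDiffAt_G hp).2.2.1.continuousAt.eventually_ne hG).and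
      ((eventually_c₀_ne hp h0).and (W.isOpen_domain.mem_nhds hp))))
  have hUW : U ⊆ W.domain := fun x hx => (hU x hx).2.2.2
  have ht : ContDiffOn ℝ ∞ N.ratio₁ U := fun x hx =>
    ((contDiffAt_G (hUW hx)).2.2.2.neg.div (contDiffAt_G (hUW hx)).2.2.1
      (hU x hx).2.1).contDiffWithinAt
  have hy : ContDiffOn ℝ ∞ N.slope₁ U :=
    ((N.contDiffOn_c₁.mono hUW).add ((N.contDiffOn_c₂.mono hUW).mul ht)).neg.div
      (N.contDiffOn_c₀.mono hUW) fun x hx => (hU x hx).2.2.1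
  obtain ⟨f, hf1, hf⟩ := exists_scalar_solution (N := N)
    (z₁ := fun y => N.a y * N.slope₁ y + N.a₂ y) (z₂ := N.slope₁) hUo hUW hpU
    (((N.a_smooth.mono hUW).mul hy).add (N.contDiffOn_a₂.mono hUW)) hy (fun x hx => by
      obtain ⟨⟨e11, e12⟩, eG, e0, hxW⟩ := hU x hx
      obtain ⟨d₁, d₂, hd, hd'⟩ := hasCov_slope₁ hxW e0 eG e11 e12
      have hz : N.HasCov 1 (fun y => N.a y * N.slope₁ y + N.a₂ y) x _ _ :=
        ((hasCov_a hxW).mul hd).add (hasCov_a₂ hxW)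
      rw [hd.2.1, hz.2.2]
      linear_combination hd')
  have hsol : N.IsSolutionNear p (fun y => N.ratio₁ y * f y) f := by
    refine isSolutionNear_of_hasCov ?_
    filter_upwards [hf, hUo.mem_nhds hpU] with x hx hxU
    obtain ⟨⟨e11, e12⟩, eG, e0, hxW⟩ := hU x hxU
    have hu := (hasCov_ratio₁ hxW e0 eG e11 e12).mul hx.2
    exact ⟨(ht.contDiffAt (hUo.mem_nhds hxU)).mul hx.1, hx.1, N.slope₁ x * f x,
      hu.congr_deriv (by ring) (by ring), hx.2.congr_deriv (by ring) rfl⟩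
  refine rank_eq_one_of_solution hp (b := 0) (c := 1) hsol (Or.inr (by rw [hf1]; norm_num)) ?_
  intro u v h hv
  have hv' : v p = 0 := by linarith
  have e := (h.G_relations hp).self_of_nhds.2
  have hu' : u p = 0 := by simpa [hv', hG] using e
  have ho := (h.obstruction hp).self_of_nhds
  exact h.eventually_eq_zero hp hu' hv' (by simpa [hu', hv', h0] using ho)

/-! #### The case of a reduced system of rank one, solved for `v` -/

/-- The ratio `v / u`, from the second obstruction. -/
def ratio₂ (N : W.Normalization) (x : Plane) : ℝ := -N.G₂₁ x / N.G₂₂ x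

/-- The ratio `w / u`, from both obstructions. -/
def slope₂ (N : W.Normalization) (x : Plane) : ℝ := -(N.c₁ x * N.ratio₂ x + N.c₂ x) / N.c₀ x

/-- The logarithmic derivative of `u`, in both directions. -/
def logDeriv₂ (N : W.Normalization) (x : Plane) : ℝ :=
  -(N.a x * N.slope₂ x + N.a₂ x * N.ratio₂ x)

lemma hasCov_ratio₂ (hx : x ∈ W.domain) (h0 : N.c₀ x ≠ 0) (hG : N.G₂₂ x ≠ 0) (h11 : N.J₁₁ x = 0)
    (h12 : N.J₁₂ x = 0) : N.HasCov 0 N.ratio₂ x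
      (-((N.ratio₂ x + 1) * N.logDeriv₂ x)) (N.slope₂ x - N.ratio₂ x * N.logDeriv₂ x) := by
  have h : N.HasCov 0 N.ratio₂ x _ _ :=
    HasCov.div (k := 0) (l := 6) (hasCov_G₂₁ hx).neg (hasCov_G₂₂ hx) hG
  simp only [J₁₁] at h11
  simp only [J₁₂] at h12
  refine h.congr_deriv ?_ ?_
  · simp only [logDeriv₂, slope₂, ratio₂]
    field_simp
    linear_combination (-1 : ℝ) * h11
  · simp only [logDeriv₂, slope₂, ratio₂]
    field_simp
    linear_combination (-1 : ℝ) * h12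

/-- Here the commutator acts on `u`, so the integrability condition is the first relation `G₁₁ + G₁₂
t = 0`. The vanishing determinant `J₁₀` deduces it from the second. -/
lemma hasCov_logDeriv₂ (hx : x ∈ W.domain) (h0 : N.c₀ x ≠ 0) (hG : N.G₂₂ x ≠ 0)
    (h10 : N.J₁₀ x = 0) (h11 : N.J₁₁ x = 0) (h12 : N.J₁₂ x = 0) :
    ∃ d₁ d₂, N.HasCov 1 N.logDeriv₂ x d₁ d₂ ∧ d₁ - d₂ + N.K x = 0 := by
  have ht := hasCov_ratio₂ hx h0 hG h11 h12
  have hy : N.HasCov 1 N.slope₂ x _ _ := HasCov.div (k := 1) (l := 2)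
    (((hasCov_c₁ hx).mul ht).add (hasCov_c₂ hx)).neg (hasCov_c₀ hx) h0
  have h : N.HasCov 1 N.logDeriv₂ x _ _ :=
    (((hasCov_a hx).mul hy).add ((hasCov_a₂ hx).mul ht)).neg
  refine ⟨_, _, h, ?_⟩
  have e : N.G₁₁ x + N.G₁₂ x * N.ratio₂ x = 0 := by
    rw [J₁₀] at h10
    simp only [ratio₂]
    field_simp
    linear_combination h10
  simp only [G₁₁, G₁₂] at e
  simp only [logDeriv₂, slope₂]
  generalize N.ratio₂ x = t at e
  field_simp
  linear_combination (-1 : ℝ) * e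

lemma rank_eq_one_of_G₂₂_ne_zero (hp : p ∈ W.domain) (h0 : N.c₀ p ≠ 0) (hG : N.G₂₂ p ≠ 0)
    (h10 : VanishesNear N.J₁₀ p) (h11 : VanishesNear N.J₁₁ p) (h12 : VanishesNear N.J₁₂ p) :
    W.rank p hp = 1 := by
  obtain ⟨U, hU, hUo, hpU⟩ := eventually_nhds_iff.1 ((h10.and (h11.and h12)).and
    (((contDiffAt_G hp).2.2.2.continuousAt.eventually_ne hG).and
      ((eventually_c₀_ne hp h0).and (W.isOpen_domain.mem_nhds hp))))
  have hUW : U ⊆ W.domain := fun x hx => (hU x hx).2.2.2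
  have ht : ContDiffOn ℝ ∞ N.ratio₂ U := fun x hx =>
    ((contDiffAt_G (hUW hx)).2.2.1.neg.div (contDiffAt_G (hUW hx)).2.2.2
      (hU x hx).2.1).contDiffWithinAt
  have hy : ContDiffOn ℝ ∞ N.slope₂ U :=
    (((N.contDiffOn_c₁.mono hUW).mul ht).add (N.contDiffOn_c₂.mono hUW)).neg.div
      (N.contDiffOn_c₀.mono hUW) fun x hx => (hU x hx).2.2.1
  have hz : ContDiffOn ℝ ∞ N.logDeriv₂ U :=
    (((N.a_smooth.mono hUW).mul hy).add ((N.contDiffOn_a₂.mono hUW).mul ht)).neg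
  obtain ⟨f, hf1, hf⟩ := exists_scalar_solution (N := N) hUo hUW hpU hz hz (fun x hx => by
      obtain ⟨⟨e10, e11, e12⟩, eG, e0, hxW⟩ := hU x hx
      obtain ⟨d₁, d₂, hd, hd'⟩ := hasCov_logDeriv₂ hxW e0 eG e10 e11 e12
      rw [hd.2.1, hd.2.2, hd'])
  have hsol : N.IsSolutionNear p f (fun y => N.ratio₂ y * f y) := by
    refine isSolutionNear_of_hasCov ?_
    filter_upwards [hf, hUo.mem_nhds hpU] with x hx hxU
    obtain ⟨⟨e10, e11, e12⟩, eG, e0, hxW⟩ := hU x hxU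
    have hv := (hasCov_ratio₂ hxW e0 eG e11 e12).mul hx.2
    have e : N.logDeriv₂ x = -(N.a x * N.slope₂ x + N.a₂ x * N.ratio₂ x) := rfl
    exact ⟨hx.1, (ht.contDiffAt (hUo.mem_nhds hxU)).mul hx.1, N.slope₂ x * f x,
      hx.2.congr_deriv (by rw [e]; ring) (by rw [e]; ring),
      hv.congr_deriv (by rw [e]; ring) (by ring)⟩
  refine rank_eq_one_of_solution hp (b := 1) (c := 0) hsol (Or.inl (by rw [hf1]; norm_num)) ?_
  intro u v h hu
  have hu' : u p = 0 := by linarith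
  have e := (h.G_relations hp).self_of_nhds.2
  have hv' : v p = 0 := by simpa [hu', hG] using e
  have ho := (h.obstruction hp).self_of_nhds
  exact h.eventually_eq_zero hp hu' hv' (by simpa [hu', hv', h0] using ho)

end FourWeb.Normalization

end PlanarWeb

end

/-! ### Assembling the cases -/

theorem theorem6 (W : PlanarWeb.FourWeb) (N : W.Normalization)
    (p : PlanarWeb.Plane) (hp : p ∈ W.domain)
    (h₀ : PlanarWeb.RegularAt N.c₀ p)
    (h₁ : PlanarWeb.VanishesNear N.c₀ p →
      PlanarWeb.RegularAt N.c₁ p ∧ PlanarWeb.RegularAt (fun x => N.c₁ x - N.c₂ x) p) :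
    (W.rank p hp = 1 → N.Case1 p ∨ N.Case2 p ∨ N.Case3 p ∨ N.Case4 p) ∧
    ((N.c₀ p ≠ 0 → N.G₂₁ p ≠ 0 ∨ N.G₂₂ p ≠ 0) →
      N.Case1 p ∨ N.Case2 p ∨ N.Case3 p ∨ N.Case4 p → W.rank p hp = 1) := by
  open PlanarWeb.FourWeb.Normalization in
  constructor
  · intro hr
    rcases h₀ with h0 | h0
    -- Regularity leaves four combinations. If `c₁` and `c₁ - c₂` both vanish, so does `c₂`, the
    -- obstruction is trivial and the rank is not one; the other three are the cases 3, 2 and 1.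
    · obtain ⟨h1 | h1, h12 | h12⟩ := h₁ h0
      · refine absurd hr (rank_ne_one_of_obstruction_eq_zero hp h0 h1 ?_)
        filter_upwards [h1, h12] with x e1 e12
        linarith
      · have e1 : N.c₁ p = 0 := h1.self_of_nhds
        have h2 : N.c₂ p ≠ 0 := fun e2 => h12 (by simp only [e1, e2, sub_zero])
        exact Or.inr (Or.inr (Or.inl ⟨h0, h1, h2, rank_eq_one_imp_J₄ hp h0 h1 h2 hr⟩))
      · exact Or.inr (Or.inl ⟨h0, h12, h1, rank_eq_one_imp_J₃ hp h0 h12 h1 hr⟩)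
      · have h12' := sub_ne_zero.1 h12
        obtain ⟨hJ₁, hJ₂⟩ := rank_eq_one_imp_J₁_J₂ hp h0 h1 h12' hr
        exact Or.inl ⟨h0, hJ₁, hJ₂, h12', h1⟩
    · obtain ⟨h10, h11, h12⟩ := rank_eq_one_imp_J₁₀_J₁₁_J₁₂ hp h0 hr
      exact Or.inr (Or.inr (Or.inr ⟨h0, h10, h11, h12,
        fun hG => rank_ne_one_of_G_eq_zero hp h0 hG hr⟩))
  · rintro hG (⟨h0, hJ₁, hJ₂, h12, h1⟩ | ⟨h0, h12, h1, hJ⟩ | ⟨h0, h1, h2, hJ⟩ |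
      ⟨h0, h10, h11, h12, -⟩)
    · exact rank_eq_one_of_J₁_J₂ hp h0 h1 h12 hJ₁ hJ₂
    · exact rank_eq_one_of_J₃ hp h0 h12 h1 hJ
    · exact rank_eq_one_of_J₄ hp h0 h1 h2 hJ
    · rcases hG h0 with hG | hG
      · exact rank_eq_one_of_G₂₁_ne_zero hp h0 hG h11 h12
      · exact rank_eq_one_of_G₂₂_ne_zero hp h0 hG h10 h11 h12
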